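/- Let $n\ge 1$ and let $\boldsymbol\Omega=\{\Omega_i\}_{i=1}^m$ be a multi-region configuration in $\mathbb R^{n+1}$: the $\Omega_i$ are compact connected $(n+1)$-dimensional regions which are smooth manifolds with boundaries and corners (near each of its points, $\Omega_i$ is diffeomorphic, through a local diffeomorphism of $\mathbb R^{n+1}$, to $\mathbb R_{\ge 0}^k\times\mathbb R^{n+1-k}$ for some $0\le k\le n+1$; points with $k\ge 2$ are the singular boundary points), with boundaries $\mathcal B_i$; distinct regions meet only along their boundaries; and near a point lying in more than one region the union of the boundaries of the regions containing it is locally diffeomorphic to one of the models $P_k$ ($1\le k\le n+1$) or $Q_k$ ($1\le k\le n$). Here, writing $\mathbb R^{n+1}=L_k\times\mathbb R^{n+1-k}$ with $L_k=\{y\in\mathbb R^{k+1}:\sum_i y_i=0\}$, $P_k$ is the set of points whose $L_k$-component $y$ attains its minimal coordinate at least twice, and $Q_k$ is the hyperplane $\{x_{n+1}=0\}$ together with $P_k\cap\{x_{n+1}\ge 0\}$. Suppose that each $\Omega_i$ has a generic Blum medial axis, as is the case for every configuration with a Blum medial linking structure or a full Blum linking structure. (The further conditions of such a structure, on linking in the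 exterior and between adjoining regions, are not needed.) This means the following. Let $\rho(y,u)=\|y-u\|^2$. The interior medial axis of $\Omega_i$ is the set of $u\in\operatorname{int}\Omega_i$ for which the absolute minimum of $\rho(\cdot,u)$ on $\mathcal B_i$ occurs at more than one point or is degenerate. Generic means that at each of its points $u$ and for every finite nonempty set $S$ of minimum points of $\rho(\cdot,u)|_{\mathcal B_i}$, the multigerm of $\rho$ on $\mathcal B_i\times\mathbb R^{n+1}$ at $S\times\{u\}$ is a versal unfolding for $\mathcal R^+$-equivalence, except possibly at finitely many points $u$ each having a single closest boundary point (such as generic $\tilde E_7$-points when $n+1=7$). Let $M_i$ be the Blum medial axis of $\Omega_i$, i.e. the interior medial axis together with the singular boundary points. Let $\tilde M_i$ be its double: the set of pairs $(x,U)$ with $x\in M_i$ and $x+U$ a point of $\mathcal B_i$ closest to $x$. Let $\psi_i(x,U)=x+U$ be the radial map $\tilde M_i\to\mathcal B_i$. At $(x,U)$, put $r_i=\|U\|$ and $\mathbf u=U/\|U\|$. Over the regular part of $M_i$ (the points near which $M_i$ is a smooth hypersurface) let $S_{rad}(v)=-\operatorname{proj}_U(\partial\mathbf u/\partial v)$ for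 $v\in T_xM_i$, where $\mathbf u$ is extended along $M_i$ by the corresponding smooth value of $U$ and $\operatorname{proj}_U$ is the projection onto $T_xM_i$ along $U$. Let $dM_i$ be the medial measure on $\tilde M_i$, which is $(\mathbf u\cdot\mathbf n)\,dV$ on the part over the regular part of $M_i$ and zero on the rest; here $dV$ is the $n$-dimensional Riemannian volume on $M_i$ and $\mathbf n$ the unit normal to $M_i$ on the side of $U$. Let $g$ be a multivalued Borel measurable and integrable function on the boundaries, i.e. a family of Borel functions $g_i:\mathcal B_i\to\mathbb R$, each integrable for the $n$-dimensional volume $dV$ on $\mathcal B_i$ ($g_i(x)$ is the value of $g$ at $x$ for the region $\Omega_i$). Put $\tilde g=g_i\circ\psi_i$ on $\tilde M_i$, $\mathcal B_{i0}=\mathcal B_i\setminus\bigcup_{j\ne i}\mathcal B_j$ and $\mathcal B_{ij}=\mathcal B_i\cap\mathcal B_j$, and let $$\int_{\mathcal B} g\,dV=\sum_{i=1}^m\Big(\int_{\mathcal B_{i0}}g_i\,dV+\sum_{j\ne i,\ j\geq 1}\int_{\mathcal B_{ij}}g_i\,dV\Big).$$ Then $\tilde g\det(I-r_iS_{rad})$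 is integrable on each $\tilde M_i$ with respect to $dM_i$, and $$\int_{\mathcal B} g\,dV=\int_{\tilde M}\tilde g\,\det(I-r_iS_{rad})\,dM:=\sum_{i=1}^m\int_{\tilde M_i}\tilde g\,\det(I-r_iS_{rad})\,dM_i .$$ -/

import Mathlib

open MeasureTheory Filter Topology Set
open scoped ContDiff ENNReal

noncomputable section

namespace BlumLinking

/-- The ambient Euclidean space `ℝ^(n+1)`. -/
abbrev Ambient (n : ℕ) : Type := EuclideanSpace ℝ (Fin (n + 1))

/-- `f` is smooth (`C^∞`) on a neighbourhood of `a`. -/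
def SmoothNear {X Y : Type*} [NormedAddCommGroup X] [NormedSpace ℝ X]
    [NormedAddCommGroup Y] [NormedSpace ℝ Y] (f : X → Y) (a : X) : Prop :=
  ∀ᶠ x in 𝓝 a, ContDiffAt ℝ ∞ f x

/-! ### Regions with boundaries and corners, multi-region configurations -/

/-- A smooth diffeomorphism from an open neighbourhood of `x` in `ℝ^(n+1)` onto an open
neighbourhood of the origin, with `x ↦ 0`. -/
structure IsLocalChartAt {n : ℕ} (φ : OpenPartialHomeomorph (Ambient n) (Ambient n))
    (x : Ambient n) : Prop where
  mem_source : x ∈ φ.source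
  map_zero : φ x = 0
  smooth : ContDiffOn ℝ ∞ φ φ.source
  smooth_symm : ContDiffOn ℝ ∞ φ.symm φ.target

/-- `x` is a `k`-edge-corner point of `Ω`: near `x`, `Ω` is diffeomorphic, with `x ↦ 0`, to
`C_k = {u : 0 ≤ u_j for the first k coordinates}`.  (`k = 0`: interior point, `k = 1`: smooth
boundary point, `k ≥ 2`: singular boundary point.) -/
def IsEdgeCornerPoint {n : ℕ} (Ω : Set (Ambient n)) (k : ℕ) (x : Ambient n) : Prop :=
  k ≤ n + 1 ∧ ∃ φ : OpenPartialHomeomorph (Ambient n) (Ambient n), IsLocalChartAt φ x ∧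
    ∀ y ∈ φ.source, (y ∈ Ω ↔ ∀ j : Fin (n + 1), j.1 < k → 0 ≤ φ y j)

/-- A compact connected `(n+1)`-dimensional region which is a smooth manifold with boundaries and
corners.  Its boundary is `frontier Ω`. -/
structure IsRegion {n : ℕ} (Ω : Set (Ambient n)) : Prop where
  isCompact : IsCompact Ω
  isConnected : IsConnected Ω
  corners : ∀ x ∈ Ω, ∃ k, IsEdgeCornerPoint Ω k x

/-- The coordinates `y_0, …, y_k`, with sum zero, of the `L_k`-component of a point of
`ℝ^(n+1) ≅ L_k × ℝ^(n+1-k)`, where `L_k = {y ∈ ℝ^(k+1) : ∑ y_i = 0}` is parametrized by its first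
`k` coordinates. -/
def simplexCoord {n : ℕ} (k : ℕ) (z : Ambient n) (i : ℕ) : ℝ :=
  if h : i < n + 1 ∧ i < k then z ⟨i, h.1⟩
  else - ∑ j : Fin (n + 1), if j.1 < k then z j else 0

/-- `P_k = Y_k × ℝ^(n+1-k)`: the minimum of the coordinates `y_0, …, y_k` is attained at least
twice. -/
def modelP (n k : ℕ) : Set (Ambient n) :=
  {z | ∃ i ≤ k, ∃ j ≤ k, i ≠ j ∧ simplexCoord k z i = simplexCoord k z j ∧
    ∀ l ≤ k, simplexCoord k z i ≤ simplexCoord k z l}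

/-- `Q_k`: the hyperplane on which the last coordinate vanishes, together with the part of `P_k`
on which the last coordinate is nonnegative. -/
def modelQ (n k : ℕ) : Set (Ambient n) :=
  {z | z (Fin.last n) = 0} ∪ {z | 0 ≤ z (Fin.last n) ∧ z ∈ modelP n k}

/-- Near `x`, the set `B` is diffeomorphic, with `x ↦ 0`, to the model set `P`. -/
def IsLocallyModelledOn {n : ℕ} (B P : Set (Ambient n)) (x : Ambient n) : Prop :=
  ∃ φ : OpenPartialHomeomorph (Ambient n) (Ambient n), IsLocalChartAt φ x ∧
    ∀ y ∈ φ.source, (y ∈ B ↔ φ y ∈ P)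

/-- A multi-region configuration: finitely many regions which meet only along their boundaries
(boundary intersection condition), and such that near each point lying in more than one region,
the union of the boundaries of the regions containing it is locally diffeomorphic to some `P_k`,
`1 ≤ k ≤ n + 1`, or `Q_k`, `1 ≤ k ≤ n` (boundary edge condition; with these local models the
intersection of two regions is a union of strata of the boundaries). -/
structure IsMultiRegionConfiguration {n m : ℕ} (Ω : Fin m → Set (Ambient n)) : Prop where
  isRegion : ∀ i, IsRegion (Ω i)
  boundary_intersection : ∀ i j, i ≠ j → Ω i ∩ Ω j ⊆ frontier (Ω i) ∩ frontier (Ω j)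
  boundary_edge : ∀ i j, i ≠ j → ∀ x ∈ Ω i ∩ Ω j,
    (∃ k, 1 ≤ k ∧ k ≤ n + 1 ∧
      IsLocallyModelledOn (⋃ l ∈ {l | x ∈ Ω l}, frontier (Ω l)) (modelP n k) x) ∨
    (∃ k, 1 ≤ k ∧ k ≤ n ∧
      IsLocallyModelledOn (⋃ l ∈ {l | x ∈ Ω l}, frontier (Ω l)) (modelQ n k) x)

/-! ### Distance-squared functions and the Blum medial axis -/

/-- The points of the boundary at which `ρ(·, u) = ‖· - u‖²` attains its absolute minimum. -/
def closestPoints {n : ℕ} (Ω : Set (Ambient n)) (u : Ambient n) : Set (Ambient n) :=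
  {y ∈ frontier Ω | dist u y = Metric.infDist u (frontier Ω)}

/-- `γ` is a smooth local parametrization, with `0 ↦ y`, of `B` as a smooth hypersurface near
`y`. -/
structure IsLocalParam {n : ℕ} (B : Set (Ambient n)) (y : Ambient n)
    (γ : EuclideanSpace ℝ (Fin n) → Ambient n) : Prop where
  smooth : SmoothNear γ 0
  map_zero : γ 0 = y
  immersion : Function.Injective (fderiv ℝ γ 0)
  map_nhds : map γ (𝓝 0) = 𝓝[B] y

/-- The restriction of `ρ(·, u)` to `B` has a degenerate Hessian at `y`. -/
def IsDegenerateAt {n : ℕ} (B : Set (Ambient n)) (u y : Ambient n) : Prop :=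
  ∃ γ, IsLocalParam B y γ ∧ ∃ v ≠ 0, fderiv ℝ (fderiv ℝ fun z => ‖γ z - u‖ ^ 2) 0 v = 0

/-- The part of the Blum medial axis in the interior of `Ω` (the Maxwell set of `ρ`): the interior
points `u` for which the absolute minimum of `ρ(·, u)` on the boundary occurs at multiple points or
is degenerate. -/
def interiorMedialAxis {n : ℕ} (Ω : Set (Ambient n)) : Set (Ambient n) :=
  {u ∈ interior Ω | (closestPoints Ω u).Nontrivial ∨
    ∃ y ∈ closestPoints Ω u, IsDegenerateAt (frontier Ω) u y}

/-- The Blum medial axis `M` of a region with boundaries and corners, including the singular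
(`k`-edge-corner, `k ≥ 2`) points of the boundary. -/
def medialAxis {n : ℕ} (Ω : Set (Ambient n)) : Set (Ambient n) :=
  interiorMedialAxis Ω ∪ {x | ∃ k, 2 ≤ k ∧ IsEdgeCornerPoint Ω k x}

/-- The family of functions `f s (·, u)`, regarded as a multigerm of functions at the origins of
`ℝ^n` (one for each `s`) with parameter `u` near `u₀`, is a versal unfolding for `𝓡⁺`-equivalence
of multigerms: every smooth unfolding `G` of the multigerm `f s (·, u₀)`, on any finite number `p`
of parameters, is induced from it by a change of parameters `μ`, a family `φ s` of local
diffeomorphisms unfolding the identity, and a function `c` of the parameters. -/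
def IsRPlusVersal {n : ℕ} {κ : Type*} (f : κ → EuclideanSpace ℝ (Fin n) → Ambient n → ℝ)
    (u₀ : Ambient n) : Prop :=
  ∀ (p : ℕ) (G : κ → EuclideanSpace ℝ (Fin n) × EuclideanSpace ℝ (Fin p) → ℝ),
    (∀ s, SmoothNear (G s) 0) → (∀ s, ∀ᶠ z in 𝓝 0, G s (z, 0) = f s z u₀) →
    ∃ (φ : κ → EuclideanSpace ℝ (Fin n) × EuclideanSpace ℝ (Fin p) → EuclideanSpace ℝ (Fin n))
      (μ : EuclideanSpace ℝ (Fin p) → Ambient n) (c : EuclideanSpace ℝ (Fin p) → ℝ),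
      (∀ s, SmoothNear (φ s) 0) ∧ (∀ s, ∀ᶠ z in 𝓝 0, φ s (z, 0) = z) ∧
      SmoothNear μ 0 ∧ μ 0 = u₀ ∧ SmoothNear c 0 ∧ c 0 = 0 ∧
      ∀ s, ∀ᶠ q in 𝓝 0, G s q = f s (φ s q) (μ q.2) + c q.2

/-- The multigerm of `ρ : B × ℝ^(n+1) → ℝ` at `S × {u}` is an `𝓡⁺`-versal unfolding. -/
def IsVersalAt {n : ℕ} (B : Set (Ambient n)) (S : Finset (Ambient n)) (u : Ambient n) : Prop :=
  ∀ γ : S → EuclideanSpace ℝ (Fin n) → Ambient n, (∀ s : S, IsLocalParam B (s : Ambient n) (γ s)) →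
    IsRPlusVersal (fun (s : S) z w => ‖γ s z - w‖ ^ 2) u

/-- `Ω` has a generic Blum medial axis: at the points `u` of the medial axis in the interior of
`Ω`, and for every finite set `S` of boundary points closest to `u`, the multigerm of `ρ` at
`S × {u}` is an `𝓡⁺`-versal unfolding.  Finitely many exceptional points `u`, each with a
single closest boundary point, are allowed; these cover the generic `Ẽ₇`-points, which occur for
`n + 1 = 7`. -/
def HasGenericBlumMedialAxis {n : ℕ} (Ω : Set (Ambient n)) : Prop :=
  ∃ E : Set (Ambient n), E.Finite ∧ (∀ u ∈ E, ∃ y, closestPoints Ω u = {y}) ∧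
    ∀ u ∈ interiorMedialAxis Ω \ E, ∀ S : Finset (Ambient n), S.Nonempty →
      (S : Set (Ambient n)) ⊆ closestPoints Ω u → IsVersalAt (frontier Ω) S u

/-! ### The double of the medial axis, the radial shape operator and the medial measure -/

/-- The values at `x` of the multivalued radial vector field: the vectors from `x` to the closest
boundary points. -/
def radialVectors {n : ℕ} (Ω : Set (Ambient n)) (x : Ambient n) : Set (Ambient n) :=
  {U | x + U ∈ closestPoints Ω x}

/-- The double `M̃` of the medial axis: the pairs `(x, U)` with `x ∈ M` and `U` a value of the
radial vector field at `x`.  Over a singular point of the boundary there is the single value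
`U = 0`. -/
def double {n : ℕ} (Ω : Set (Ambient n)) : Set (Ambient n × Ambient n) :=
  {p | p.1 ∈ medialAxis Ω ∧ p.2 ∈ radialVectors Ω p.1}

/-- The time-one radial flow map `(x, U) ↦ x + U` from the double to the boundary. -/
def radialMap {n : ℕ} (p : Ambient n × Ambient n) : Ambient n := p.1 + p.2

/-- The regular part `M_reg` of the medial axis: the points near which it is a smooth
hypersurface. -/
def regularPart {n : ℕ} (Ω : Set (Ambient n)) : Set (Ambient n) :=
  {x ∈ medialAxis Ω | ∃ F : Ambient n → ℝ, SmoothNear F x ∧ fderiv ℝ F x ≠ 0 ∧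
    ∀ᶠ y in 𝓝 x, (y ∈ medialAxis Ω ↔ F y = 0)}

/-- The tangent space of the medial axis at `x` (for `x` in the regular part). -/
def medialTangentSpace {n : ℕ} (Ω : Set (Ambient n)) (x : Ambient n) :
    Submodule ℝ (Ambient n) :=
  Submodule.span ℝ (tangentConeAt ℝ (medialAxis Ω) x)

/-- `V` is, along the medial axis near `p.1`, a smooth choice of values of the radial vector field
which takes the value `p.2` at `p.1`. -/
def IsSmoothValue {n : ℕ} (Ω : Set (Ambient n)) (p : Ambient n × Ambient n)
    (V : Ambient n → Ambient n) : Prop :=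
  SmoothNear V p.1 ∧ V p.1 = p.2 ∧ ∀ᶠ y in 𝓝[medialAxis Ω] p.1, V y ∈ radialVectors Ω y

open Classical in
/-- The unit radial vector field `U / ‖U‖` near `p.1` belonging to a smooth value of the radial
vector field through `p`. -/
def unitRadialField {n : ℕ} (Ω : Set (Ambient n)) (p : Ambient n × Ambient n) :
    Ambient n → Ambient n :=
  if h : ∃ V, IsSmoothValue Ω p V then fun y => ‖h.choose y‖⁻¹ • h.choose y else 0

open Classical in
/-- The projection of `ℝ^(n+1)` onto `T` along the line spanned by `U` (for `U` transverse to the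
hyperplane `T`). -/
def projAlong {n : ℕ} (T : Submodule ℝ (Ambient n)) (U : Ambient n) : Ambient n →ₗ[ℝ] T :=
  if h : IsCompl T (Submodule.span ℝ {U}) then T.projectionOnto (Submodule.span ℝ {U}) h else 0

/-- The radial shape operator `S_rad(v) = - proj_U (∂u/∂v)` on `T_x M`, for `p = (x, U)`. -/
def radialShapeOperator {n : ℕ} (Ω : Set (Ambient n)) (p : Ambient n × Ambient n) :
    medialTangentSpace Ω p.1 →ₗ[ℝ] medialTangentSpace Ω p.1 :=
  - (projAlong (medialTangentSpace Ω p.1) p.2 ∘ₗ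
      (fderiv ℝ (unitRadialField Ω p) p.1 : Ambient n →ₗ[ℝ] Ambient n) ∘ₗ
      (medialTangentSpace Ω p.1).subtype)

/-- `det (I - r S_rad)` at `p = (x, U)`, with `r = ‖U‖`. -/
def radialJacobian {n : ℕ} (Ω : Set (Ambient n)) (p : Ambient n × Ambient n) : ℝ :=
  LinearMap.det (LinearMap.id - ‖p.2‖ • radialShapeOperator Ω p)

/-- The density `u · n` at `p = (x, U)`, where `u = U / ‖U‖` and `n` is the unit normal to the
medial axis on the side of `U`: the length of the component of `u` normal to `T_x M`. -/
def normalDensity {n : ℕ} (Ω : Set (Ambient n)) (p : Ambient n × Ambient n) : ℝ :=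
  ‖(medialTangentSpace Ω p.1)ᗮ.starProjection (‖p.2‖⁻¹ • p.2)‖

/-- The medial measure `dM` on the double `M̃` (as a Borel measure on pairs, carried by the double):
on the copies of the regular part of the medial axis given by the values of the radial vector field
it is `(u · n) dV`, with `dV` the `n`-dimensional Riemannian volume of the regular part. -/
def medialMeasure {n : ℕ} (Ω : Set (Ambient n)) : Measure (Ambient n × Ambient n) :=
  ((Measure.euclideanHausdorffMeasure n).restrict (regularPart Ω)).bind fun x =>
    Measure.sum fun U : radialVectors Ω x =>
      ENNReal.ofReal (normalDensity Ω (x, (U : Ambient n))) • Measure.dirac (x, (U : Ambient n))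

/-! ### Integrals of multivalued functions over the boundaries -/

/-- The integral over the complete boundary of a configuration of a multivalued function, with
value `g i x` at the point `x` of the boundary of the region `Ω i`.  It is the sum over all regions
`Ω i` of the integrals over the unshared part of the boundary of `Ω i` and over the parts which it
shares with the other regions `Ω j`. -/
def boundaryIntegral {n m : ℕ} (Ω : Fin m → Set (Ambient n)) (g : Fin m → Ambient n → ℝ) : ℝ :=
  ∑ i, ((∫ x in frontier (Ω i) \ ⋃ j ∈ {j | j ≠ i}, frontier (Ω j), g i x
          ∂(Measure.euclideanHausdorffMeasure n)) +
    ∑ j ∈ Finset.univ.erase i,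
      ∫ x in frontier (Ω i) ∩ frontier (Ω j), g i x ∂(Measure.euclideanHausdorffMeasure n))

end BlumLinking

end

/-!
Almost every boundary point of a region is smooth, and no three regions share a smooth boundary
point, so `boundaryIntegral` is the sum of the integrals over the whole boundaries
(`IsMultiRegionConfiguration.boundaryIntegral_eq`).  It remains to show, for a single region, that
the radial map `(x, U) ↦ x + U` pushes the measure `det (I - r S_rad) dM` on the double of the
medial axis forward to the volume of the boundary (`IsRegion.map_radialMap_withDensity`); the
theorem is then the change of variables formula for integrals.

*Generic points.*  Call an interior point generic if it has exactly two closest boundary points,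
both nondegenerate.  By the implicit function theorem a nondegenerate closest point persists as a
smooth sheet `q` of critical points of the distance-squared functions
(`IsLocalParam.exists_isSheet`).  Hence, near a generic point, the medial axis is the zero set of
`‖q₁ w - w‖² - ‖q₂ w - w‖²`, a smooth hypersurface with normal `q₁ - q₂`, and its double is the union
of the graphs of the radial fields `q₁ w - w` and `q₂ w - w` (`IsTwoSheeted.eventually_medialAxis`).

*Jacobian.*  The sheet `q₁` is the radial map along the first graph.  Its derivative kills the
radial vector `U` and takes values in `Uᗮ`.  The operator `I - r S_rad` is that derivative followed
by the projection to the tangent space along `U`, and passing from `Uᗮ` to the tangent space changes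
volume by the factor `u · n`.  So `q₁` distorts the volume of the medial axis by
`det (I - r S_rad) (u · n)` (`IsTwoSheeted.normDet_eq`), and the determinant is positive because the
derivative of a sheet of minima is positive definite across `U`.  Volume is Hausdorff measure here:
maps between almost flat pieces are compared with their linear parts by Lipschitz estimates
(`euclideanHausdorffMeasure_image_near`), and the local comparisons are summed over small pieces
(`measure_image_eq_setLIntegral_of_local`).  The radial map is injective over the interior medial
axis, since on the open segment between a point and a closest boundary point there are no medial
axis points (`IsRegion.unique_of_mem_closestPoints`).

*Null sets.*  Every smooth boundary point is a closest point of some medial axis point, namely the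
last point on its normal of which it is a closest point (`IsRegion.exists_mem_interiorMedialAxis`).
So it suffices that the pairs of a non-generic medial axis point and a closest boundary point form
a set of vanishing `n`-dimensional Hausdorff measure (`IsRegion.hausdorffMeasure_nongeneric_pairs`);
both the boundary points and the medial axis points left out are then null.  Three nondegenerate
closest points are equally far on a set of codimension two in the ambient space, since three points
of a sphere are not collinear (`IsRegion.hausdorffMeasure_nondegenerateTriples`).  At a degenerate
minimum the Hessian has a unit vector in its kernel and the cubic form vanishes on it.  These
conditions, together with the equations for a critical point, are `2 n + 2` equations in `3 n + 1`
unknowns, and versality, used only infinitesimally and for single closest points, makes them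
independent (`exists_surjective_fderiv_degenerateMap`); the solution set is `(n - 1)`-dimensional.
The finitely many exceptional points have single closest points, so they contribute finitely many
pairs, which are null because `n ≥ 1`.
-/

namespace BlumLinking

open scoped RealInnerProductSpace

/-! ### Hausdorff measure of images and of level sets -/

section HausdorffImages

variable {ι X Y : Type*} [MetricSpace X] [MetricSpace Y]
  [MeasurableSpace X] [BorelSpace X] [MeasurableSpace Y] [BorelSpace Y]

/-- If distances between values of `f` are at most `C` times those between values of `g`, then
`f '' A` is a `C`-Lipschitz image of `g '' A`. -/
theorem hausdorffMeasure_image_le_image {f : ι → Y} {g : ι → X} {A : Set ι} {C : NNReal}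
    (h : ∀ x ∈ A, ∀ x' ∈ A, dist (f x) (f x') ≤ C * dist (g x) (g x')) {d : ℝ} (hd : 0 ≤ d) :
    μH[d] (f '' A) ≤ (C : ℝ≥0∞) ^ d * μH[d] (g '' A) := by
  rcases A.eq_empty_or_nonempty with rfl | ⟨a, -⟩
  · simp
  have : Nonempty ι := ⟨a⟩
  let k : X → Y := fun p => f (Function.invFunOn g A p)
  have hk : ∀ x ∈ A, k (g x) = f x := fun x hx => by
    have h1 := Function.invFunOn_mem (f := g) ⟨x, hx, rfl⟩
    have h2 := Function.invFunOn_eq (f := g) ⟨x, hx, rfl⟩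
    have := h _ h1 x hx
    rw [h2, dist_self, mul_zero] at this
    exact dist_le_zero.1 this
  have hL : LipschitzOnWith C k (g '' A) := by
    refine LipschitzOnWith.of_dist_le_mul ?_
    rintro _ ⟨x, hx, rfl⟩ _ ⟨x', hx', rfl⟩
    rw [hk x hx, hk x' hx']
    exact h x hx x' hx'
  have himg : f '' A = k '' (g '' A) := by
    rw [image_image]
    exact image_congr fun x hx => (hk x hx).symm
  rw [himg]
  exact hL.hausdorffMeasure_image_le hd

theorem euclideanHausdorffMeasure_image_le_image {f : ι → Y} {g : ι → X} {A : Set ι} {C : NNReal}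
    (h : ∀ x ∈ A, ∀ x' ∈ A, dist (f x) (f x') ≤ C * dist (g x) (g x')) (n : ℕ) :
    (Measure.euclideanHausdorffMeasure n) (f '' A) ≤
      (C : ℝ≥0∞) ^ n * (Measure.euclideanHausdorffMeasure n) (g '' A) := by
  simp only [Measure.euclideanHausdorffMeasure_def, Measure.smul_apply, Measure.nnreal_smul_coe_apply]
  rw [mul_left_comm]
  gcongr
  simpa using hausdorffMeasure_image_le_image h (d := n) (by positivity)

theorem euclideanHausdorffMeasure_eq_zero_iff {n : ℕ} {s : Set X} :
    (Measure.euclideanHausdorffMeasure n) s = 0 ↔ μH[n] s = 0 := by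
  simp [Measure.euclideanHausdorffMeasure_def, Measure.smul_apply, Measure.nnreal_smul_coe_apply,
    Measure.addHaarScalarFactor_volume_hausdorffMeasure_ne_zero]

/-- Locally Lipschitz images of Hausdorff-null sets are null. -/
theorem hausdorffMeasure_image_null_of_locally_lipschitz [SecondCountableTopology X]
    {f : X → Y} {s : Set X} {d : ℝ} (hd : 0 ≤ d) (hs : μH[d] s = 0)
    (h : ∀ x ∈ s, ∃ K : NNReal, ∃ t ∈ 𝓝 x, LipschitzOnWith K f t) : μH[d] (f '' s) = 0 := by
  choose! K t ht hL using h
  obtain ⟨c, hcs, hc, hcov⟩ := TopologicalSpace.countable_cover_nhdsWithin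
    (fun x hx => (mem_nhdsWithin_of_mem_nhds (ht x hx) : t x ∈ 𝓝[s] x))
  have hsub : f '' s ⊆ ⋃ x ∈ c, f '' (s ∩ t x) := by
    rintro _ ⟨y, hy, rfl⟩
    obtain ⟨x, hx, hyx⟩ := mem_iUnion₂.1 (hcov hy)
    exact mem_iUnion₂.2 ⟨x, hx, y, ⟨hy, hyx⟩, rfl⟩
  refine measure_mono_null hsub ((measure_biUnion_null_iff hc).2 fun x hx => ?_)
  refine le_antisymm ?_ (zero_le)
  calc μH[d] (f '' (s ∩ t x)) ≤ (K x : ℝ≥0∞) ^ d * μH[d] (s ∩ t x) :=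
        ((hL x (hcs hx)).mono inter_subset_right).hausdorffMeasure_image_le hd
    _ = 0 := by rw [measure_mono_null inter_subset_left hs, mul_zero]

end HausdorffImages

theorem hausdorffMeasure_image_null {X Y : Type*} [NormedAddCommGroup X] [NormedSpace ℝ X]
    [NormedAddCommGroup Y] [NormedSpace ℝ Y] [MeasurableSpace X] [BorelSpace X]
    [MeasurableSpace Y] [BorelSpace Y] [SecondCountableTopology X]
    {f : X → Y} {s : Set X} {d : ℝ} (hd : 0 ≤ d) (hs : μH[d] s = 0)
    (h : ∀ x ∈ s, ContDiffAt ℝ 1 f x) : μH[d] (f '' s) = 0 :=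
  hausdorffMeasure_image_null_of_locally_lipschitz hd hs fun x hx =>
    (h x hx).exists_lipschitzOnWith

theorem exists_nhds_norm_sub_sub_le {X Y : Type*} [NormedAddCommGroup X] [NormedSpace ℝ X]
    [NormedAddCommGroup Y] [NormedSpace ℝ Y] {f : X → Y} {f' : X →L[ℝ] Y} {p : X}
    (hf : HasStrictFDerivAt f f' p) {ε : ℝ} (hε : 0 < ε) :
    ∃ N ∈ 𝓝 p, ∀ x ∈ N, ∀ x' ∈ N, ‖f x - f x' - f' (x - x')‖ ≤ ε * ‖x - x'‖ := by
  have h := hf.isLittleO.def hε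
  rw [nhds_prod_eq] at h
  exact (eventually_prod_self_iff
    (r := fun x x' => ‖f x - f x' - f' (x - x')‖ ≤ ε * ‖x - x'‖)).1 h

/-- Near a point where `f` is strictly differentiable with surjective derivative, level sets of
`f : X → Y` have dimension at most `dim X - dim Y`. -/
theorem exists_nhds_hausdorffMeasure_level_null {X Y : Type*} [NormedAddCommGroup X]
    [NormedSpace ℝ X] [FiniteDimensional ℝ X] [MeasurableSpace X] [BorelSpace X]
    [NormedAddCommGroup Y] [NormedSpace ℝ Y] [FiniteDimensional ℝ Y]
    {f : X → Y} {f' : X →L[ℝ] Y} {p : X} (hf : HasStrictFDerivAt f f' p)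
    (hsurj : Function.Surjective f') {d : ℕ}
    (hdim : Module.finrank ℝ X < Module.finrank ℝ Y + d) :
    ∃ N ∈ 𝓝 p, ∀ s ⊆ N, (∀ x ∈ s, f x = f p) → μH[d] s = 0 := by
  obtain ⟨P, hP⟩ := Submodule.ClosedComplemented.of_finiteDimensional
    (LinearMap.ker (f' : X →ₗ[ℝ] Y))
  -- on a level set, the projection `P` to the kernel of `f'` has a Lipschitz inverse
  have hinj : LinearMap.ker (f'.prod P).toLinearMap = ⊥ := by
    rw [LinearMap.ker_eq_bot']
    intro x hx
    have h1 : f' x = 0 := congrArg Prod.fst hx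
    have h2 : P x = 0 := congrArg Prod.snd hx
    have h3 := hP ⟨x, h1⟩
    rw [h2] at h3
    exact (congrArg Subtype.val h3).symm
  obtain ⟨C, hC0, hC⟩ := (f'.prod P).toLinearMap.exists_antilipschitzWith hinj
  have hC' : ∀ x, ‖x‖ ≤ C * max ‖f' x‖ ‖P x‖ := fun x => by
    have := hC.le_mul_dist x 0
    simpa [Prod.dist_eq] using this
  have hCpos : (0 : ℝ) < C := hC0
  have hε : (0 : ℝ) < 1 / (2 * C) := by positivity
  obtain ⟨N, hN, hNN⟩ := exists_nhds_norm_sub_sub_le hf hε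
  refine ⟨N, hN, fun s hs hlev => ?_⟩
  have hkey : ∀ x ∈ s, ∀ x' ∈ s, dist (id x) (id x') ≤ C * dist (P x) (P x') := by
    intro x hx x' hx'
    have h1 := hNN x (hs hx) x' (hs hx')
    simp only [hlev x hx, hlev x' hx', sub_self, zero_sub, norm_neg] at h1
    have h2 := hC' (x - x')
    rw [id, id, dist_eq_norm, dist_eq_norm, ← map_sub]
    rcases le_total ‖f' (x - x')‖ ‖P (x - x')‖ with h | h
    · rwa [max_eq_right h] at h2
    · rw [max_eq_left h] at h2
      have h3 : C * ‖f' (x - x')‖ ≤ ‖x - x'‖ / 2 := by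
        calc C * ‖f' (x - x')‖ ≤ C * (1 / (2 * C) * ‖x - x'‖) := by gcongr
          _ = ‖x - x'‖ / 2 := by field_simp
      have h4 : ‖x - x'‖ ≤ 0 := by linarith
      have : 0 ≤ (C : ℝ) * ‖P (x - x')‖ := by positivity
      linarith
  borelize ↥(LinearMap.ker (f' : X →ₗ[ℝ] Y))
  have h5 := hausdorffMeasure_image_le_image hkey (d := (d : ℝ)) (by positivity)
  rw [image_id] at h5
  have hfin : Module.finrank ℝ (LinearMap.ker (f' : X →ₗ[ℝ] Y)) < d := by
    have h6 := (f' : X →ₗ[ℝ] Y).finrank_range_add_finrank_ker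
    have h7 : LinearMap.range (f' : X →ₗ[ℝ] Y) = ⊤ := LinearMap.range_eq_top.2 hsurj
    rw [h7, finrank_top] at h6
    omega
  have h8 : (μH[(d : ℝ)] : Measure (LinearMap.ker (f' : X →ₗ[ℝ] Y))) = 0 :=
    Real.hausdorffMeasure_of_finrank_lt (by exact_mod_cast hfin)
  rw [h8] at h5
  simpa using h5

/-- A map between pieces of `n`-dimensional submanifolds which has the strict derivative `L` at `x₀`
distorts `n`-dimensional volume near `x₀` by the factor `normDet (L|_T)`.  The hypothesis `hT` says
that `s` is a `C¹` piece with tangent space inside `T` at `x₀`. -/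
theorem euclideanHausdorffMeasure_image_near {V W : Type*} [NormedAddCommGroup V]
    [InnerProductSpace ℝ V] [FiniteDimensional ℝ V] [MeasurableSpace V] [BorelSpace V]
    [NormedAddCommGroup W] [InnerProductSpace ℝ W] [MeasurableSpace W] [BorelSpace W]
    {s : Set V} {x₀ : V} {T : Submodule ℝ V} {n : ℕ} (hn : Module.finrank ℝ T = n)
    {ψ : V → W} {L : V →L[ℝ] W}
    (hT : ∀ ε > 0, ∃ N ∈ 𝓝 x₀, ∀ x ∈ s ∩ N, ∀ x' ∈ s ∩ N,
      ‖(x - x') - T.starProjection (x - x')‖ ≤ ε * ‖x - x'‖)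
    (hψ : HasStrictFDerivAt ψ L x₀)
    (hL : ∀ v ∈ T, L v = 0 → v = 0) {c : ℝ} (hc : 1 < c) :
    ∃ N ∈ 𝓝 x₀, ∀ A ⊆ s ∩ N,
      (Measure.euclideanHausdorffMeasure n) (ψ '' A) ≤
        ENNReal.ofReal (c * (L.toLinearMap ∘ₗ T.subtype).normDet) *
          (Measure.euclideanHausdorffMeasure n) A ∧
      ENNReal.ofReal (L.toLinearMap ∘ₗ T.subtype).normDet *
          (Measure.euclideanHausdorffMeasure n) A ≤
        ENNReal.ofReal c * (Measure.euclideanHausdorffMeasure n) (ψ '' A) := by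
  -- a Lipschitz constant `κ > 1` whose `2n`-th power is at most `c`
  obtain ⟨κ, hκ1, hκc⟩ : ∃ κ : ℝ, 1 < κ ∧ κ ^ (2 * n) ≤ c := by
    have hcont : ContinuousAt (fun κ : ℝ => κ ^ (2 * n)) 1 := by fun_prop
    have h1 : ∀ᶠ κ in 𝓝 (1 : ℝ), κ ^ (2 * n) < c := by
      refine hcont.eventually_lt continuousAt_const (by simpa using hc)
    obtain ⟨κ, hκ, hκ'⟩ := ((h1.filter_mono nhdsWithin_le_nhds).and
      (self_mem_nhdsWithin : Ioi (1 : ℝ) ∈ 𝓝[>] 1)).exists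
    exact ⟨κ, hκ', hκ.le⟩
  have hκ0 : 0 < κ := by linarith
  have he0 : 0 < 1 - 1 / κ := by
    rw [sub_pos, div_lt_one hκ0]; exact hκ1
  have hker : LinearMap.ker (L.toLinearMap ∘ₗ T.subtype) = ⊥ := by
    rw [LinearMap.ker_eq_bot']
    intro v hv
    exact Subtype.ext (hL v v.2 hv)
  obtain ⟨C, hC0, hC⟩ := (L.toLinearMap ∘ₗ T.subtype).exists_antilipschitzWith hker
  have hCpos : (0 : ℝ) < C := hC0
  have hC' : ∀ v : T, ‖(v : V)‖ ≤ C * ‖L v‖ := fun v => by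
    simpa using hC.le_mul_dist v 0
  set e0 := 1 - 1 / κ with he0_def
  obtain ⟨N₁, hN₁, h₁⟩ := hT (min e0 (e0 / (2 * κ * C * (‖L‖ + 1)))) (by positivity)
  obtain ⟨N₂, hN₂, h₂⟩ := exists_nhds_norm_sub_sub_le hψ
    (ε := e0 / (2 * κ * C)) (by positivity)
  refine ⟨N₁ ∩ N₂, inter_mem hN₁ hN₂, fun A hA => ?_⟩
  have hκe : (1 - e0) * κ = 1 := by rw [he0_def]; field_simp; ring
  -- on `A`, the orthogonal projection to `T` almost preserves distances
  have hP : ∀ x ∈ A, ∀ x' ∈ A, ‖x - x'‖ ≤ κ * ‖T.orthogonalProjectionOnto (x - x')‖ := by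
    intro x hx x' hx'
    have h := h₁ x ⟨(hA hx).1, (hA hx).2.1⟩ x' ⟨(hA hx').1, (hA hx').2.1⟩
    have h' : ‖(x - x') - T.starProjection (x - x')‖ ≤ e0 * ‖x - x'‖ :=
      h.trans (by gcongr; exact min_le_left _ _)
    have h3 : ‖x - x'‖ - ‖T.starProjection (x - x')‖ ≤ e0 * ‖x - x'‖ :=
      (norm_sub_norm_le _ _).trans h'
    have h4 : ‖T.starProjection (x - x')‖ = ‖T.orthogonalProjectionOnto (x - x')‖ := rfl
    rw [h4] at h3
    calc ‖x - x'‖ = (1 - e0) * κ * ‖x - x'‖ := by rw [hκe, one_mul]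
      _ = κ * ((1 - e0) * ‖x - x'‖) := by ring
      _ ≤ _ := by gcongr; linarith
  -- on `A`, differences of `ψ` are those of `L` after projecting to `T`, up to the factor `1 ± e0`
  have hD : ∀ x ∈ A, ∀ x' ∈ A, ‖(ψ x - ψ x') - L (T.starProjection (x - x'))‖ ≤
      e0 * ‖L (T.starProjection (x - x'))‖ := by
    intro x hx x' hx'
    have h := h₁ x ⟨(hA hx).1, (hA hx).2.1⟩ x' ⟨(hA hx').1, (hA hx').2.1⟩
    have h' : ‖(x - x') - T.starProjection (x - x')‖ ≤
        (e0 / (2 * κ * C * (‖L‖ + 1))) * ‖x - x'‖ :=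
      h.trans (by gcongr; exact min_le_right _ _)
    have h3 := h₂ x (hA hx).2.2 x' (hA hx').2.2
    have h4 : ‖L ((x - x') - T.starProjection (x - x'))‖ ≤ e0 / (2 * κ * C) * ‖x - x'‖ := by
      calc _ ≤ ‖L‖ * ‖(x - x') - T.starProjection (x - x')‖ := L.le_opNorm _
        _ ≤ (‖L‖ + 1) * ((e0 / (2 * κ * C * (‖L‖ + 1))) * ‖x - x'‖) := by
            gcongr; linarith
        _ = _ := by field_simp
    have h5 : ‖(ψ x - ψ x') - L (T.starProjection (x - x'))‖ ≤ e0 / (κ * C) * ‖x - x'‖ := by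
      calc _ = ‖(ψ x - ψ x' - L (x - x')) + L ((x - x') - T.starProjection (x - x'))‖ := by
            rw [map_sub L (x - x')]; congr 1; abel
        _ ≤ _ := norm_add_le _ _
        _ ≤ e0 / (2 * κ * C) * ‖x - x'‖ + e0 / (2 * κ * C) * ‖x - x'‖ := add_le_add h3 h4
        _ = _ := by field_simp; ring
    refine h5.trans ?_
    have h6 := hP x hx x' hx'
    have h7 := hC' (T.orthogonalProjectionOnto (x - x'))
    calc e0 / (κ * C) * ‖x - x'‖ ≤ e0 / (κ * C) * (κ * (C * ‖L (T.starProjection (x - x'))‖)) := by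
          gcongr
          refine h6.trans ?_
          gcongr
          exact h7
      _ = _ := by field_simp
  have hκ2 : 1 + e0 ≤ κ := by
    have : 2 ≤ κ + 1 / κ := by
      rw [← sub_nonneg]
      have : κ + 1 / κ - 2 = (κ - 1) ^ 2 / κ := by field_simp; ring
      rw [this]; positivity
    rw [he0_def]; linarith
  -- `A` and its projection to `T` are `κ`-bi-Lipschitz equivalent, as are `ψ '' A` and `Λ '' A`;
  -- the linear map from the projection of `A` to `Λ '' A` has the distortion `normDet`
  let Λ : V → W := fun x => (L.toLinearMap ∘ₗ T.subtype) (T.orthogonalProjectionOnto x)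
  have hΛ : ∀ x x', Λ x - Λ x' = L (T.starProjection (x - x')) := fun x x' => by
    simp only [Λ, ← map_sub]; rfl
  have k1 : ∀ x ∈ A, ∀ x' ∈ A, dist (ψ x) (ψ x') ≤ (κ.toNNReal : ℝ) * dist (Λ x) (Λ x') := by
    intro x hx x' hx'
    rw [Real.coe_toNNReal _ hκ0.le, dist_eq_norm, dist_eq_norm, hΛ]
    have h := hD x hx x' hx'
    have h' := (norm_sub_norm_le _ _).trans h
    nlinarith [norm_nonneg (L (T.starProjection (x - x')))]
  have k2 : ∀ x ∈ A, ∀ x' ∈ A, dist (Λ x) (Λ x') ≤ (κ.toNNReal : ℝ) * dist (ψ x) (ψ x') := by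
    intro x hx x' hx'
    rw [Real.coe_toNNReal _ hκ0.le, dist_eq_norm, dist_eq_norm, hΛ]
    have h := hD x hx x' hx'
    rw [norm_sub_rev] at h
    have h' := (norm_sub_norm_le _ _).trans h
    calc ‖L (T.starProjection (x - x'))‖ = κ * ((1 - e0) * ‖L (T.starProjection (x - x'))‖) := by
          rw [← mul_assoc, mul_comm κ, hκe, one_mul]
      _ ≤ _ := by gcongr; linarith
  have k3 : ∀ x ∈ A, ∀ x' ∈ A, dist (id x) (id x') ≤ (κ.toNNReal : ℝ) *
      dist (T.orthogonalProjectionOnto x) (T.orthogonalProjectionOnto x') := by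
    intro x hx x' hx'
    rw [Real.coe_toNNReal _ hκ0.le, dist_eq_norm, dist_eq_norm, ← map_sub]
    exact hP x hx x' hx'
  have k4 : ∀ x ∈ A, ∀ x' ∈ A, dist (T.orthogonalProjectionOnto x) (T.orthogonalProjectionOnto x') ≤
      ((1 : NNReal) : ℝ) * dist (id x) (id x') := by
    intro x _ x' _
    rw [dist_eq_norm, dist_eq_norm, ← map_sub, NNReal.coe_one, one_mul]
    exact Submodule.norm_orthogonalProjectionOnto_apply_le _ _
  have m1 := euclideanHausdorffMeasure_image_le_image k1 n
  have m2 := euclideanHausdorffMeasure_image_le_image k2 n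
  have m3 := euclideanHausdorffMeasure_image_le_image k3 n
  have m4 := euclideanHausdorffMeasure_image_le_image k4 n
  have hJ : (Measure.euclideanHausdorffMeasure n) (Λ '' A) =
      ENNReal.ofReal (L.toLinearMap ∘ₗ T.subtype).normDet *
        (Measure.euclideanHausdorffMeasure n) ((fun x => T.orthogonalProjectionOnto x) '' A) := by
    have := (L.toLinearMap ∘ₗ T.subtype).euclideanHausdorffMeasure_image
      ((fun x => T.orthogonalProjectionOnto x) '' A)
    rw [hn, image_image] at this
    exact this
  set J := (L.toLinearMap ∘ₗ T.subtype).normDet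
  have hJ0 : 0 ≤ J := LinearMap.normDet_nonneg _
  simp only [image_id, ENNReal.coe_one, one_pow, one_mul] at m3 m4
  have hκn : ∀ k : ℕ, ((κ.toNNReal : NNReal) : ℝ≥0∞) ^ k = ENNReal.ofReal (κ ^ k) := fun k => by
    rw [ENNReal.ofReal_pow hκ0.le]; rfl
  have hκn' : κ ^ n ≤ c := (pow_le_pow_right₀ hκ1.le (by omega)).trans hκc
  constructor
  · calc _ ≤ _ := m1
      _ = ENNReal.ofReal (κ ^ n) * (ENNReal.ofReal J * _) := by rw [hJ, hκn]
      _ ≤ ENNReal.ofReal c * (ENNReal.ofReal J * (Measure.euclideanHausdorffMeasure n) A) := by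
          gcongr
      _ = _ := by rw [ENNReal.ofReal_mul (by linarith), mul_assoc]
  · calc _ ≤ ENNReal.ofReal J * (ENNReal.ofReal (κ ^ n) * _) := by rw [← hκn]; gcongr
      _ = ENNReal.ofReal (κ ^ n) * (Measure.euclideanHausdorffMeasure n) (Λ '' A) := by
          rw [hJ]; ring
      _ ≤ ENNReal.ofReal (κ ^ n) * (ENNReal.ofReal (κ ^ n) *
            (Measure.euclideanHausdorffMeasure n) (ψ '' A)) := by rw [← hκn]; gcongr
      _ = ENNReal.ofReal (κ ^ (2 * n)) * (Measure.euclideanHausdorffMeasure n) (ψ '' A) := by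
          rw [← mul_assoc, ← ENNReal.ofReal_mul (by positivity)]; congr 2; ring
      _ ≤ _ := by gcongr

/-- If an injective map distorts measure near each point of `S` by the factor `J`, up to factors
arbitrarily close to one, then it satisfies the change of variables formula with Jacobian `J`. -/
theorem measure_image_eq_setLIntegral_of_local {X Y : Type*} [TopologicalSpace X]
    [SecondCountableTopology X] [MeasurableSpace X] [OpensMeasurableSpace X] [MeasurableSpace Y]
    {m : Measure X} {μ : Measure Y} {S : Set X} {ψ : X → Y} {J : X → ℝ≥0∞}
    (hinj : InjOn ψ S) (himg : ∀ A ⊆ S, MeasurableSet A → MeasurableSet (ψ '' A))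
    (hloc : ∀ p ∈ S, ∀ c : ℝ, 1 < c → ∃ N ∈ 𝓝 p,
      (∀ x ∈ S ∩ N, J x ≤ ENNReal.ofReal c * J p ∧ J p ≤ ENNReal.ofReal c * J x) ∧
      ∀ A ⊆ S ∩ N, MeasurableSet A → μ (ψ '' A) ≤ ENNReal.ofReal c * (J p * m A) ∧
        J p * m A ≤ ENNReal.ofReal c * μ (ψ '' A))
    {A : Set X} (hA : A ⊆ S) (hAm : MeasurableSet A) : μ (ψ '' A) = ∫⁻ x in A, J x ∂m := by
  have key : ∀ c : ℝ, 1 < c → μ (ψ '' A) ≤ ENNReal.ofReal (c ^ 2) * ∫⁻ x in A, J x ∂m ∧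
      ∫⁻ x in A, J x ∂m ≤ ENNReal.ofReal (c ^ 2) * μ (ψ '' A) := by
    intro c hc
    have hc0 : 0 < c := by linarith
    choose! N hN hJ hm using fun p hp => hloc p hp c hc
    have hN' : ∀ p ∈ A, interior (N p) ∈ 𝓝[A] p := fun p hp =>
      mem_nhdsWithin_of_mem_nhds (interior_mem_nhds.2 (hN p (hA hp)))
    -- a countable measurable partition of `A` into pieces on which the local estimates hold
    obtain ⟨t, htA, ht, hcov⟩ := TopologicalSpace.countable_cover_nhdsWithin hN'
    rcases t.eq_empty_or_nonempty with rfl | hne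
    · have : A = ∅ := by simpa using hcov
      simp [this]
    obtain ⟨q, hq⟩ := ht.exists_eq_range hne
    let D : ℕ → Set X := fun k => A ∩ disjointed (fun k => interior (N (q k))) k
    have hqt : ∀ k, q k ∈ A := fun k => htA (hq ▸ mem_range_self k)
    have hDm : ∀ k, MeasurableSet (D k) := fun k =>
      hAm.inter (MeasurableSet.disjointed (fun _ => isOpen_interior.measurableSet) k)
    have hDd : Pairwise (Function.onFun Disjoint D) := fun i j hij =>
      ((disjoint_disjointed _) hij).mono inter_subset_right inter_subset_right
    have hDU : ⋃ k, D k = A := by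
      rw [← inter_iUnion, iUnion_disjointed, inter_eq_left]
      refine hcov.trans ?_
      rw [hq, biUnion_range]
    have hDN : ∀ k, D k ⊆ S ∩ N (q k) := fun k x hx =>
      ⟨hA hx.1, interior_subset (disjointed_le (fun k => interior (N (q k))) k hx.2)⟩
    have hDS : ∀ k, D k ⊆ S := fun k => (hDN k).trans inter_subset_left
    have hI : ∫⁻ x in A, J x ∂m = ∑' k, ∫⁻ x in D k, J x ∂m := by
      rw [← hDU, lintegral_iUnion hDm hDd]
    have hM : μ (ψ '' A) = ∑' k, μ (ψ '' D k) := by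
      rw [← hDU, image_iUnion, measure_iUnion]
      · intro i j hij
        refine disjoint_left.2 ?_
        rintro _ ⟨x, hx, rfl⟩ ⟨x', hx', hxx⟩
        rw [hinj (hDS j hx') (hDS i hx) hxx] at hx'
        exact disjoint_left.1 (hDd hij) hx hx'
      · exact fun k => himg _ (hDS k) (hDm k)
    have hcc : ENNReal.ofReal (c ^ 2) = ENNReal.ofReal c * ENNReal.ofReal c := by
      rw [sq, ENNReal.ofReal_mul hc0.le]
    rw [hI, hM, ← ENNReal.tsum_mul_left, ← ENNReal.tsum_mul_left]
    constructor
    · refine ENNReal.tsum_le_tsum fun k => ?_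
      have h1 := (hm _ (hA (hqt k)) (D k) (hDN k) (hDm k)).1
      have h2 : J (q k) * m (D k) ≤ ENNReal.ofReal c * ∫⁻ x in D k, J x ∂m := by
        rw [← lintegral_const_mul' _ _ ENNReal.ofReal_ne_top, ← setLIntegral_const]
        exact setLIntegral_mono' (hDm k) fun x hx => (hJ _ (hA (hqt k)) x (hDN k hx)).2
      rw [hcc, mul_assoc]
      exact h1.trans (by gcongr)
    · refine ENNReal.tsum_le_tsum fun k => ?_
      have h1 := (hm _ (hA (hqt k)) (D k) (hDN k) (hDm k)).2
      have h2 : ∫⁻ x in D k, J x ∂m ≤ ENNReal.ofReal c * (J (q k) * m (D k)) := by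
        rw [← mul_assoc, ← setLIntegral_const]
        exact setLIntegral_mono' (hDm k) fun x hx => (hJ _ (hA (hqt k)) x (hDN k hx)).1
      rw [hcc, mul_assoc]
      exact h2.trans (by gcongr)
  have lim : ∀ a b : ℝ≥0∞, (∀ c : ℝ, 1 < c → a ≤ ENNReal.ofReal (c ^ 2) * b) → a ≤ b := by
    intro a b h
    have h1 : Tendsto (fun c : ℝ => ENNReal.ofReal (c ^ 2) * b) (𝓝[>] 1)
        (𝓝 (ENNReal.ofReal (1 ^ 2) * b)) := by
      refine ENNReal.Tendsto.mul_const ?_ (Or.inl (by simp))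
      refine (ENNReal.continuous_ofReal.tendsto _).comp ?_
      exact ((continuous_pow 2).tendsto (1 : ℝ)).mono_left nhdsWithin_le_nhds
    simp only [one_pow, ENNReal.ofReal_one, one_mul] at h1
    exact ge_of_tendsto h1 (eventually_nhdsWithin_of_forall fun c hc => h c hc)
  exact le_antisymm (lim _ _ fun c hc => (key c hc).1) (lim _ _ fun c hc => (key c hc).2)

/-! ### Smooth germs, inverse and implicit functions -/

section SmoothGerms

variable {X Y Z : Type*} [NormedAddCommGroup X] [NormedSpace ℝ X]
  [NormedAddCommGroup Y] [NormedSpace ℝ Y] [NormedAddCommGroup Z] [NormedSpace ℝ Z]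

namespace SmoothNear

variable {f : X → Y} {a : X}

theorem contDiffAt (h : SmoothNear f a) : ContDiffAt ℝ ∞ f a := h.self_of_nhds

theorem eventually (h : SmoothNear f a) : ∀ᶠ x in 𝓝 a, SmoothNear f x :=
  h.eventually_nhds

theorem continuousAt (h : SmoothNear f a) : ContinuousAt f a := h.contDiffAt.continuousAt

theorem differentiableAt (h : SmoothNear f a) : DifferentiableAt ℝ f a :=
  h.contDiffAt.differentiableAt (by simp)

theorem hasFDerivAt (h : SmoothNear f a) : HasFDerivAt f (fderiv ℝ f a) a :=
  h.differentiableAt.hasFDerivAt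

theorem hasStrictFDerivAt (h : SmoothNear f a) : HasStrictFDerivAt f (fderiv ℝ f a) a :=
  h.contDiffAt.hasStrictFDerivAt (by simp)

protected theorem fderiv (h : SmoothNear f a) : SmoothNear (fderiv ℝ f) a := by
  filter_upwards [h] with x hx
  exact hx.fderiv_right (by simp)

theorem comp {g : Y → Z} (hg : SmoothNear g (f a)) (hf : SmoothNear f a) :
    SmoothNear (fun x => g (f x)) a := by
  filter_upwards [hf, hf.continuousAt.eventually hg] with x hx hgx
  exact hgx.comp x hx

theorem prodMk {g : X → Z} (hf : SmoothNear f a) (hg : SmoothNear g a) :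
    SmoothNear (fun x => (f x, g x)) a := by
  filter_upwards [hf, hg] with x hx hgx using hx.prodMk hgx

theorem add {g : X → Y} (hf : SmoothNear f a) (hg : SmoothNear g a) :
    SmoothNear (fun x => f x + g x) a := by
  filter_upwards [hf, hg] with x hx hgx using hx.add hgx

theorem sub {g : X → Y} (hf : SmoothNear f a) (hg : SmoothNear g a) :
    SmoothNear (fun x => f x - g x) a := by
  filter_upwards [hf, hg] with x hx hgx using hx.sub hgx

theorem clm_apply {g : X → Y →L[ℝ] Z} (hg : SmoothNear g a) (hf : SmoothNear f a) :
    SmoothNear (fun x => g x (f x)) a := by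
  filter_upwards [hf, hg] with x hx hgx using hgx.clm_apply hx

end SmoothNear

theorem smoothNear_of_contDiff {f : X → Y} (h : ContDiff ℝ ∞ f) (a : X) : SmoothNear f a :=
  Eventually.of_forall fun _ => h.contDiffAt

/-- The inverse function theorem for smooth germs. -/
theorem SmoothNear.exists_localInverse [CompleteSpace X] [CompleteSpace Y] {f : X → Y} {a : X}
    (h : SmoothNear f a) (hbij : Function.Bijective (fderiv ℝ f a)) :
    ∃ g : Y → X, SmoothNear g (f a) ∧ g (f a) = a ∧ (∀ᶠ x in 𝓝 a, g (f x) = x) ∧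
      ∀ᶠ y in 𝓝 (f a), f (g y) = y := by
  let e := ContinuousLinearEquiv.ofBijective (fderiv ℝ f a)
    (LinearMap.ker_eq_bot.2 hbij.1) (LinearMap.range_eq_top.2 hbij.2)
  have he : (e : X →L[ℝ] Y) = fderiv ℝ f a := ContinuousLinearEquiv.coe_ofBijective _ _ _
  have hf' : HasFDerivAt f (e : X →L[ℝ] Y) a := he ▸ h.hasFDerivAt
  let Φ := h.contDiffAt.toOpenPartialHomeomorph f hf' (by simp)
  have ha : a ∈ Φ.source := h.contDiffAt.mem_toOpenPartialHomeomorph_source hf' (by simp)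
  have hfa : f a ∈ Φ.target := h.contDiffAt.image_mem_toOpenPartialHomeomorph_target hf' (by simp)
  have hΦ : ∀ x, Φ x = f x := fun x => rfl
  have hga : Φ.symm (f a) = a := Φ.left_inv ha
  refine ⟨Φ.symm, ?_, hga, ?_, ?_⟩
  · have hcont : Tendsto Φ.symm (𝓝 (f a)) (𝓝 a) := by
      have := Φ.continuousAt_symm hfa
      rwa [ContinuousAt, hga] at this
    have hinv : ∀ᶠ x in 𝓝 a, fderiv ℝ f x ∈ range ((↑) : (X ≃L[ℝ] Y) → X →L[ℝ] Y) := by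
      refine h.fderiv.continuousAt.eventually ?_
      rw [← he]
      exact ContinuousLinearEquiv.nhds e
    filter_upwards [Φ.open_target.mem_nhds hfa, hcont.eventually h, hcont.eventually hinv]
      with y hy hs hi
    obtain ⟨e', he'⟩ := hi
    refine Φ.contDiffAt_symm (f₀' := e') hy ?_ hs
    rw [he']
    exact (hs.differentiableAt (by simp)).hasFDerivAt
  · filter_upwards [Φ.open_source.mem_nhds ha] with x hx using Φ.left_inv hx
  · filter_upwards [Φ.open_target.mem_nhds hfa] with y hy using Φ.right_inv hy

/-- The implicit function theorem for smooth germs: the zeros of `f` near `(a, b)` form the graph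
of a smooth map `b ↦ a`. -/
theorem SmoothNear.exists_implicitFunction [CompleteSpace X] [CompleteSpace Y] [CompleteSpace Z]
    {f : X × Z → Y} {a : X} {b : Z} (h : SmoothNear f (a, b)) (h0 : f (a, b) = 0)
    (hbij : Function.Bijective fun x => fderiv ℝ f (a, b) (x, 0)) :
    ∃ z : Z → X, SmoothNear z b ∧ z b = a ∧ (∀ᶠ w in 𝓝 b, f (z w, w) = 0) ∧
      ∀ᶠ p in 𝓝 (a, b), f p = 0 → p.1 = z p.2 := by
  -- the inverse function theorem for `(x, w) ↦ (f (x, w), w)`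
  have hF : SmoothNear (fun p : X × Z => (f p, p.2)) (a, b) :=
    h.prodMk (smoothNear_of_contDiff contDiff_snd _)
  have hd : ∀ q, fderiv ℝ (fun p : X × Z => (f p, p.2)) (a, b) q =
      (fderiv ℝ f (a, b) q, q.2) := fun q => by
    rw [(h.hasFDerivAt.prodMk hasFDerivAt_snd).fderiv]; rfl
  have hsplit : ∀ q : X × Z, fderiv ℝ f (a, b) q =
      fderiv ℝ f (a, b) (q.1, 0) + fderiv ℝ f (a, b) (0, q.2) := fun q => by
    rw [← map_add]; simp
  obtain ⟨g, hg, hga, hgl, hgr⟩ := hF.exists_localInverse (by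
    constructor
    · intro q q' hqq
      rw [hd, hd] at hqq
      obtain ⟨h1, h2⟩ := Prod.mk.inj hqq
      rw [hsplit q, hsplit q', h2] at h1
      exact Prod.ext (hbij.1 (add_right_cancel h1)) h2
    · rintro ⟨y, w⟩
      obtain ⟨x, hx⟩ := hbij.2 (y - fderiv ℝ f (a, b) (0, w))
      refine ⟨(x, w), ?_⟩
      simp only at hx
      rw [hd, hsplit, hx]
      simp)
  simp only [h0] at hg hga hgr
  have hι : SmoothNear (fun w : Z => ((0 : Y), w)) b :=
    smoothNear_of_contDiff (contDiff_const.prodMk contDiff_id) _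
  have htend : Tendsto (fun w : Z => ((0 : Y), w)) (𝓝 b) (𝓝 (0, b)) :=
    (Continuous.prodMk_right (0 : Y)).tendsto b
  refine ⟨fun w => (g (0, w)).1, ?_, congrArg Prod.fst hga, ?_, ?_⟩
  · exact SmoothNear.comp (g := Prod.fst) (smoothNear_of_contDiff contDiff_fst _)
      (SmoothNear.comp (g := g) hg hι)
  · filter_upwards [htend.eventually hgr] with w hw
    have h2 : (g (0, w)).2 = w := congrArg Prod.snd hw
    have h1 : f (g (0, w)) = 0 := congrArg Prod.fst hw
    have h3 : g (0, w) = ((g (0, w)).1, w) := Prod.ext rfl h2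
    rwa [h3] at h1
  · filter_upwards [hgl] with p hp hp0
    rw [hp0] at hp
    rw [hp]

end SmoothGerms

/-! ### Local parametrizations of hypersurfaces -/

/-- A smooth retraction onto the parameter domain, inverse to a local parametrization. -/
theorem IsLocalParam.exists_leftInverse {n : ℕ} {B : Set (Ambient n)} {y : Ambient n}
    {γ : EuclideanSpace ℝ (Fin n) → Ambient n} (h : IsLocalParam B y γ) :
    ∃ P : Ambient n → EuclideanSpace ℝ (Fin n), SmoothNear P y ∧ P y = 0 ∧
      (∀ᶠ z in 𝓝 0, P (γ z) = z) ∧ ∀ᶠ w in 𝓝[B] y, γ (P w) = w := by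
  obtain ⟨L, hL⟩ := LinearMap.exists_leftInverse_of_injective
    (fderiv ℝ γ 0).toLinearMap (LinearMap.ker_eq_bot.2 h.immersion)
  let P₀ : Ambient n →L[ℝ] EuclideanSpace ℝ (Fin n) := L.toContinuousLinearMap
  have hP₀ : ∀ v, P₀ (fderiv ℝ γ 0 v) = v := fun v => LinearMap.congr_fun hL v
  have hs : SmoothNear (fun z => P₀ (γ z)) 0 :=
    SmoothNear.comp (smoothNear_of_contDiff P₀.contDiff _) h.smooth
  have hd : ∀ v, fderiv ℝ (fun z => P₀ (γ z)) 0 v = v := fun v => by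
    have h1 : HasFDerivAt (fun z => P₀ (γ z)) (P₀.comp (fderiv ℝ γ 0)) 0 :=
      P₀.hasFDerivAt.comp 0 h.smooth.hasFDerivAt
    rw [h1.fderiv]
    exact hP₀ v
  obtain ⟨g, hg, hg0, hgl, -⟩ := hs.exists_localInverse
    (by rw [show ⇑(fderiv ℝ (fun z => P₀ (γ z)) 0) = id from funext hd]
        exact Function.bijective_id)
  simp only [h.map_zero] at hg hg0
  refine ⟨fun w => g (P₀ w), SmoothNear.comp hg (smoothNear_of_contDiff P₀.contDiff _), hg0, hgl, ?_⟩
  rw [← h.map_nhds, eventually_map]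
  filter_upwards [hgl] with z hz
  rw [hz]

theorem IsLocalParam.eventually_mem {n : ℕ} {B : Set (Ambient n)} {y : Ambient n}
    {γ : EuclideanSpace ℝ (Fin n) → Ambient n} (h : IsLocalParam B y γ) :
    ∀ᶠ z in 𝓝 0, γ z ∈ B := by
  have : ∀ᶠ w in map γ (𝓝 0), w ∈ B := by
    rw [h.map_nhds]; exact self_mem_nhdsWithin
  exact this

theorem IsLocalParam.tendsto {n : ℕ} {B : Set (Ambient n)} {y : Ambient n}
    {γ : EuclideanSpace ℝ (Fin n) → Ambient n} (h : IsLocalParam B y γ) :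
    Tendsto γ (𝓝 0) (𝓝 y) := by
  have := h.smooth.continuousAt
  rwa [ContinuousAt, h.map_zero] at this

theorem IsLocalParam.mem {n : ℕ} {B : Set (Ambient n)} {y : Ambient n}
    {γ : EuclideanSpace ℝ (Fin n) → Ambient n} (h : IsLocalParam B y γ) : y ∈ B :=
  h.map_zero ▸ h.eventually_mem.self_of_nhds

/-- A map with a smooth retraction which parametrizes `B` near `y` is a local parametrization. -/
theorem isLocalParam_of_leftInverse {n : ℕ} {B : Set (Ambient n)} {y : Ambient n}
    {γ : EuclideanSpace ℝ (Fin n) → Ambient n} {P : Ambient n → EuclideanSpace ℝ (Fin n)}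
    (hγ : SmoothNear γ 0) (h0 : γ 0 = y) (hP : SmoothNear P y) (hP0 : P y = 0)
    (hmem : ∀ᶠ z in 𝓝 0, γ z ∈ B) (hl : ∀ᶠ z in 𝓝 0, P (γ z) = z)
    (hr : ∀ᶠ w in 𝓝[B] y, γ (P w) = w) : IsLocalParam B y γ where
  smooth := hγ
  map_zero := h0
  immersion := by
    have h1 : HasFDerivAt (fun z => P (γ z)) ((fderiv ℝ P y).comp (fderiv ℝ γ 0)) 0 := by
      refine HasFDerivAt.comp (g := P) 0 ?_ hγ.hasFDerivAt
      rw [h0]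
      exact hP.hasFDerivAt
    have h2 : HasFDerivAt (fun z => P (γ z)) (ContinuousLinearMap.id ℝ _) 0 :=
      (hasFDerivAt_id 0).congr_of_eventuallyEq hl
    have h3 := h1.unique h2
    intro v v' hv
    have h4 := congrArg (fderiv ℝ P y) hv
    simpa [← ContinuousLinearMap.comp_apply, h3] using h4
  map_nhds := by
    have ht : Tendsto γ (𝓝 0) (𝓝[B] y) := by
      refine tendsto_nhdsWithin_iff.2 ⟨?_, hmem⟩
      have := hγ.continuousAt
      rwa [ContinuousAt, h0] at this
    refine le_antisymm ht fun s hs => ?_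
    have hPt : Tendsto P (𝓝[B] y) (𝓝 0) := by
      have := hP.continuousAt.tendsto
      rw [hP0] at this
      exact this.mono_left nhdsWithin_le_nhds
    filter_upwards [hPt hs, hr] with w hw hw'
    have : γ (P w) ∈ s := hw
    rwa [hw'] at this

/-- A local parametrization remains one after recentring it at a nearby point. -/
theorem IsLocalParam.eventually_recenter {n : ℕ} {B : Set (Ambient n)} {y : Ambient n}
    {γ : EuclideanSpace ℝ (Fin n) → Ambient n} (h : IsLocalParam B y γ) :
    ∀ᶠ z₁ in 𝓝 0, IsLocalParam B (γ z₁) fun z => γ (z₁ + z) := by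
  obtain ⟨P, hP, hP0, hl, hr⟩ := h.exists_leftInverse
  rw [eventually_nhdsWithin_iff] at hr
  filter_upwards [h.smooth.eventually, h.tendsto.eventually hP.eventually,
    h.eventually_mem.eventually_nhds, hl.eventually_nhds,
    h.tendsto.eventually hr.eventually_nhds] with z₁ h1 h2 h3 h4 h5
  have hadd : Tendsto (fun z => z₁ + z) (𝓝 0) (𝓝 z₁) := by
    have : Continuous fun z : EuclideanSpace ℝ (Fin n) => z₁ + z := by fun_prop
    simpa using this.tendsto 0
  refine isLocalParam_of_leftInverse (P := fun w => P w - z₁) ?_ (by simp) ?_ ?_ ?_ ?_ ?_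
  · refine SmoothNear.comp (g := γ) (by simpa using h1) ?_
    exact smoothNear_of_contDiff (by fun_prop) _
  · exact h2.sub (smoothNear_of_contDiff contDiff_const _)
  · rw [h4.self_of_nhds, sub_self]
  · exact hadd.eventually h3
  · filter_upwards [hadd.eventually h4] with z hz
    rw [hz, add_sub_cancel_left]
  · rw [eventually_nhdsWithin_iff]
    filter_upwards [h5] with w hw hwB
    rw [add_sub_cancel, hw hwB]

/-- A regular level set has local parametrizations. -/
theorem exists_isLocalParam_of_level {n : ℕ} {B : Set (Ambient n)} {y : Ambient n}
    {G : Ambient n → ℝ} (hG : SmoothNear G y) (hG0 : G y = 0) (hG' : fderiv ℝ G y ≠ 0)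
    (hB : ∀ᶠ w in 𝓝 y, (w ∈ B ↔ G w = 0)) : ∃ γ, IsLocalParam B y γ := by
  set L := fderiv ℝ G y with hL
  have hLs : LinearMap.range (L : Ambient n →ₗ[ℝ] ℝ) = ⊤ := by
    rw [LinearMap.range_eq_top]
    exact LinearMap.surjective (fun h => hG' (by ext v; exact LinearMap.congr_fun h v))
  have hfin : Module.finrank ℝ (LinearMap.ker (L : Ambient n →ₗ[ℝ] ℝ)) = n := by
    have := (L : Ambient n →ₗ[ℝ] ℝ).finrank_range_add_finrank_ker
    rw [hLs, finrank_top] at this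
    simp at this
    omega
  obtain ⟨π, hπ⟩ := Submodule.ClosedComplemented.of_finiteDimensional
    (LinearMap.ker (L : Ambient n →ₗ[ℝ] ℝ))
  let e : LinearMap.ker (L : Ambient n →ₗ[ℝ] ℝ) ≃L[ℝ] EuclideanSpace ℝ (Fin n) :=
    ContinuousLinearEquiv.ofFinrankEq (by simp [hfin])
  -- the projection to the kernel of the differential and `G` are coordinates near `y`
  let Q : Ambient n →L[ℝ] EuclideanSpace ℝ (Fin n) := e.toContinuousLinearMap.comp π
  have hΞ : SmoothNear (fun w => (Q (w - y), G w)) y :=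
    SmoothNear.prodMk (smoothNear_of_contDiff (by fun_prop) _) hG
  have hd : fderiv ℝ (fun w => (Q (w - y), G w)) y = Q.prod L := by
    have h1 : HasFDerivAt (fun w => Q (w - y)) Q y := by
      exact Q.hasFDerivAt.comp y ((hasFDerivAt_id y).sub_const y)
    exact (h1.prodMk hG.hasFDerivAt).fderiv
  have hinj : Function.Injective (Q.prod L) := by
    rw [injective_iff_map_eq_zero]
    intro v hv
    have h1 : e (π v) = 0 := congrArg Prod.fst hv
    have h2 : L v = 0 := congrArg Prod.snd hv
    have h3 := hπ ⟨v, h2⟩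
    rw [(map_eq_zero_iff e e.injective).1 h1] at h3
    exact (congrArg Subtype.val h3).symm
  have hbij : Function.Bijective (Q.prod L) := by
    refine ⟨hinj, ?_⟩
    have := (LinearMap.injective_iff_surjective_of_finrank_eq_finrank
      (f := (Q.prod L).toLinearMap) (by simp)).1 hinj
    exact this
  obtain ⟨g, hg, hg0, hgl, hgr⟩ := hΞ.exists_localInverse (by rw [hd]; exact hbij)
  simp only [sub_self, map_zero, hG0] at hg hg0 hgr
  have hι : Tendsto (fun z : EuclideanSpace ℝ (Fin n) => (z, (0 : ℝ))) (𝓝 0) (𝓝 (0, 0)) :=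
    (Continuous.prodMk_left (0 : ℝ)).tendsto _
  have hgt : Tendsto (fun z => g (z, (0 : ℝ))) (𝓝 0) (𝓝 y) := by
    have := hg.continuousAt
    rw [ContinuousAt, hg0] at this
    exact this.comp hι
  refine ⟨fun z => g (z, 0), isLocalParam_of_leftInverse (P := fun w => Q (w - y)) ?_ hg0 ?_
    (by simp) ?_ ?_ ?_⟩
  · exact SmoothNear.comp (g := g) (f := fun z : EuclideanSpace ℝ (Fin n) => (z, (0 : ℝ)))
      hg (smoothNear_of_contDiff (by fun_prop) _)
  · exact smoothNear_of_contDiff (by fun_prop) _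
  · filter_upwards [hgt.eventually hB, hι.eventually hgr] with z hz hz'
    exact hz.2 (congrArg Prod.snd hz')
  · filter_upwards [hι.eventually hgr] with z hz
    exact congrArg Prod.fst hz
  · rw [eventually_nhdsWithin_iff]
    filter_upwards [hgl, hB] with w hw hwB hmem
    rw [hwB.1 hmem] at hw
    exact hw

/-! ### Second and third order conditions at a minimum -/

theorem deriv_deriv_nonneg_of_isLocalMin {φ : ℝ → ℝ} {x : ℝ} (h : IsLocalMin φ x)
    (hc : ContinuousAt φ x) : 0 ≤ deriv (deriv φ) x := by
  by_contra! hneg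
  have hmax : IsLocalMax φ x := isLocalMax_of_deriv_deriv_neg hneg h.deriv_eq_zero hc
  have hconst : φ =ᶠ[𝓝 x] fun _ => φ x := by
    filter_upwards [h, hmax] with t h1 h2 using le_antisymm h2 h1
  have h1 : deriv φ =ᶠ[𝓝 x] fun _ => 0 := by
    have := hconst.deriv
    simpa using this
  have h2 := h1.deriv_eq
  simp only [deriv_const'] at h2
  linarith

/-- A function whose second derivative vanishes and whose third derivative is positive at a
critical point has no local minimum there. -/
theorem not_pos_third_deriv_of_isLocalMin {φ φ₁ φ₂ : ℝ → ℝ} {c : ℝ} (h : IsLocalMin φ 0)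
    (h1 : ∀ᶠ t in 𝓝 0, HasDerivAt φ (φ₁ t) t) (h2 : ∀ᶠ t in 𝓝 0, HasDerivAt φ₁ (φ₂ t) t)
    (h3 : HasDerivAt φ₂ c 0) (h20 : φ₂ 0 = 0) : ¬ 0 < c := by
  intro hc
  have h10 : φ₁ 0 = 0 := by
    have := h.hasDerivAt_eq_zero h1.self_of_nhds
    exact this
  -- to the left of `0`, `φ₂` is negative, so `φ₁` decreases to `0` and is positive, and `φ`
  -- increases towards its minimum
  have hneg : ∀ᶠ t in 𝓝[<] (0 : ℝ), φ₂ t < 0 := by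
    have hs := hasDerivAt_iff_tendsto_slope_left_right.1 h3
    filter_upwards [hs.1.eventually (lt_mem_nhds hc), self_mem_nhdsWithin] with t ht ht0
    rw [slope_def_field, h20, sub_zero, sub_zero] at ht
    rcases div_pos_iff.1 ht with ⟨-, h⟩ | ⟨h, -⟩
    · exact absurd (lt_trans h ht0) (lt_irrefl _)
    · exact h
  obtain ⟨δ₁, hδ₁, H₁⟩ := mem_nhdsLT_iff_exists_Ioo_subset.1 hneg
  obtain ⟨δ₂, hδ₂, H₂⟩ := Metric.eventually_nhds_iff.1 (h1.and (h2.and h))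
  set a := max (δ₁ / 2) (-(δ₂ / 2)) with ha
  have hδ₁' : δ₁ < 0 := hδ₁
  have ha0 : a < 0 := max_lt (by linarith) (by linarith)
  have haδ : δ₁ < a := lt_of_lt_of_le (by linarith) (le_max_left _ _)
  have hball : ∀ t ∈ Icc a 0, dist t 0 < δ₂ := by
    intro t ht
    have : -(δ₂ / 2) ≤ a := le_max_right _ _
    rw [Real.dist_eq, sub_zero, abs_lt]
    constructor <;> linarith [ht.1, ht.2]
  have hanti : StrictAntiOn φ₁ (Icc a 0) := by
    refine strictAntiOn_of_deriv_neg (convex_Icc _ _)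
      (fun t ht => (H₂ (hball t ht)).2.1.continuousAt.continuousWithinAt) fun t ht => ?_
    rw [interior_Icc] at ht
    rw [(H₂ (hball t (Ioo_subset_Icc_self ht))).2.1.deriv]
    exact H₁ ⟨haδ.trans ht.1, ht.2⟩
  have hmono : StrictMonoOn φ (Icc a 0) := by
    refine strictMonoOn_of_deriv_pos (convex_Icc _ _)
      (fun t ht => (H₂ (hball t ht)).1.continuousAt.continuousWithinAt) fun t ht => ?_
    rw [interior_Icc] at ht
    rw [(H₂ (hball t (Ioo_subset_Icc_self ht))).1.deriv, ← h10]
    exact hanti (Ioo_subset_Icc_self ht) (right_mem_Icc.2 ha0.le) ht.2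
  have h4 := hmono (left_mem_Icc.2 ha0.le) (right_mem_Icc.2 ha0.le) ha0
  have h5 := (H₂ (hball a (left_mem_Icc.2 ha0.le))).2.2
  linarith

theorem third_deriv_eq_zero_of_isLocalMin {φ φ₁ φ₂ : ℝ → ℝ} {c : ℝ} (h : IsLocalMin φ 0)
    (h1 : ∀ᶠ t in 𝓝 0, HasDerivAt φ (φ₁ t) t) (h2 : ∀ᶠ t in 𝓝 0, HasDerivAt φ₁ (φ₂ t) t)
    (h3 : HasDerivAt φ₂ c 0) (h20 : φ₂ 0 = 0) : c = 0 := by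
  refine le_antisymm (not_lt.1 (not_pos_third_deriv_of_isLocalMin h h1 h2 h3 h20)) ?_
  have hneg : Tendsto (fun t : ℝ => -t) (𝓝 0) (𝓝 0) := by
    simpa using (continuous_neg (G := ℝ)).tendsto 0
  have hk : ∀ {ψ : ℝ → ℝ} {d t : ℝ}, HasDerivAt ψ d (-t) → HasDerivAt (fun t => ψ (-t)) (-d) t :=
    fun {ψ d t} hd => by
      have := hd.comp t (hasDerivAt_neg t)
      rw [mul_neg_one] at this
      exact this
  have := not_pos_third_deriv_of_isLocalMin (φ := fun t => φ (-t)) (φ₁ := fun t => -φ₁ (-t))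
    (φ₂ := fun t => φ₂ (-t)) (c := -c)
    (by have := hneg.eventually h
        simpa [IsLocalMin, IsMinFilter] using this)
    ((hneg.eventually h1).mono fun t ht => hk ht)
    ((hneg.eventually h2).mono fun t ht => by
      have := (hk ht).neg
      rw [neg_neg] at this
      exact this)
    (hk (by simpa using h3)) (by simpa using h20)
  linarith

section Lines

variable {X : Type*} [NormedAddCommGroup X] [NormedSpace ℝ X]

theorem eventually_smul_line {p : X → Prop} (v : X) (h : ∀ᶠ z in 𝓝 0, p z) :
    ∀ᶠ t : ℝ in 𝓝 0, p (t • v) := by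
  have : Tendsto (fun t : ℝ => t • v) (𝓝 0) (𝓝 0) := by
    have : Continuous fun t : ℝ => t • v := by fun_prop
    simpa using this.tendsto 0
  exact this.eventually h

theorem hasDerivAt_along_line {Y : Type*} [NormedAddCommGroup Y] [NormedSpace ℝ Y] {F : X → Y}
    (v : X) {t : ℝ} (h : DifferentiableAt ℝ F (t • v)) :
    HasDerivAt (fun t : ℝ => F (t • v)) (fderiv ℝ F (t • v) v) t := by
  have h1 : HasDerivAt (fun t : ℝ => t • v) v t := by
    simpa using (hasDerivAt_id t).smul_const v
  exact h.hasFDerivAt.comp_hasDerivAt t h1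

variable {F : X → ℝ}

theorem SmoothNear.eventually_hasDerivAt_line (hF : SmoothNear F 0) (v : X) :
    ∀ᶠ t : ℝ in 𝓝 0, HasDerivAt (fun t : ℝ => F (t • v)) (fderiv ℝ F (t • v) v) t :=
  (eventually_smul_line v hF).mono fun _ ht =>
    hasDerivAt_along_line v (ht.differentiableAt (by simp))

theorem SmoothNear.eventually_hasDerivAt_line₂ (hF : SmoothNear F 0) (v : X) :
    ∀ᶠ t : ℝ in 𝓝 0, HasDerivAt (fun t : ℝ => fderiv ℝ F (t • v) v)
      (fderiv ℝ (fderiv ℝ F) (t • v) v v) t :=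
  (eventually_smul_line v hF.fderiv).mono fun t ht => by
    have := hasDerivAt_along_line v (ht.differentiableAt (by simp))
    simpa using this.clm_apply (hasDerivAt_const t v)

theorem isLocalMin_line {v : X} (h : IsLocalMin F 0) : IsLocalMin (fun t : ℝ => F (t • v)) 0 := by
  have := eventually_smul_line v h
  simpa [IsLocalMin, IsMinFilter] using this

/-- The Hessian at a local minimum is positive semidefinite. -/
theorem SmoothNear.hessian_nonneg (hF : SmoothNear F 0) (h : IsLocalMin F 0) (v : X) :
    0 ≤ fderiv ℝ (fderiv ℝ F) 0 v v := by
  have h1 := hF.eventually_hasDerivAt_line v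
  have h2 := (hF.eventually_hasDerivAt_line₂ v).self_of_nhds
  have hd : deriv (fun t : ℝ => F (t • v)) =ᶠ[𝓝 0] fun t => fderiv ℝ F (t • v) v :=
    h1.mono fun t ht => ht.deriv
  have := deriv_deriv_nonneg_of_isLocalMin (isLocalMin_line (v := v) h)
    h1.self_of_nhds.continuousAt
  rw [hd.deriv_eq, h2.deriv, zero_smul] at this
  exact this

end Lines

/-! ### Distance-squared functions in a parametrization -/

section DistSq

variable {n : ℕ} {B : Set (Ambient n)} {y u : Ambient n}
  {γ : EuclideanSpace ℝ (Fin n) → Ambient n}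

/-- The function `ρ(·, u)` in the parametrization `γ`. -/
noncomputable def distSq (γ : EuclideanSpace ℝ (Fin n) → Ambient n) (u : Ambient n)
    (z : EuclideanSpace ℝ (Fin n)) : ℝ := ‖γ z - u‖ ^ 2

theorem smoothNear_distSq {z : EuclideanSpace ℝ (Fin n)} (h : SmoothNear γ z) (u : Ambient n) :
    SmoothNear (distSq γ u) z := by
  filter_upwards [h] with x hx
  exact (hx.sub contDiffAt_const).norm_sq ℝ

theorem hasFDerivAt_distSq {z : EuclideanSpace ℝ (Fin n)} (h : DifferentiableAt ℝ γ z)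
    (u : Ambient n) :
    HasFDerivAt (distSq γ u) ((2 : ℝ) • (innerSL ℝ (γ z - u)).comp (fderiv ℝ γ z)) z := by
  have := (h.hasFDerivAt.sub_const u).norm_sq
  rw [← Nat.cast_smul_eq_nsmul ℝ, Nat.cast_ofNat] at this
  exact this

theorem fderiv_distSq_apply {z : EuclideanSpace ℝ (Fin n)} (h : DifferentiableAt ℝ γ z)
    (u : Ambient n) (v : EuclideanSpace ℝ (Fin n)) :
    fderiv ℝ (distSq γ u) z v = 2 * ⟪γ z - u, fderiv ℝ γ z v⟫ := by
  rw [(hasFDerivAt_distSq h u).fderiv]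
  simp [inner_sub_left]

theorem hessian_distSq_apply {z : EuclideanSpace ℝ (Fin n)} (h : SmoothNear γ z)
    (u : Ambient n) (v v' : EuclideanSpace ℝ (Fin n)) :
    fderiv ℝ (fderiv ℝ (distSq γ u)) z v v' =
      2 * (⟪fderiv ℝ γ z v, fderiv ℝ γ z v'⟫ + ⟪γ z - u, fderiv ℝ (fderiv ℝ γ) z v v'⟫) := by
  have h1 : fderiv ℝ (distSq γ u) =ᶠ[𝓝 z]
      fun z => (2 : ℝ) • (innerSL ℝ (γ z - u)).comp (fderiv ℝ γ z) :=
    h.mono fun x hx => (hasFDerivAt_distSq (hx.differentiableAt (by simp)) u).fderiv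
  have h2 : HasFDerivAt (fun z => innerSL ℝ (γ z - u)) ((innerSL ℝ).comp (fderiv ℝ γ z)) z :=
    (innerSL ℝ).hasFDerivAt.comp z (h.hasFDerivAt.sub_const u)
  have h3 : HasFDerivAt (fun z => (2 : ℝ) • (innerSL ℝ (γ z - u)).comp (fderiv ℝ γ z)) _ z :=
    (h2.clm_comp h.fderiv.hasFDerivAt).const_smul (2 : ℝ)
  rw [h1.fderiv_eq, h3.fderiv]
  simp [inner_sub_left]
  ring

theorem mem_closestPoints_iff {Ω : Set (Ambient n)} :
    y ∈ closestPoints Ω u ↔ y ∈ frontier Ω ∧ ∀ b ∈ frontier Ω, dist u y ≤ dist u b := by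
  constructor
  · rintro ⟨h1, h2⟩
    exact ⟨h1, fun b hb => h2 ▸ Metric.infDist_le_dist_of_mem hb⟩
  · rintro ⟨h1, h2⟩
    exact ⟨h1, le_antisymm ((Metric.le_infDist ⟨y, h1⟩).2 fun {b} hb => h2 b hb)
      (Metric.infDist_le_dist_of_mem h1)⟩

theorem IsLocalParam.isLocalMin_distSq (hγ : IsLocalParam B y γ)
    (h : ∀ b ∈ B, dist u y ≤ dist u b) : IsLocalMin (distSq γ u) 0 := by
  filter_upwards [hγ.eventually_mem] with z hz
  have := h _ hz
  rw [dist_comm, dist_comm u, dist_eq_norm, dist_eq_norm] at this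
  unfold distSq
  rw [hγ.map_zero]
  gcongr

/-- Degeneracy of a critical point may be tested in any parametrization. -/
theorem IsLocalParam.isDegenerateAt_iff (hγ : IsLocalParam B y γ)
    (hcrit : fderiv ℝ (distSq γ u) 0 = 0) :
    IsDegenerateAt B u y ↔ ∃ v ≠ 0, fderiv ℝ (fderiv ℝ (distSq γ u)) 0 v = 0 := by
  constructor
  swap
  · rintro ⟨v, hv, h⟩
    exact ⟨γ, hγ, v, hv, h⟩
  rintro ⟨γ', hγ', v, hv, h⟩
  obtain ⟨P, hP, hP0, hl, hr⟩ := hγ.exists_leftInverse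
  -- `γ' = γ ∘ τ`, and at a critical point the Hessian transforms by the derivative of `τ` alone
  have hτ : SmoothNear (fun z => P (γ' z)) 0 :=
    SmoothNear.comp (by rw [hγ'.map_zero]; exact hP) hγ'.smooth
  set τ := fun z => P (γ' z) with hτdef
  have hτ0 : τ 0 = 0 := by simp only [hτdef, hγ'.map_zero, hP0]
  have heq : ∀ᶠ z in 𝓝 0, γ (τ z) = γ' z := by
    rw [← hγ'.map_nhds, eventually_map] at hr
    exact hr
  have hγ0 : HasFDerivAt γ (fderiv ℝ γ 0) (τ 0) := by rw [hτ0]; exact hγ.smooth.hasFDerivAt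
  have hinj : Function.Injective (fderiv ℝ τ 0) := by
    have h1 : HasFDerivAt (fun z => γ (τ z)) ((fderiv ℝ γ 0).comp (fderiv ℝ τ 0)) 0 :=
      hγ0.comp 0 hτ.hasFDerivAt
    have h2 := h1.congr_of_eventuallyEq (heq.mono fun z hz => hz.symm)
    have h3 := hγ'.immersion
    rw [h2.fderiv] at h3
    exact Function.Injective.of_comp h3
  have hsurj : Function.Surjective (fderiv ℝ τ 0) :=
    LinearMap.injective_iff_surjective (f := (fderiv ℝ τ 0).toLinearMap).1 hinj
  have hf := smoothNear_distSq hγ.smooth u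
  have hτt : Tendsto τ (𝓝 0) (𝓝 0) := by
    have := hτ.continuousAt
    rwa [ContinuousAt, hτ0] at this
  have h1 : fderiv ℝ (fun z => ‖γ' z - u‖ ^ 2) =ᶠ[𝓝 0]
      fun z => (fderiv ℝ (distSq γ u) (τ z)).comp (fderiv ℝ τ z) := by
    have h2 : (fun z => ‖γ' z - u‖ ^ 2) =ᶠ[𝓝 0] fun z => distSq γ u (τ z) :=
      heq.mono fun z hz => by simp only [distSq, hz]
    refine h2.fderiv.trans ?_
    filter_upwards [hτ, hτt.eventually hf] with z hz hz'
    exact ((hz'.differentiableAt (by simp)).hasFDerivAt.comp z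
      (hz.differentiableAt (by simp)).hasFDerivAt).fderiv
  have h2 : HasFDerivAt (fun z => fderiv ℝ (distSq γ u) (τ z))
      ((fderiv ℝ (fderiv ℝ (distSq γ u)) 0).comp (fderiv ℝ τ 0)) 0 := by
    have h3 : HasFDerivAt (fderiv ℝ (distSq γ u)) (fderiv ℝ (fderiv ℝ (distSq γ u)) 0) (τ 0) := by
      rw [hτ0]; exact hf.fderiv.hasFDerivAt
    exact h3.comp 0 hτ.hasFDerivAt
  have h4 := h2.clm_comp hτ.fderiv.hasFDerivAt
  rw [h1.fderiv_eq, h4.fderiv] at h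
  refine ⟨fderiv ℝ τ 0 v, fun h0 => hv ((map_eq_zero_iff _ hinj).1 h0), ?_⟩
  ext x
  obtain ⟨x', rfl⟩ := hsurj x
  have h5 := congrArg (fun A => A x') h
  simpa [hτ0, hcrit] using h5

end DistSq

/-! ### Smooth sheets of closest points -/

section Sheets

variable {n : ℕ} {B : Set (Ambient n)} {y u : Ambient n}
  {γ : EuclideanSpace ℝ (Fin n) → Ambient n}

theorem IsLocalParam.inner_eq_zero_of_closest (hγ : IsLocalParam B y γ)
    (h : ∀ b ∈ B, dist u y ≤ dist u b) (v : EuclideanSpace ℝ (Fin n)) :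
    ⟪y - u, fderiv ℝ γ 0 v⟫ = 0 := by
  have h1 := (hγ.isLocalMin_distSq h).fderiv_eq_zero
  have h2 := fderiv_distSq_apply hγ.smooth.differentiableAt u v
  rw [h1, hγ.map_zero] at h2
  simpa using h2.symm

theorem IsLocalParam.fderiv_distSq_eq_zero (hγ : IsLocalParam B y γ)
    (h : ∀ v, ⟪y - u, fderiv ℝ γ 0 v⟫ = 0) : fderiv ℝ (distSq γ u) 0 = 0 := by
  ext v
  rw [fderiv_distSq_apply hγ.smooth.differentiableAt, hγ.map_zero, h]
  simp

theorem hessian_distSq_symm {z : EuclideanSpace ℝ (Fin n)} (h : SmoothNear γ z) (u : Ambient n)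
    (v v' : EuclideanSpace ℝ (Fin n)) :
    fderiv ℝ (fderiv ℝ (distSq γ u)) z v v' = fderiv ℝ (fderiv ℝ (distSq γ u)) z v' v :=
  ((smoothNear_distSq h u).contDiffAt.isSymmSndFDerivAt (by
    simp only [minSmoothness_of_isRCLikeNormedField]; exact WithTop.coe_le_coe.2 (le_top : (2 : ℕ∞) ≤ ⊤))).eq v v'

/-- A nondegenerate minimum has a positive definite Hessian. -/
theorem IsLocalParam.hessian_pos_of_closest (hγ : IsLocalParam B y γ)
    (h : ∀ b ∈ B, dist u y ≤ dist u b) (hnd : ¬ IsDegenerateAt B u y)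
    {v : EuclideanSpace ℝ (Fin n)} (hv : v ≠ 0) :
    0 < fderiv ℝ (fderiv ℝ (distSq γ u)) 0 v v := by
  set H := fderiv ℝ (fderiv ℝ (distSq γ u)) 0 with hH
  have hmin := hγ.isLocalMin_distSq h
  have hnn : ∀ v, 0 ≤ H v v := (smoothNear_distSq hγ.smooth u).hessian_nonneg hmin
  refine lt_of_le_of_ne (hnn v) fun h0 => hnd ⟨γ, hγ, v, hv, ?_⟩
  change H v = 0
  ext x
  have key : ∀ t : ℝ, 0 ≤ 2 * t * H v x + t ^ 2 * H x x := fun t => by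
    have h1 := hnn (v + t • x)
    have h2 : H x v = H v x := hessian_distSq_symm hγ.smooth u x v
    simp only [map_add, map_smul, add_apply, smul_apply,
      smul_eq_mul, ← h0, h2] at h1
    linarith
  by_contra hne
  have hne : H v x ≠ 0 := hne
  have hxx := hnn x
  have h3 := key (-(H v x) / (H x x + 1))
  have h4 : 2 * (-(H v x) / (H x x + 1)) * H v x + (-(H v x) / (H x x + 1)) ^ 2 * H x x =
      -(H v x) ^ 2 * (H x x + 2) / (H x x + 1) ^ 2 := by
    field_simp; ring
  rw [h4] at h3
  have h5 : 0 < (H v x) ^ 2 * (H x x + 2) / (H x x + 1) ^ 2 := by positivity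
  have h6 : -(H v x) ^ 2 * (H x x + 2) / (H x x + 1) ^ 2 =
    -((H v x) ^ 2 * (H x x + 2) / (H x x + 1) ^ 2) := by ring
  linarith

/-- `q` is a smooth local choice, for `w` near `u`, of the critical points near `y` of the
distance-squared function to `w` on `B`: the vector `q w - w` is normal to `B`, `q` is constant to
first order along the line through `w` and `q w`, near `y` only `q w` can be a closest point to `w`,
and the critical points `q w` are nondegenerate. -/
structure IsSheet (B : Set (Ambient n)) (y u : Ambient n) (q : Ambient n → Ambient n) :
    Prop where
  smooth : SmoothNear q u
  map_base : q u = y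
  mem : ∀ᶠ w in 𝓝 u, q w ∈ B
  orth : ∀ᶠ w in 𝓝 u, ∀ v, ⟪q w - w, fderiv ℝ q w v⟫ = 0
  ker : ∀ᶠ w in 𝓝 u, fderiv ℝ q w (q w - w) = 0
  eq_of_closest : ∀ᶠ p in 𝓝 (y, u), p.1 ∈ B → (∀ b ∈ B, dist p.2 p.1 ≤ dist p.2 b) → p.1 = q p.2
  not_isDegenerateAt : ∀ᶠ w in 𝓝 u, ¬ IsDegenerateAt B w (q w)

/-- The map whose zeros `(z, w)` are the critical points `z` of the distance-squared function
to `w`. -/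
noncomputable def criticalMap (γ : EuclideanSpace ℝ (Fin n) → Ambient n)
    (p : EuclideanSpace ℝ (Fin n) × Ambient n) : EuclideanSpace ℝ (Fin n) →L[ℝ] ℝ :=
  (innerSL ℝ (γ p.1 - p.2)).comp (fderiv ℝ γ p.1)

theorem criticalMap_eq_zero_iff {p : EuclideanSpace ℝ (Fin n) × Ambient n} :
    criticalMap γ p = 0 ↔ ∀ v, ⟪γ p.1 - p.2, fderiv ℝ γ p.1 v⟫ = 0 :=
  ⟨fun h v => congrArg (fun A => A v) h, fun h => ContinuousLinearMap.ext h⟩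

theorem smoothNear_criticalMap {p : EuclideanSpace ℝ (Fin n) × Ambient n}
    (h : SmoothNear γ p.1) : SmoothNear (criticalMap γ) p := by
  filter_upwards [continuousAt_fst.eventually h.eventually] with x hx
  have h1 : ContDiffAt ℝ ∞ (fun p : EuclideanSpace ℝ (Fin n) × Ambient n => γ p.1 - p.2) x :=
    (hx.contDiffAt.comp x contDiffAt_fst).sub contDiffAt_snd
  have h2 : ContDiffAt ℝ ∞ (fun p : EuclideanSpace ℝ (Fin n) × Ambient n => fderiv ℝ γ p.1) x :=
    ContDiffAt.comp (g := fderiv ℝ γ) x hx.fderiv.contDiffAt contDiffAt_fst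
  exact ((innerSL ℝ).contDiff.contDiffAt.comp x h1).clm_comp h2

theorem fderiv_criticalMap {p : EuclideanSpace ℝ (Fin n) × Ambient n} (h : SmoothNear γ p.1)
    (ζ : EuclideanSpace ℝ (Fin n)) (η : Ambient n) (v : EuclideanSpace ℝ (Fin n)) :
    fderiv ℝ (criticalMap γ) p (ζ, η) v =
      fderiv ℝ (fderiv ℝ (distSq γ p.2)) p.1 ζ v / 2 - ⟪η, fderiv ℝ γ p.1 v⟫ := by
  have h1 : HasFDerivAt (fun p : EuclideanSpace ℝ (Fin n) × Ambient n => γ p.1 - p.2)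
      ((fderiv ℝ γ p.1).comp (ContinuousLinearMap.fst ℝ _ _) - ContinuousLinearMap.snd ℝ _ _) p :=
    (h.hasFDerivAt.comp p hasFDerivAt_fst).sub hasFDerivAt_snd
  have h2 : HasFDerivAt (fun p : EuclideanSpace ℝ (Fin n) × Ambient n => fderiv ℝ γ p.1)
      ((fderiv ℝ (fderiv ℝ γ) p.1).comp (ContinuousLinearMap.fst ℝ _ _)) p :=
    HasFDerivAt.comp (g := fderiv ℝ γ) p h.fderiv.hasFDerivAt hasFDerivAt_fst
  have h3 : HasFDerivAt (criticalMap γ) _ p :=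
    ((innerSL ℝ).hasFDerivAt.comp p h1).clm_comp h2
  rw [h3.fderiv, hessian_distSq_apply h]
  change ⟪γ p.1 - p.2, fderiv ℝ (fderiv ℝ γ) p.1 ζ v⟫ + ⟪fderiv ℝ γ p.1 ζ - η, fderiv ℝ γ p.1 v⟫ = _
  rw [inner_sub_left (fderiv ℝ γ p.1 ζ)]
  ring

theorem fderiv_shift (γ : EuclideanSpace ℝ (Fin n) → Ambient n) (z₁ : EuclideanSpace ℝ (Fin n)) :
    fderiv ℝ (fun z => γ (z₁ + z)) = fun z => fderiv ℝ γ (z₁ + z) := by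
  funext z
  exact fderiv_comp_add_left z₁

theorem fderiv_distSq_shift (γ : EuclideanSpace ℝ (Fin n) → Ambient n)
    (z₁ : EuclideanSpace ℝ (Fin n)) (u : Ambient n) :
    fderiv ℝ (distSq (fun z => γ (z₁ + z)) u) = fun z => fderiv ℝ (distSq γ u) (z₁ + z) := by
  funext z
  exact fderiv_comp_add_left (f := distSq γ u) z₁

theorem hessian_distSq_shift (γ : EuclideanSpace ℝ (Fin n) → Ambient n)
    (z₁ : EuclideanSpace ℝ (Fin n)) (u : Ambient n) :
    fderiv ℝ (fderiv ℝ (distSq (fun z => γ (z₁ + z)) u)) =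
      fun z => fderiv ℝ (fderiv ℝ (distSq γ u)) (z₁ + z) := by
  rw [fderiv_distSq_shift]
  funext z
  exact fderiv_comp_add_left (f := fderiv ℝ (distSq γ u)) z₁

/-- A nondegenerate minimum of the distance-squared function persists as a sheet of critical
points.  The implicit function theorem gives `q = γ ∘ z` with `z' = 2 H⁻¹ (γ')ᵀ`, where `H` is the
Hessian, so that the derivative of `q` is positive semidefinite. -/
theorem IsLocalParam.exists_isSheet (hγ : IsLocalParam B y γ)
    (hcrit : ∀ v, ⟪y - u, fderiv ℝ γ 0 v⟫ = 0)
    (hpos : ∀ v ≠ 0, 0 < fderiv ℝ (fderiv ℝ (distSq γ u)) 0 v v) :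
    ∃ q, IsSheet B y u q ∧ (∀ᶠ w in 𝓝 u, (∀ v, ⟪y - w, fderiv ℝ γ 0 v⟫ = 0) → q w = y) ∧
      ∀ v, 0 ≤ ⟪fderiv ℝ q u v, v⟫ ∧
        (⟪fderiv ℝ q u v, v⟫ = 0 → ∀ x, ⟪v, fderiv ℝ γ 0 x⟫ = 0) := by
  set H := fderiv ℝ (fderiv ℝ (distSq γ u)) 0 with hH
  have hs : SmoothNear (criticalMap γ) ((0 : EuclideanSpace ℝ (Fin n)), u) :=
    smoothNear_criticalMap (p := (0, u)) hγ.smooth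
  have h0 : criticalMap γ (0, u) = 0 := by
    rw [criticalMap_eq_zero_iff]; simpa [hγ.map_zero] using hcrit
  have hd : ∀ x v, fderiv ℝ (criticalMap γ) (0, u) (x, 0) v = H x v / 2 := fun x v => by
    rw [fderiv_criticalMap (p := (0, u)) hγ.smooth]; simp [hH]
  -- `A` is half the Hessian of the distance-squared function, so it is invertible at `(0, u)`
  let A : EuclideanSpace ℝ (Fin n) × Ambient n →
      (EuclideanSpace ℝ (Fin n) →L[ℝ] EuclideanSpace ℝ (Fin n) →L[ℝ] ℝ) := fun p =>
    (fderiv ℝ (criticalMap γ) p).comp (ContinuousLinearMap.inl ℝ _ _)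
  have hAinj : Function.Injective (A (0, u)) := by
    rw [injective_iff_map_eq_zero]
    intro x hx
    by_contra hne
    have h1 := congrArg (fun A => A x) hx
    have h2 := hpos x hne
    have h3 : fderiv ℝ (criticalMap γ) (0, u) (x, 0) x = 0 := h1
    rw [hd] at h3
    linarith
  have hfin : Module.finrank ℝ (EuclideanSpace ℝ (Fin n)) =
      Module.finrank ℝ (EuclideanSpace ℝ (Fin n) →L[ℝ] ℝ) := by
    rw [← (LinearMap.toContinuousLinearMap (𝕜 := ℝ) (E := EuclideanSpace ℝ (Fin n))
      (F' := ℝ)).finrank_eq]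
    exact (Subspace.dual_finrank_eq (K := ℝ)).symm
  have hAsurj : Function.Surjective (A (0, u)) :=
    (LinearMap.injective_iff_surjective_of_finrank_eq_finrank
      (f := (A (0, u)).toLinearMap) hfin).1 hAinj
  obtain ⟨z, hz, hz0, hzc, hzu⟩ := hs.exists_implicitFunction h0 ⟨hAinj, hAsurj⟩
  have hzt : Tendsto z (𝓝 u) (𝓝 0) := by
    have := hz.continuousAt
    rwa [ContinuousAt, hz0] at this
  have hzt' : Tendsto (fun w => (z w, w)) (𝓝 u) (𝓝 (0, u)) := hzt.prodMk_nhds tendsto_id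
  -- the Hessian stays injective near the base point
  have hAinj' : ∀ᶠ w in 𝓝 u, Function.Injective (A (z w, w)) := by
    let e := ContinuousLinearEquiv.ofBijective (A (0, u))
      (LinearMap.ker_eq_bot.2 hAinj) (LinearMap.range_eq_top.2 hAsurj)
    have he : (e : _ →L[ℝ] _) = A (0, u) := ContinuousLinearEquiv.coe_ofBijective _ _ _
    have hAc : ContinuousAt A (0, u) := hs.fderiv.continuousAt.clm_comp continuousAt_const
    have h1 : ∀ᶠ p in 𝓝 ((0 : EuclideanSpace ℝ (Fin n)), u), A p ∈ range
        ((↑) : (EuclideanSpace ℝ (Fin n) ≃L[ℝ] (EuclideanSpace ℝ (Fin n) →L[ℝ] ℝ)) →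
          (EuclideanSpace ℝ (Fin n) →L[ℝ] EuclideanSpace ℝ (Fin n) →L[ℝ] ℝ)) := by
      refine hAc.eventually ?_
      rw [← he]
      exact ContinuousLinearEquiv.nhds e
    filter_upwards [hzt'.eventually h1] with w hw
    obtain ⟨e', he'⟩ := hw
    rw [← he']
    exact e'.injective
  -- differentiating the critical point equation
  have hzd : ∀ᶠ w in 𝓝 u, ∀ η v,
      fderiv ℝ (fderiv ℝ (distSq γ w)) (z w) (fderiv ℝ z w η) v / 2 = ⟪η, fderiv ℝ γ (z w) v⟫ := by
    filter_upwards [hzc.eventually_nhds, hz, hzt.eventually hγ.smooth.eventually] with w h1 h2 h3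
    intro η v
    have h4 : HasFDerivAt (fun w => (z w, w))
        ((fderiv ℝ z w).prod (ContinuousLinearMap.id ℝ _)) w :=
      (h2.differentiableAt (by simp)).hasFDerivAt.prodMk (hasFDerivAt_id w)
    have h5 : HasFDerivAt (fun w => criticalMap γ (z w, w)) _ w :=
      HasFDerivAt.comp (g := criticalMap γ) w
        (smoothNear_criticalMap (p := (z w, w)) h3).hasFDerivAt h4
    have h6 : HasFDerivAt (fun w => criticalMap γ (z w, w)) 0 w :=
      (hasFDerivAt_const (𝕜 := ℝ) (0 : EuclideanSpace ℝ (Fin n) →L[ℝ] ℝ) w).congr_of_eventuallyEq h1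
    have h7 := congrArg (fun A => A η v) (h5.unique h6)
    have h8 : fderiv ℝ (criticalMap γ) (z w, w) (fderiv ℝ z w η, η) v = 0 := h7
    rw [fderiv_criticalMap (p := (z w, w)) h3] at h8
    simp only at h8
    linarith
  have hq : ∀ᶠ w in 𝓝 u, HasFDerivAt (fun w => γ (z w)) ((fderiv ℝ γ (z w)).comp (fderiv ℝ z w))
      w := by
    filter_upwards [hz, hzt.eventually hγ.smooth] with w h2 h3
    exact (h3.differentiableAt (by simp)).hasFDerivAt.comp w
      (h2.differentiableAt (by simp)).hasFDerivAt
  obtain ⟨P, hP, hP0, hl, hr⟩ := hγ.exists_leftInverse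
  have hPt : Tendsto P (𝓝 y) (𝓝 0) := by
    have := hP.continuousAt
    rwa [ContinuousAt, hP0] at this
  refine ⟨fun w => γ (z w), ⟨?_, ?_, ?_, ?_, ?_, ?_, ?_⟩, ?_, ?_⟩
  · exact SmoothNear.comp (by rw [hz0]; exact hγ.smooth) hz
  · rw [hz0, hγ.map_zero]
  · exact hzt.eventually hγ.eventually_mem
  · filter_upwards [hzc, hq] with w h1 h2 v
    rw [h2.fderiv]
    exact criticalMap_eq_zero_iff.1 h1 _
  · filter_upwards [hzc, hq, hzd, hAinj', hzt.eventually hγ.smooth.eventually]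
      with w h1 h2 h3 h4 h5
    rw [h2.fderiv]
    have h6 : fderiv ℝ z w (γ (z w) - w) = 0 := by
      refine h4 (Eq.trans ?_ (_root_.map_zero (A (z w, w))).symm)
      ext v
      change fderiv ℝ (criticalMap γ) (z w, w) (_, 0) v = 0
      rw [fderiv_criticalMap (p := (z w, w)) h5]
      have h7 := h3 (γ (z w) - w) v
      rw [criticalMap_eq_zero_iff.1 h1 v] at h7
      simpa using h7
    rw [ContinuousLinearMap.comp_apply, h6, _root_.map_zero]
  · rw [eventually_nhdsWithin_iff] at hr
    have t2 : Tendsto (fun p : Ambient n × Ambient n => p.1) (𝓝 (y, u)) (𝓝 y) := continuousAt_fst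
    have t1 : Tendsto (fun p : Ambient n × Ambient n => (P p.1, p.2)) (𝓝 (y, u)) (𝓝 (0, u)) :=
      (hPt.comp t2).prodMk_nhds continuousAt_snd
    filter_upwards [t1.eventually hzu, t2.eventually hr,
      t2.eventually (hPt.eventually hγ.eventually_recenter)] with p h1 h2 h3 hB hclose
    rw [h2 hB] at h3
    have h4 := h3.inner_eq_zero_of_closest hclose
    rw [fderiv_shift] at h4
    rw [← h1 (criticalMap_eq_zero_iff.2 (by simpa [h2 hB] using h4)), h2 hB]
  · filter_upwards [hzc, hAinj', hzt.eventually hγ.smooth.eventually,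
      hzt.eventually hγ.eventually_recenter] with w h1 h2 h3 h4
    have h5 := h4.fderiv_distSq_eq_zero (u := w) (by
      rw [fderiv_shift]
      simpa using criticalMap_eq_zero_iff.1 h1)
    rw [h4.isDegenerateAt_iff h5]
    rintro ⟨v, hv, h6⟩
    refine hv (h2 (Eq.trans ?_ (_root_.map_zero (A (z w, w))).symm))
    rw [hessian_distSq_shift] at h6
    simp only [add_zero] at h6
    ext x
    change fderiv ℝ (criticalMap γ) (z w, w) (_, 0) x = 0
    rw [fderiv_criticalMap (p := (z w, w)) h3]
    have h7 := congrArg (fun A => A x) h6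
    simpa using h7
  · have t1 : Tendsto (fun w => ((0 : EuclideanSpace ℝ (Fin n)), w)) (𝓝 u) (𝓝 (0, u)) :=
      (Continuous.prodMk_right _).tendsto u
    filter_upwards [t1.eventually hzu] with w h1 h2
    have h3 := h1 (criticalMap_eq_zero_iff.2 (by simpa [hγ.map_zero] using h2))
    rw [← h3, hγ.map_zero]
  · intro v
    have h1 := hzd.self_of_nhds
    rw [hz0] at h1
    have h2 : ⟪fderiv ℝ (fun w => γ (z w)) u v, v⟫ = H (fderiv ℝ z u v) (fderiv ℝ z u v) / 2 := by
      rw [hq.self_of_nhds.fderiv, hz0, h1, real_inner_comm]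
      rfl
    rw [h2]
    rcases eq_or_ne (fderiv ℝ z u v) 0 with h3 | h3
    · refine ⟨by rw [h3]; simp, fun _ x => ?_⟩
      rw [← h1, h3]; simp
    · have := hpos _ h3
      exact ⟨by positivity, fun h => by linarith⟩

end Sheets

/-! ### Versality and degenerate minima -/

section Versality

variable {n : ℕ} {B : Set (Ambient n)} {y u : Ambient n}
  {γ : EuclideanSpace ℝ (Fin n) → Ambient n}

/-- Infinitesimal versality: the one-parameter deformation in the direction of `h` is induced from
the family of distance-squared functions, and differentiation in the parameter writes `h` as an
element of the Jacobian ideal plus a combination of the initial speeds of the family. -/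
theorem IsVersalAt.exists_decomposition (hV : IsVersalAt B {y} u) (hγ : IsLocalParam B y γ)
    {h : EuclideanSpace ℝ (Fin n) → ℝ} (hh : ContDiff ℝ ∞ h) :
    ∃ (X : EuclideanSpace ℝ (Fin n) → EuclideanSpace ℝ (Fin n)) (η : Ambient n) (c : ℝ),
      SmoothNear X 0 ∧
      ∀ᶠ z in 𝓝 0, h z = criticalMap γ (z, u) (X z) - ⟪γ z - u, η⟫ + c := by
  have hsub : ∀ s : ({y} : Finset (Ambient n)), (s : Ambient n) = y := fun s =>
    Finset.mem_singleton.1 s.2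
  let e : EuclideanSpace ℝ (Fin 1) := EuclideanSpace.single 0 1
  obtain ⟨φ, μ, c, hφ, hφ0, hμ, hμ0, hc, -, hG⟩ := hV (fun _ => γ)
    (fun s => by rw [hsub s]; exact hγ) 1
    -- the factor `2` cancels the one produced by differentiating a square
    (fun _ q => distSq γ u q.1 + q.2 0 * (2 * h q.1))
    (fun s => by
      have h1 : SmoothNear (fun q : EuclideanSpace ℝ (Fin n) × EuclideanSpace ℝ (Fin 1) =>
          distSq γ u q.1) 0 :=
        SmoothNear.comp (g := distSq γ u) (smoothNear_distSq hγ.smooth u)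
          (smoothNear_of_contDiff contDiff_fst _)
      refine h1.add (smoothNear_of_contDiff ?_ _)
      fun_prop)
    (fun s => Eventually.of_forall fun z => by simp [distSq])
  let s₀ : ({y} : Finset (Ambient n)) := ⟨y, Finset.mem_singleton_self y⟩
  have hι : Tendsto (fun z : EuclideanSpace ℝ (Fin n) => (z, (0 : EuclideanSpace ℝ (Fin 1))))
      (𝓝 0) (𝓝 0) := (Continuous.prodMk_left (0 : EuclideanSpace ℝ (Fin 1))).tendsto _
  refine ⟨fun z => fderiv ℝ (φ s₀) (z, 0) (0, e), fderiv ℝ μ 0 e, fderiv ℝ c 0 e / 2, ?_, ?_⟩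
  · have h1 : SmoothNear (fun z : EuclideanSpace ℝ (Fin n) => fderiv ℝ (φ s₀) (z, 0)) 0 :=
      SmoothNear.comp (g := fderiv ℝ (φ s₀)) (f := fun z => (z, 0)) (hφ s₀).fderiv
        (smoothNear_of_contDiff (by fun_prop) _)
    exact h1.clm_apply (smoothNear_of_contDiff contDiff_const _)
  · filter_upwards [hι.eventually (hφ s₀), hφ0 s₀, hι.eventually (hG s₀).eventually_nhds,
      hγ.smooth] with z h1 h2 h3 h4
    -- both sides of the induced deformation are differentiated along `t ↦ t e` at `t = 0`
    have hpath : HasDerivAt (fun t : ℝ => (z, t • e)) (0, e) 0 := by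
      have := (hasDerivAt_id (0 : ℝ)).smul_const e
      simpa using (hasDerivAt_const (0 : ℝ) z).prodMk this
    have hpath2 : HasDerivAt (fun t : ℝ => t • e) e 0 := by
      simpa using (hasDerivAt_id (0 : ℝ)).smul_const e
    have d1 : HasDerivAt (fun t : ℝ => φ s₀ (z, t • e)) (fderiv ℝ (φ s₀) (z, 0) (0, e)) 0 := by
      refine HasFDerivAt.comp_hasDerivAt (l := φ s₀) (f := fun t : ℝ => (z, t • e)) 0 ?_ hpath
      rw [zero_smul]
      exact (h1.differentiableAt (by simp)).hasFDerivAt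
    have d2 : HasDerivAt (fun t : ℝ => γ (φ s₀ (z, t • e)))
        (fderiv ℝ γ z (fderiv ℝ (φ s₀) (z, 0) (0, e))) 0 := by
      refine HasFDerivAt.comp_hasDerivAt (l := γ) (f := fun t : ℝ => φ s₀ (z, t • e)) 0 ?_ d1
      rw [zero_smul, h2]
      exact (h4.differentiableAt (by simp)).hasFDerivAt
    have d3 : HasDerivAt (fun t : ℝ => μ (t • e)) (fderiv ℝ μ 0 e) 0 := by
      refine HasFDerivAt.comp_hasDerivAt (l := μ) (f := fun t : ℝ => t • e) 0 ?_ hpath2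
      rw [zero_smul]
      exact hμ.hasFDerivAt
    have d4 : HasDerivAt (fun t : ℝ => c (t • e)) (fderiv ℝ c 0 e) 0 := by
      refine HasFDerivAt.comp_hasDerivAt (l := c) (f := fun t : ℝ => t • e) 0 ?_ hpath2
      rw [zero_smul]
      exact hc.hasFDerivAt
    have d5 := ((d2.sub d3).norm_sq).add d4
    have d6 : HasDerivAt (fun t : ℝ => distSq γ u z + (t • e) 0 * (2 * h z)) (2 * h z) 0 := by
      have : (fun t : ℝ => distSq γ u z + (t • e) 0 * (2 * h z)) =
          fun t : ℝ => distSq γ u z + t * (2 * h z) := by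
        funext t; simp [e]
      rw [this]
      simpa using ((hasDerivAt_id (0 : ℝ)).mul_const (2 * h z)).const_add (distSq γ u z)
    have hpt : Tendsto (fun t : ℝ => (z, t • e)) (𝓝 0) (𝓝 (z, 0)) := by
      have := hpath.continuousAt
      rwa [ContinuousAt, zero_smul] at this
    have h5 := (d5.congr_of_eventuallyEq (hpt.eventually h3)).unique d6
    simp only [zero_smul, h2, hμ0, Pi.sub_apply] at h5
    change _ = ⟪γ z - u, fderiv ℝ γ z _⟫ - _ + _
    rw [inner_sub_right] at h5
    linarith

/-- Infinitesimal versality for the differentials: the differential of any function is obtained by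
differentiating the equations for critical points along a vector field and in the parameter. -/
theorem IsVersalAt.exists_fderiv_eq (hV : IsVersalAt B {y} u) (hγ : IsLocalParam B y γ)
    {h : EuclideanSpace ℝ (Fin n) → ℝ} (hh : ContDiff ℝ ∞ h) :
    ∃ (X : EuclideanSpace ℝ (Fin n) → EuclideanSpace ℝ (Fin n)) (η : Ambient n),
      SmoothNear X 0 ∧
      ∀ᶠ z in 𝓝 0, ∀ k, fderiv ℝ h z k = fderiv ℝ (criticalMap γ) (z, u) (X z, η) k +
        criticalMap γ (z, u) (fderiv ℝ X z k) := by
  obtain ⟨X, η, c, hX, hd⟩ := hV.exists_decomposition hγ hh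
  refine ⟨X, η, hX, ?_⟩
  filter_upwards [hX, hd.eventually_nhds, hγ.smooth.eventually] with z h1 h2 h3 k
  have hC : HasFDerivAt (fun z => criticalMap γ (z, u))
      ((fderiv ℝ (criticalMap γ) (z, u)).comp (ContinuousLinearMap.inl ℝ _ _)) z :=
    HasFDerivAt.comp (g := criticalMap γ) z
      (smoothNear_criticalMap (p := (z, u)) h3).hasFDerivAt (hasFDerivAt_prodMk_left z u)
  have hXz := (h1.differentiableAt (by simp)).hasFDerivAt
  have hγz := ((h3.hasFDerivAt.sub_const u).inner ℝ (hasFDerivAt_const (𝕜 := ℝ) η z))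
  have h4 := ((((hC.clm_apply hXz).sub hγz).add_const c).congr_of_eventuallyEq h2).fderiv
  rw [h4, fderiv_criticalMap (p := (z, u)) h3, hessian_distSq_symm h3]
  simp [fderiv_criticalMap (p := (z, u)) h3, real_inner_comm]
  ring

end Versality

section Cubic

set_option maxSynthPendingDepth 5

variable {P V : Type*} [NormedAddCommGroup P] [NormedSpace ℝ P] [NormedAddCommGroup V]
  [InnerProductSpace ℝ V]

/-- For a family `F` of differentials of functions on `V`, parametrized by `P ⊇ V`, the system of
equations for a degenerate critical point at which the cubic form vanishes on the unit vector `v`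
of the kernel of the Hessian. -/
noncomputable def degenerateMap (F : P → V →L[ℝ] ℝ) (ι : V →L[ℝ] P) (p : P × V) :
    (V →L[ℝ] ℝ) × (V →L[ℝ] ℝ) × ℝ × ℝ :=
  (F p.1, fderiv ℝ F p.1 (ι p.2), fderiv ℝ (fderiv ℝ F) p.1 (ι p.2) (ι p.2) p.2, ⟪p.2, p.2⟫)

variable {F : P → V →L[ℝ] ℝ} {ι : V →L[ℝ] P}

theorem hasStrictFDerivAt_degenerateMap {p : P × V} (hs : SmoothNear F p.1) :
    ∃ D : (P × V) →L[ℝ] (V →L[ℝ] ℝ) × (V →L[ℝ] ℝ) × ℝ × ℝ,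
      HasStrictFDerivAt (degenerateMap F ι) D p ∧ ∀ r v',
      D (r, v') = (fderiv ℝ F p.1 r,
        fderiv ℝ (fderiv ℝ F) p.1 r (ι p.2) + fderiv ℝ F p.1 (ι v'),
        fderiv ℝ (fderiv ℝ (fderiv ℝ F)) p.1 r (ι p.2) (ι p.2) p.2 +
          fderiv ℝ (fderiv ℝ F) p.1 (ι v') (ι p.2) p.2 +
          fderiv ℝ (fderiv ℝ F) p.1 (ι p.2) (ι v') p.2 +
          fderiv ℝ (fderiv ℝ F) p.1 (ι p.2) (ι p.2) v',
        2 * ⟪p.2, v'⟫) := by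
  have h1 := HasStrictFDerivAt.comp (g := F) p hs.hasStrictFDerivAt
    (hasStrictFDerivAt_fst (𝕜 := ℝ))
  have h2 := HasStrictFDerivAt.comp (g := fderiv ℝ F) p hs.fderiv.hasStrictFDerivAt
    (hasStrictFDerivAt_fst (𝕜 := ℝ))
  have h3 := HasStrictFDerivAt.comp (g := fderiv ℝ (fderiv ℝ F)) p
    hs.fderiv.fderiv.hasStrictFDerivAt (hasStrictFDerivAt_fst (𝕜 := ℝ))
  have hv : HasStrictFDerivAt (fun p : P × V => p.2) (ContinuousLinearMap.snd ℝ _ _) p :=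
    hasStrictFDerivAt_snd
  have hv0 : HasStrictFDerivAt (fun p : P × V => ι p.2)
      (ι.comp (ContinuousLinearMap.snd ℝ _ _)) p := ι.hasStrictFDerivAt.comp p hv
  have h4 := h2.clm_apply hv0
  have h5 := ((h3.clm_apply hv0).clm_apply hv0).clm_apply hv
  have h6 := hv.inner ℝ hv
  refine ⟨_, h1.prodMk (h4.prodMk (h5.prodMk h6)), fun r v' => ?_⟩
  refine Prod.ext rfl (Prod.ext ?_ (Prod.ext ?_ ?_))
  · simp [add_comm]
  · simp
    ring
  · simp [real_inner_comm]
    ring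

theorem SmoothNear.second_fderiv_symm {X Y : Type*} [NormedAddCommGroup X] [NormedSpace ℝ X]
    [NormedAddCommGroup Y] [NormedSpace ℝ Y] {f : X → Y} {x : X} (h : SmoothNear f x) (a b : X) :
    fderiv ℝ (fderiv ℝ f) x a b = fderiv ℝ (fderiv ℝ f) x b a :=
  (h.contDiffAt.isSymmSndFDerivAt (by
    simp only [minSmoothness_of_isRCLikeNormedField]
    exact WithTop.coe_le_coe.2 (le_top : (2 : ℕ∞) ≤ ⊤))).eq a b

theorem SmoothNear.third_fderiv_symm {X Y : Type*} [NormedAddCommGroup X] [NormedSpace ℝ X]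
    [NormedAddCommGroup Y] [NormedSpace ℝ Y] {f : X → Y} {x : X} (h : SmoothNear f x) (a b c : X) :
    fderiv ℝ (fderiv ℝ (fderiv ℝ f)) x a b c = fderiv ℝ (fderiv ℝ (fderiv ℝ f)) x b c a := by
  rw [h.fderiv.second_fderiv_symm]
  have h1 := (h.fderiv.fderiv.hasFDerivAt.clm_apply (hasFDerivAt_const (𝕜 := ℝ) a x)).clm_apply
    (hasFDerivAt_const (𝕜 := ℝ) c x)
  have h2 := (h.fderiv.fderiv.hasFDerivAt.clm_apply (hasFDerivAt_const (𝕜 := ℝ) c x)).clm_apply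
    (hasFDerivAt_const (𝕜 := ℝ) a x)
  have h3 := h1.congr_of_eventuallyEq (h.eventually.mono fun x hx => hx.second_fderiv_symm c a)
  simpa using congrArg (fun L => L b) (h3.unique h2)

theorem hasDerivAt_along_affine_line {Y : Type*} [NormedAddCommGroup Y] [NormedSpace ℝ Y]
    {K : P → Y} {p v : P} {t : ℝ} (hK : DifferentiableAt ℝ K (p + t • v)) :
    HasDerivAt (fun t : ℝ => K (p + t • v)) (fderiv ℝ K (p + t • v) v) t := by
  have h1 : HasDerivAt (fun t : ℝ => p + t • v) v t := by
    simpa using ((hasDerivAt_id t).smul_const v).const_add p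
  exact HasFDerivAt.comp_hasDerivAt (l := K) t hK.hasFDerivAt h1

set_option maxHeartbeats 1600000 in
/-- Infinitesimal versality makes the equations for a degenerate minimum independent.  A target
`(a, b, s, τ)` is hit by testing versality on the cubic polynomial whose differential along the
line of `v` is `a + t b + t² (s / 2) ⟪v, ·⟫`. -/
theorem exists_surjective_fderiv_degenerateMap {p₀ : P} {v : V} (hs : SmoothNear F p₀)
    (hF0 : F p₀ = 0) (hv : ⟪v, v⟫ = 1) (hker : fderiv ℝ F p₀ (ι v) = 0)
    (hcub : fderiv ℝ (fderiv ℝ F) p₀ (ι v) (ι v) v = 0)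
    (hsymm : ∀ v₁ v₂, fderiv ℝ F p₀ (ι v₁) v₂ = fderiv ℝ F p₀ (ι v₂) v₁)
    (hver : ∀ h : V → ℝ, ContDiff ℝ ∞ h → ∃ (X : V → V) (η : P), SmoothNear X 0 ∧
      ∀ᶠ z in 𝓝 0, ∀ k, fderiv ℝ h z k = fderiv ℝ F (p₀ + ι z) (η + ι (X z)) k +
        F (p₀ + ι z) (fderiv ℝ X z k)) :
    ∃ D : (P × V) →L[ℝ] (V →L[ℝ] ℝ) × (V →L[ℝ] ℝ) × ℝ × ℝ,
      HasStrictFDerivAt (degenerateMap F ι) D (p₀, v) ∧ Function.Surjective D := by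
  obtain ⟨D, hD, hDa⟩ := hasStrictFDerivAt_degenerateMap (ι := ι) (p := (p₀, v)) hs
  refine ⟨D, hD, ?_⟩
  rintro ⟨a, b, s, τ⟩
  have hvn : ‖v‖ = 1 := by
    rw [norm_eq_sqrt_real_inner, hv, Real.sqrt_one]
  -- the quadratic correction by `b v / 2` makes the differential at `t v` equal to
  -- `a + t b + t² (s / 2) ⟪v, ·⟫`
  obtain ⟨X, η, hX, hver⟩ := hver
    (fun z => a z + innerSL ℝ v z * b z - b v / 2 * innerSL ℝ v z ^ 2 +
      s / 6 * innerSL ℝ v z ^ 3) (by fun_prop)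
  have hline : Tendsto (fun t : ℝ => p₀ + t • ι v) (𝓝 0) (𝓝 p₀) := by
    have : Continuous fun t : ℝ => p₀ + t • ι v := by fun_prop
    simpa using this.tendsto 0
  -- the identity of versality along the line of `v`
  have hA : ∀ᶠ t : ℝ in 𝓝 0, ∀ k, a k + t * b k + s / 2 * t ^ 2 * ⟪v, k⟫ =
      fderiv ℝ F (p₀ + t • ι v) (η + ι (X (t • v))) k +
        F (p₀ + t • ι v) (fderiv ℝ X (t • v) k) := by
    filter_upwards [eventually_smul_line v hver] with t ht k
    have h1 := ht k
    rw [map_smul] at h1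
    rw [← h1]
    have hi : HasFDerivAt (innerSL ℝ v) (innerSL ℝ v) (t • v) := (innerSL ℝ v).hasFDerivAt
    have h2 := ((a.hasFDerivAt (x := t • v)).add (hi.mul b.hasFDerivAt)).sub
      ((hi.pow 2).const_mul (b v / 2)) |>.add ((hi.pow 3).const_mul (s / 6))
    have h3 := HasFDerivAt.fderiv h2
    change fderiv ℝ (fun z => a z + innerSL ℝ v z * b z - b v / 2 * innerSL ℝ v z ^ 2 +
      s / 6 * innerSL ℝ v z ^ 3) (t • v) = _ at h3
    rw [h3]
    simp [inner_smul_right, hvn]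
    ring
  have hx : ∀ᶠ t : ℝ in 𝓝 0, HasDerivAt (fun t : ℝ => η + ι (X (t • v)))
      (ι (fderiv ℝ X (t • v) v)) t := by
    filter_upwards [eventually_smul_line v hX] with t ht
    have h1 := hasDerivAt_along_line v (ht.differentiableAt (by simp))
    exact (ι.hasFDerivAt.comp_hasDerivAt t h1).const_add η
  have hδ : ∀ k, ∀ᶠ t : ℝ in 𝓝 0, HasDerivAt (fun t : ℝ => fderiv ℝ X (t • v) k)
      (fderiv ℝ (fderiv ℝ X) (t • v) v k) t := by
    intro k
    filter_upwards [eventually_smul_line v hX.fderiv] with t ht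
    have h1 := hasDerivAt_along_line v (ht.differentiableAt (by simp))
    simpa using h1.clm_apply (hasDerivAt_const t k)
  have hFd : ∀ᶠ t : ℝ in 𝓝 0, SmoothNear F (p₀ + t • ι v) := hline.eventually hs.eventually
  -- the first derivative of the identity
  have hA1 : ∀ k, ∀ᶠ t : ℝ in 𝓝 0, b k + s * t * ⟪v, k⟫ =
      fderiv ℝ (fderiv ℝ F) (p₀ + t • ι v) (ι v) (η + ι (X (t • v))) k +
      fderiv ℝ F (p₀ + t • ι v) (ι (fderiv ℝ X (t • v) v)) k +
      fderiv ℝ F (p₀ + t • ι v) (ι v) (fderiv ℝ X (t • v) k) +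
      F (p₀ + t • ι v) (fderiv ℝ (fderiv ℝ X) (t • v) v k) := by
    intro k
    filter_upwards [hA.eventually_nhds, hx, hδ k, hFd] with t h1 h2 h3 h4
    have e1 := ((hasDerivAt_along_affine_line (K := fderiv ℝ F)
      h4.fderiv.differentiableAt).clm_apply h2).clm_apply (hasDerivAt_const t k)
    have e2 := (hasDerivAt_along_affine_line (K := F) h4.differentiableAt).clm_apply h3
    have e3 : HasDerivAt (fun t : ℝ => a k + t * b k + s / 2 * t ^ 2 * ⟪v, k⟫)
        (b k + s * t * ⟪v, k⟫) t := by
      have := (((hasDerivAt_id t).mul_const (b k)).const_add (a k)).add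
        ((((hasDerivAt_id t).pow 2).const_mul (s / 2)).mul_const ⟪v, k⟫)
      refine this.congr_deriv ?_
      simp only [id, Nat.cast_ofNat]
      ring
    have := e3.unique ((e1.add e2).congr_of_eventuallyEq (h1.mono fun t ht => ht k))
    rw [this]
    simp
    ring
  -- the second derivative, evaluated at `v`
  have hA2 : s = fderiv ℝ (fderiv ℝ (fderiv ℝ F)) p₀ (ι v) (ι v) (η + ι (X 0)) v +
      fderiv ℝ (fderiv ℝ F) p₀ (ι v) (ι (fderiv ℝ X 0 v)) v +
      fderiv ℝ (fderiv ℝ F) p₀ (ι v) (ι (fderiv ℝ X 0 v)) v +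
      fderiv ℝ (fderiv ℝ F) p₀ (ι v) (ι v) (fderiv ℝ X 0 v) := by
    have h4 := hFd.self_of_nhds
    have h2 := hx.self_of_nhds
    have h3 := (hδ v).self_of_nhds
    have h5 : DifferentiableAt ℝ (fderiv ℝ (fderiv ℝ X)) ((0 : ℝ) • v) := by
      rw [zero_smul]; exact hX.fderiv.fderiv.differentiableAt
    have h6 := ((hasDerivAt_along_line (Y := V →L[ℝ] V →L[ℝ] V) v h5).clm_apply
      (hasDerivAt_const 0 v)).clm_apply (hasDerivAt_const 0 v)
    have e0 := hasDerivAt_along_affine_line (K := fderiv ℝ F) h4.fderiv.differentiableAt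
    have e1 := (((hasDerivAt_along_affine_line (K := fderiv ℝ (fderiv ℝ F))
      h4.fderiv.fderiv.differentiableAt).clm_apply
      (hasDerivAt_const 0 (ι v))).clm_apply h2).clm_apply (hasDerivAt_const 0 v)
    have e2 := (e0.clm_apply (ι.hasFDerivAt.comp_hasDerivAt 0 h3)).clm_apply (hasDerivAt_const 0 v)
    have e3 := (e0.clm_apply (hasDerivAt_const 0 (ι v))).clm_apply h3
    have e4 := (hasDerivAt_along_affine_line (K := F) h4.differentiableAt).clm_apply h6
    have e5 : HasDerivAt (fun t : ℝ => b v + s * t * ⟪v, v⟫) s 0 := by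
      have := ((((hasDerivAt_id (0 : ℝ)).const_mul s).mul_const ⟪v, v⟫).const_add (b v))
      simpa [hvn] using this
    have := e5.unique ((((e1.add e2).add e3).add e4).congr_of_eventuallyEq (hA1 v))
    rw [this]
    simp [hF0, hker, hsymm _ v]
  have hA0 : a = fderiv ℝ F p₀ (η + ι (X 0)) := by
    ext k
    simpa [hF0] using hA.self_of_nhds k
  have hA1' : b = fderiv ℝ (fderiv ℝ F) p₀ (ι v) (η + ι (X 0)) +
      fderiv ℝ F p₀ (ι (fderiv ℝ X 0 v)) := by
    ext k
    simpa [hF0, hker] using (hA1 k).self_of_nhds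
  -- the `v`-component of the second entry is free, because `v` lies in the kernel and the cubic
  -- form vanishes on it; it is chosen to match `τ`
  refine ⟨(η + ι (X 0), fderiv ℝ X 0 v + (τ / 2 - ⟪v, fderiv ℝ X 0 v⟫) • v), ?_⟩
  rw [hDa]
  refine Prod.ext hA0.symm (Prod.ext ?_ (Prod.ext ?_ ?_))
  · rw [hA1', hs.second_fderiv_symm (ι v) (η + ι (X 0))]
    simp only [map_add, map_smul, hker, smul_zero, add_zero]
  · rw [hA2, hs.third_fderiv_symm (η + ι (X 0)), hs.second_fderiv_symm (ι (_ + _))]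
    simp only [map_add, map_smul, add_apply, smul_apply, smul_eq_mul, hcub]
    ring
  · simp only [inner_add_right, inner_smul_right, hv]
    ring

end Cubic

/-! ### The set of degenerate minima -/

section DegeneratePairs

variable {n : ℕ} {B : Set (Ambient n)} {y u : Ambient n}
  {γ : EuclideanSpace ℝ (Fin n) → Ambient n}

/-- The pairs `(y, u)` such that `y` is a degenerate closest point of `B` to `u` at which the
family of distance-squared functions is versal. -/
def versalDegeneratePairs (B : Set (Ambient n)) : Set (Ambient n × Ambient n) :=
  {p | (∀ b ∈ B, dist p.2 p.1 ≤ dist p.2 b) ∧ IsDegenerateAt B p.2 p.1 ∧ IsVersalAt B {p.1} p.2}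

theorem finrank_dual_euclideanSpace :
    Module.finrank ℝ (EuclideanSpace ℝ (Fin n) →L[ℝ] ℝ) = n := by
  rw [← (LinearMap.toContinuousLinearMap (𝕜 := ℝ) (E := EuclideanSpace ℝ (Fin n))
    (F' := ℝ)).finrank_eq, Module.finrank_linearMap_self]
  simp

/-- A degenerate minimum of a distance-squared function, with a unit vector in the kernel of the
Hessian, solves the degeneracy equations: the cubic form vanishes on that vector. -/
theorem IsLocalParam.exists_degenerateMap_eq {z : EuclideanSpace ℝ (Fin n)}
    (hγ : IsLocalParam B (γ z) fun z' => γ (z + z')) (hs : SmoothNear γ z)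
    (h : ∀ b ∈ B, dist u (γ z) ≤ dist u b) (hdeg : IsDegenerateAt B u (γ z)) :
    ∃ v : EuclideanSpace ℝ (Fin n), ‖v‖ = 1 ∧
      degenerateMap (criticalMap γ) (ContinuousLinearMap.inl ℝ _ _) ((z, u), v) = (0, 0, 0, 1) := by
  have horth := hγ.inner_eq_zero_of_closest h
  obtain ⟨v₀, hv₀, hker₀⟩ := (hγ.isDegenerateAt_iff (hγ.fderiv_distSq_eq_zero horth)).1 hdeg
  rw [hessian_distSq_shift] at hker₀
  beta_reduce at hker₀
  rw [add_zero] at hker₀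
  obtain ⟨v, hv, hker⟩ : ∃ v : EuclideanSpace ℝ (Fin n), ‖v‖ = 1 ∧
      fderiv ℝ (fderiv ℝ (distSq γ u)) z v = 0 :=
    ⟨‖v₀‖⁻¹ • v₀, norm_smul_inv_norm (𝕜 := ℝ) hv₀, by rw [map_smul, hker₀, smul_zero]⟩
  have h0 : criticalMap γ (z, u) = 0 := by
    rw [criticalMap_eq_zero_iff]
    intro v
    have := horth v
    rw [fderiv_shift] at this
    beta_reduce at this
    rwa [add_zero] at this
  have h1 : fderiv ℝ (criticalMap γ) (z, u) (v, 0) = 0 := by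
    ext k
    rw [fderiv_criticalMap (p := (z, u)) hs]
    simp [hker]
  refine ⟨v, hv, ?_⟩
  have hline : Tendsto (fun t : ℝ => (z, u) + t • (v, (0 : Ambient n))) (𝓝 0) (𝓝 (z, u)) := by
    have : Continuous fun t : ℝ => (z, u) + t • (v, (0 : Ambient n)) := by fun_prop
    simpa using this.tendsto 0
  have hC : SmoothNear (criticalMap γ) (z, u) := smoothNear_criticalMap (p := (z, u)) hs
  have h2 : fderiv ℝ (fderiv ℝ (criticalMap γ)) (z, u) (v, 0) (v, 0) v = 0 := by
    -- half the distance-squared function along the line of `v`, with its derivatives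
    refine third_deriv_eq_zero_of_isLocalMin
      (φ := fun t => ‖γ ((z, u) + t • (v, (0 : Ambient n))).1 -
        ((z, u) + t • (v, (0 : Ambient n))).2‖ ^ 2 / 2)
      (φ₁ := fun t => criticalMap γ ((z, u) + t • (v, (0 : Ambient n))) v)
      (φ₂ := fun t => fderiv ℝ (criticalMap γ) ((z, u) + t • (v, (0 : Ambient n))) (v, 0) v)
      ?_ ?_ ?_ ?_ ?_
    · have := isLocalMin_line (v := v) (hγ.isLocalMin_distSq h)
      filter_upwards [this] with t ht
      simp only [distSq, zero_smul, add_zero] at ht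
      simp
      gcongr
    · filter_upwards [(continuous_fst.tendsto _ |>.comp hline).eventually hs] with t ht
      have h3 : HasDerivAt (fun t : ℝ => ((z, u) + t • (v, (0 : Ambient n))).1) v t := by
        simpa using ((hasDerivAt_id t).smul_const v).const_add z
      have h4 : HasDerivAt (fun t : ℝ => ((z, u) + t • (v, (0 : Ambient n))).2) 0 t := by
        simpa using hasDerivAt_const t u
      have h5 := HasFDerivAt.comp_hasDerivAt (l := γ) t
        (ht.differentiableAt (by simp)).hasFDerivAt h3
      refine ((h5.sub h4).norm_sq.div_const 2).congr_deriv ?_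
      simp [criticalMap, inner_sub_left]
    · filter_upwards [hline.eventually hC] with t ht
      simpa using (hasDerivAt_along_affine_line (K := criticalMap γ)
        (ht.differentiableAt (by simp))).clm_apply (hasDerivAt_const t v)
    · have h3 : DifferentiableAt ℝ (fderiv ℝ (criticalMap γ))
          ((z, u) + (0 : ℝ) • (v, (0 : Ambient n))) := by
        rw [zero_smul, add_zero]; exact hC.fderiv.differentiableAt
      have := ((hasDerivAt_along_affine_line (K := fderiv ℝ (criticalMap γ)) h3).clm_apply
        (hasDerivAt_const 0 (v, (0 : Ambient n)))).clm_apply (hasDerivAt_const 0 v)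
      simpa using this
    · simp [h1]
  simp only [degenerateMap, ContinuousLinearMap.inl_apply, h0, h1, h2]
  rw [real_inner_self_eq_norm_sq, hv]
  norm_num

/-- At a degenerate minimum where the family is versal, the solution set of the degeneracy
equations has codimension `2 n + 2`. -/
theorem IsVersalAt.exists_nhds_degenerateMap_null (hV : IsVersalAt B {y} u)
    (hγ : IsLocalParam B y γ) {v : EuclideanSpace ℝ (Fin n)} :
    ∃ N ∈ 𝓝 (((0 : EuclideanSpace ℝ (Fin n)), u), v), μH[n] {q ∈ N |
      degenerateMap (criticalMap γ) (ContinuousLinearMap.inl ℝ _ _) q = (0, 0, 0, 1)} = 0 := by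
  have hC : SmoothNear (criticalMap γ) ((0 : EuclideanSpace ℝ (Fin n)), u) :=
    smoothNear_criticalMap (p := (0, u)) hγ.smooth
  by_cases h : degenerateMap (criticalMap γ) (ContinuousLinearMap.inl ℝ _ _)
    (((0 : EuclideanSpace ℝ (Fin n)), u), v) = (0, 0, 0, 1)
  -- the map is a submersion from dimension `3 n + 1` at a solution
  · have h' := h
    simp only [degenerateMap, Prod.mk.injEq, ContinuousLinearMap.inl_apply] at h'
    obtain ⟨D, hD, hDs⟩ := exists_surjective_fderiv_degenerateMap (F := criticalMap γ)
      (ι := ContinuousLinearMap.inl ℝ _ _) hC h'.1 h'.2.2.2 h'.2.1 h'.2.2.1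
      (fun v₁ v₂ => by
        simp only [ContinuousLinearMap.inl_apply]
        rw [fderiv_criticalMap (p := (0, u)) hγ.smooth, fderiv_criticalMap (p := (0, u)) hγ.smooth,
          hessian_distSq_symm hγ.smooth]
        simp)
      (fun g hg => by
        obtain ⟨X, η, hX, hd⟩ := hV.exists_fderiv_eq hγ hg
        refine ⟨X, (0, η), hX, hd.mono fun z hz k => ?_⟩
        simpa using hz k)
    obtain ⟨N, hN, hnull⟩ := exists_nhds_hausdorffMeasure_level_null (d := n) hD hDs (by
      simp only [Module.finrank_prod, finrank_dual_euclideanSpace, finrank_euclideanSpace_fin,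
        Module.finrank_self]
      omega)
    exact ⟨N, hN, hnull _ (sep_subset _ _) fun x hx => hx.2.trans h.symm⟩
  · obtain ⟨D, hD, -⟩ := hasStrictFDerivAt_degenerateMap
      (ι := ContinuousLinearMap.inl ℝ (EuclideanSpace ℝ (Fin n)) (Ambient n))
      (p := (((0 : EuclideanSpace ℝ (Fin n)), u), v)) hC
    refine ⟨_, hD.continuousAt.eventually_ne h, ?_⟩
    convert measure_empty (μ := μH[(n : ℝ)])
    ext q
    simp

theorem hausdorffMeasure_versalDegeneratePairs (B : Set (Ambient n)) :
    μH[n] (versalDegeneratePairs B) = 0 := by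
  refine measure_null_of_locally_null _ ?_
  rintro ⟨y, u⟩ ⟨hclosest, ⟨γ, hγ, -⟩, hV⟩
  -- a neighbourhood of the base point which works for all unit vectors, by compactness
  obtain ⟨N, hN, hnull⟩ : ∃ N ∈ 𝓝 ((0 : EuclideanSpace ℝ (Fin n)), u), μH[n] {q |
      (q.1 ∈ N ∧ q.2 ∈ Metric.sphere (0 : EuclideanSpace ℝ (Fin n)) 1) ∧
      degenerateMap (criticalMap γ) (ContinuousLinearMap.inl ℝ _ _) q = (0, 0, 0, 1)} = 0 := by
    refine IsCompact.induction_on (isCompact_sphere (0 : EuclideanSpace ℝ (Fin n)) 1)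
      (p := fun S => ∃ N ∈ 𝓝 ((0 : EuclideanSpace ℝ (Fin n)), u), μH[n] {q |
      (q.1 ∈ N ∧ q.2 ∈ S) ∧
      degenerateMap (criticalMap γ) (ContinuousLinearMap.inl ℝ _ _) q = (0, 0, 0, 1)} = 0)
      ⟨univ, univ_mem, by simp⟩ ?_ ?_ ?_
    · rintro s t hst ⟨N, hN, h⟩
      exact ⟨N, hN, measure_mono_null (fun q hq => by exact ⟨⟨hq.1.1, hst hq.1.2⟩, hq.2⟩) h⟩
    · rintro s t ⟨N, hN, h⟩ ⟨N', hN', h'⟩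
      refine ⟨N ∩ N', inter_mem hN hN', measure_mono_null ?_ (measure_union_null h h')⟩
      rintro q ⟨⟨hq, hs | ht⟩, hd⟩
      exacts [Or.inl ⟨⟨hq.1, hs⟩, hd⟩, Or.inr ⟨⟨hq.2, ht⟩, hd⟩]
    · intro v _
      obtain ⟨N, hN, h⟩ := hV.exists_nhds_degenerateMap_null hγ (v := v)
      rw [nhds_prod_eq, mem_prod_iff] at hN
      obtain ⟨N₁, hN₁, N₂, hN₂, hsub⟩ := hN
      exact ⟨N₂, mem_nhdsWithin_of_mem_nhds hN₂, N₁, hN₁,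
        measure_mono_null (fun q hq => by exact ⟨hsub hq.1, hq.2⟩) h⟩
  obtain ⟨P, hP, hP0, hl, hr⟩ := hγ.exists_leftInverse
  rw [eventually_nhdsWithin_iff] at hr
  have hPt : Tendsto (fun p : Ambient n × Ambient n => (P p.1, p.2)) (𝓝 (y, u))
      (𝓝 ((0 : EuclideanSpace ℝ (Fin n)), u)) := by
    have : ContinuousAt (fun p : Ambient n × Ambient n => (P p.1, p.2)) (y, u) :=
      (ContinuousAt.comp (g := P) hP.continuousAt continuousAt_fst).prodMk continuousAt_snd
    rwa [ContinuousAt, hP0] at this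
  have hsN : {p : EuclideanSpace ℝ (Fin n) × Ambient n | SmoothNear γ p.1 ∧
      IsLocalParam B (γ p.1) fun z => γ (p.1 + z)} ∈ 𝓝 ((0 : EuclideanSpace ℝ (Fin n)), u) :=
    (continuousAt_fst (p := ((0 : EuclideanSpace ℝ (Fin n)), u))).eventually
      (hγ.smooth.eventually.and hγ.eventually_recenter)
  -- the degenerate pairs are the image of the solutions under `((z, u), v) ↦ (γ z, u)`
  have himg := hausdorffMeasure_image_null
    (f := fun q : (EuclideanSpace ℝ (Fin n) × Ambient n) × EuclideanSpace ℝ (Fin n) =>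
      (γ q.1.1, q.1.2)) (Nat.cast_nonneg n)
    (measure_mono_null (fun q (hq : q.1 ∈ {p : EuclideanSpace ℝ (Fin n) × Ambient n |
      SmoothNear γ p.1 ∧ IsLocalParam B (γ p.1) fun z => γ (p.1 + z)} ∧ _) => hq.2) hnull)
    (fun q hq => by
      have h1 : ContDiffAt ℝ 1 γ q.1.1 := hq.1.1.contDiffAt.of_le (by simp)
      exact (ContDiffAt.comp (g := γ) q h1 (contDiffAt_fst.fst)).prodMk contDiffAt_fst.snd)
  refine ⟨_, inter_mem_nhdsWithin _ (inter_mem (hPt (inter_mem hN hsN))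
    (continuousAt_fst.eventually hr : ∀ᶠ p in 𝓝 (y, u), p.1 ∈ B → γ (P p.1) = p.1)), ?_⟩
  refine measure_mono_null ?_ himg
  rintro ⟨y', u'⟩ ⟨⟨hclosest', hdeg', -⟩, ⟨hN', hsm, hγ'⟩, hr'⟩
  have hy' : γ (P y') = y' := hr' (by obtain ⟨γ', h', -⟩ := hdeg'; exact h'.mem)
  simp only at hclosest' hdeg' hsm hγ'
  obtain ⟨v, hv, hd⟩ := hγ'.exists_degenerateMap_eq hsm (u := u') (by rwa [hy']) (by rwa [hy'])
  exact ⟨((P y', u'), v), ⟨⟨hsm, hγ'⟩, ⟨hN', by simpa using hv⟩, hd⟩, by simp [hy']⟩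

end DegeneratePairs

/-! ### Smooth boundary points and corners of regions -/

section Boundary

variable {n : ℕ} {Ω Ω' Ω'' : Set (Ambient n)} {y u : Ambient n}

/-- Near `y`, the set `Ω` is where `G` is nonnegative, and `y` is a regular zero of `G`. -/
structure IsDefiningFunction (Ω : Set (Ambient n)) (y : Ambient n) (G : Ambient n → ℝ) : Prop where
  smooth : SmoothNear G y
  map_base : G y = 0
  fderiv_ne_zero : fderiv ℝ G y ≠ 0
  eventually_mem_iff : ∀ᶠ w in 𝓝 y, (w ∈ Ω ↔ 0 ≤ G w)

/-- The boundary of `Ω` is a smooth hypersurface near `y`, with `Ω` on one side. -/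
def IsSmoothBoundaryPoint (Ω : Set (Ambient n)) (y : Ambient n) : Prop :=
  ∃ G, IsDefiningFunction Ω y G

variable {G G' G'' : Ambient n → ℝ}

theorem IsDefiningFunction.mem_frontier_iff (h : IsDefiningFunction Ω y G) :
    ∀ᶠ w in 𝓝 y, (w ∈ frontier Ω ↔ G w = 0) := by
  filter_upwards [h.eventually_mem_iff.eventually_nhds, h.smooth.eventually,
    h.smooth.fderiv.continuousAt.eventually_ne h.fderiv_ne_zero] with w h1 h2 h3
  rcases lt_trichotomy (G w) 0 with hw | hw | hw
  · have : w ∉ closure Ω := by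
      rw [mem_closure_iff_frequently, not_frequently]
      filter_upwards [h1, h2.continuousAt.eventually_lt_const hw] with x hx hx' hxΩ
      exact absurd (hx.1 hxΩ) (not_le.2 hx')
    exact ⟨fun hf => absurd hf.1 this, fun h0 => absurd h0 hw.ne⟩
  · refine ⟨fun _ => hw, fun _ => ⟨subset_closure (h1.self_of_nhds.2 hw.ge), fun hint => h3 ?_⟩⟩
    refine IsLocalMin.fderiv_eq_zero ?_
    filter_upwards [h1, mem_interior_iff_mem_nhds.1 hint] with x hx hxΩ
    rw [hw]
    exact hx.1 hxΩ
  · have : w ∈ interior Ω := by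
      rw [mem_interior_iff_mem_nhds]
      filter_upwards [h1, h2.continuousAt.eventually_const_lt hw] with x hx hx'
      exact hx.2 hx'.le
    exact ⟨fun hf => absurd this hf.2, fun h0 => absurd h0 hw.ne'⟩

theorem IsDefiningFunction.mem_interior_of_pos (h : IsDefiningFunction Ω y G) :
    ∀ᶠ w in 𝓝 y, 0 < G w → w ∈ interior Ω := by
  filter_upwards [h.eventually_mem_iff.eventually_nhds, h.smooth.eventually] with w h1 h2 hw
  rw [mem_interior_iff_mem_nhds]
  filter_upwards [h1, h2.continuousAt.eventually_const_lt hw] with x hx hx'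
  exact hx.2 hx'.le

theorem IsSmoothBoundaryPoint.exists_isLocalParam (h : IsSmoothBoundaryPoint Ω y) :
    ∃ γ, IsLocalParam (frontier Ω) y γ := by
  obtain ⟨G, hG⟩ := h
  exact exists_isLocalParam_of_level hG.smooth hG.map_base hG.fderiv_ne_zero hG.mem_frontier_iff

theorem tendsto_add_smul (y v : Ambient n) :
    Tendsto (fun t : ℝ => y + t • v) (𝓝[>] 0) (𝓝 y) := by
  have : Continuous fun t : ℝ => y + t • v := by fun_prop
  simpa using (this.tendsto 0).mono_left nhdsWithin_le_nhds

theorem eventually_pos_of_fderiv_pos (hG : DifferentiableAt ℝ G y) (h0 : G y = 0) {v : Ambient n}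
    (hv : 0 < fderiv ℝ G y v) : ∀ᶠ t : ℝ in 𝓝[>] 0, 0 < G (y + t • v) := by
  have h1 : HasDerivAt (fun t : ℝ => G (y + t • v)) (fderiv ℝ G y v) 0 := by
    have := hasDerivAt_along_affine_line (K := G) (p := y) (v := v) (t := 0) (by simpa using hG)
    simpa using this
  have h2 := (hasDerivAt_iff_tendsto_slope.1 h1).eventually_const_lt hv
  have h3 := (nhdsGT_le_nhdsNE (0 : ℝ)) h2
  filter_upwards [h3, self_mem_nhdsWithin] with t ht ht0
  have ht0' : (0 : ℝ) < t := ht0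
  simp only [slope_def_field, zero_smul, add_zero, h0, sub_zero, mem_ofPred_eq] at ht
  simpa using (div_pos_iff_of_pos_right ht0').1 ht

/-- Interiors of two regions with a common smooth boundary point and no common interior point
lie on opposite sides. -/
theorem IsDefiningFunction.not_both_pos (h : IsDefiningFunction Ω y G)
    (h' : IsDefiningFunction Ω' y G') (hdisj : Ω ∩ Ω' ⊆ frontier Ω) (v : Ambient n) :
    ¬ (0 < fderiv ℝ G y v ∧ 0 < fderiv ℝ G' y v) := by
  rintro ⟨h1, h2⟩
  obtain ⟨t, ht1, ht2, ht3, ht4⟩ :=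
    ((eventually_pos_of_fderiv_pos h.smooth.differentiableAt h.map_base h1).and
    ((eventually_pos_of_fderiv_pos h'.smooth.differentiableAt h'.map_base h2).and
    (((tendsto_add_smul y v).eventually h.mem_interior_of_pos).and
    ((tendsto_add_smul y v).eventually h'.mem_interior_of_pos)))).exists
  exact (hdisj ⟨interior_subset (ht3 ht1), interior_subset (ht4 ht2)⟩).2 (ht3 ht1)

theorem eq_neg_of_not_both_pos {a b : Ambient n} (ha : ‖a‖ = 1) (hb : ‖b‖ = 1)
    (h : ∀ v, ¬ (0 < ⟪a, v⟫ ∧ 0 < ⟪b, v⟫)) : b = -a := by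
  by_contra hne
  have h1 : -1 < ⟪a, b⟫ := by
    refine lt_of_le_of_ne ?_ fun h0 => hne ?_
    · have := neg_le_of_abs_le (abs_real_inner_le_norm a b)
      simpa [ha, hb] using this
    · have := (inner_eq_neg_one_iff_of_norm_eq_one (𝕜 := ℝ) ha hb).1 h0.symm
      rw [this, neg_neg]
  refine h (a + b) ⟨?_, ?_⟩
  · rw [inner_add_right, real_inner_self_eq_norm_sq, ha]; linarith
  · rw [inner_add_right, real_inner_self_eq_norm_sq, hb, real_inner_comm]; linarith

theorem exists_unit_gradient {L : Ambient n →L[ℝ] ℝ} (hL : L ≠ 0) :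
    ∃ a : Ambient n, ∃ c : ℝ, ‖a‖ = 1 ∧ 0 < c ∧ ∀ v, L v = c * ⟪a, v⟫ := by
  set b := (InnerProductSpace.toDual ℝ (Ambient n)).symm L with hb
  have hb0 : b ≠ 0 := by simpa [hb] using hL
  refine ⟨‖b‖⁻¹ • b, ‖b‖, norm_smul_inv_norm (𝕜 := ℝ) hb0, norm_pos_iff.2 hb0, fun v => ?_⟩
  rw [inner_smul_left, hb, InnerProductSpace.toDual_symm_apply, ← hb]
  have := norm_ne_zero_iff.2 hb0
  simp
  field_simp

/-- Three regions with pairwise disjoint interiors have no common smooth boundary point. -/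
theorem not_three_smooth (h : IsSmoothBoundaryPoint Ω y) (h' : IsSmoothBoundaryPoint Ω' y)
    (h'' : IsSmoothBoundaryPoint Ω'' y) (h1 : Ω ∩ Ω' ⊆ frontier Ω) (h2 : Ω ∩ Ω'' ⊆ frontier Ω)
    (h3 : Ω' ∩ Ω'' ⊆ frontier Ω') : False := by
  obtain ⟨G, hG⟩ := h
  obtain ⟨G', hG'⟩ := h'
  obtain ⟨G'', hG''⟩ := h''
  obtain ⟨a, α, ha, hα, haG⟩ := exists_unit_gradient hG.fderiv_ne_zero
  obtain ⟨b, β, hb, hβ, hbG⟩ := exists_unit_gradient hG'.fderiv_ne_zero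
  obtain ⟨c, κ, hc, hκ, hcG⟩ := exists_unit_gradient hG''.fderiv_ne_zero
  have e1 := eq_neg_of_not_both_pos ha hb fun v ⟨p, q⟩ => hG.not_both_pos hG' h1 v
    ⟨by rw [haG]; positivity, by rw [hbG]; positivity⟩
  have e2 := eq_neg_of_not_both_pos ha hc fun v ⟨p, q⟩ => hG.not_both_pos hG'' h2 v
    ⟨by rw [haG]; positivity, by rw [hcG]; positivity⟩
  have e3 := eq_neg_of_not_both_pos hb hc fun v ⟨p, q⟩ => hG'.not_both_pos hG'' h3 v
    ⟨by rw [hbG]; positivity, by rw [hcG]; positivity⟩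
  rw [e2, e1, neg_neg] at e3
  have h0 : ⟪-a, a⟫ = ⟪a, a⟫ := by rw [e3]
  rw [inner_neg_left, real_inner_self_eq_norm_sq, ha] at h0
  norm_num at h0

end Boundary

section Corners

variable {n : ℕ} {Ω : Set (Ambient n)} {x y u : Ambient n}
  {φ : OpenPartialHomeomorph (Ambient n) (Ambient n)}

theorem IsLocalChartAt.smoothNear (h : IsLocalChartAt φ x) (hy : y ∈ φ.source) :
    SmoothNear φ y := by
  filter_upwards [φ.open_source.mem_nhds hy] with w hw
  exact (h.smooth w hw).contDiffAt (φ.open_source.mem_nhds hw)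

theorem IsLocalChartAt.fderiv_surjective (h : IsLocalChartAt φ x) (hy : y ∈ φ.source) :
    Function.Surjective (fderiv ℝ φ y) := by
  have h1 := (h.smoothNear hy).hasFDerivAt
  have ht : φ y ∈ φ.target := φ.map_source hy
  have h2 : ContDiffAt ℝ ∞ φ.symm (φ y) :=
    (h.smooth_symm _ ht).contDiffAt (φ.open_target.mem_nhds ht)
  have h3 : HasFDerivAt φ (fderiv ℝ φ y) (φ.symm (φ y)) := by rwa [φ.left_inv hy]
  have h4 := h3.comp (φ y) (h2.differentiableAt (by simp)).hasFDerivAt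
  have h5 : HasFDerivAt (φ ∘ φ.symm) (ContinuousLinearMap.id ℝ (Ambient n)) (φ y) :=
    (hasFDerivAt_id _).congr_of_eventuallyEq
      (eventually_of_mem (φ.open_target.mem_nhds ht) fun w hw => φ.right_inv hw)
  intro v
  exact ⟨_, congrArg (fun L => L v) (h4.unique h5)⟩

theorem IsLocalChartAt.smoothNear_coord (h : IsLocalChartAt φ x) (hy : y ∈ φ.source)
    (j : Fin (n + 1)) : SmoothNear (fun w => φ w j) y :=
  SmoothNear.comp (g := fun z : Ambient n => z j)
    (smoothNear_of_contDiff (by fun_prop) _) (h.smoothNear hy)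

theorem IsLocalChartAt.fderiv_coord (h : IsLocalChartAt φ x) (hy : y ∈ φ.source)
    (j : Fin (n + 1)) (v : Ambient n) : fderiv ℝ (fun w => φ w j) y v = fderiv ℝ φ y v j := by
  have h1 := (h.smoothNear hy).hasFDerivAt
  have h2 := (EuclideanSpace.proj (𝕜 := ℝ) j).hasFDerivAt.comp y h1
  have h3 : HasFDerivAt (fun w => φ w j) _ y := h2
  rw [h3.fderiv]
  rfl

/-- A boundary point at which exactly one of the inequalities defining the corner is sharp is a
smooth boundary point. -/
theorem IsLocalChartAt.isSmoothBoundaryPoint (h : IsLocalChartAt φ x) {k : ℕ}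
    (hk : ∀ y ∈ φ.source, (y ∈ Ω ↔ ∀ j : Fin (n + 1), j.1 < k → 0 ≤ φ y j)) (hy : y ∈ φ.source)
    {j : Fin (n + 1)} (hj : j.1 < k) (hj0 : φ y j = 0)
    (hne : ∀ i : Fin (n + 1), i.1 < k → i ≠ j → 0 < φ y i) : IsSmoothBoundaryPoint Ω y := by
  refine ⟨fun w => φ w j, h.smoothNear_coord hy j, hj0, fun h0 => ?_, ?_⟩
  · obtain ⟨v, hv⟩ := h.fderiv_surjective hy (EuclideanSpace.single j 1)
    have := h.fderiv_coord hy j v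
    rw [h0, hv] at this
    simp at this
  · have h1 : ∀ᶠ w in 𝓝 y, ∀ i : Fin (n + 1), i.1 < k → i ≠ j → 0 < φ w i := by
      rw [eventually_all]
      intro i
      by_cases hi : i.1 < k ∧ i ≠ j
      · exact ((h.smoothNear_coord hy i).continuousAt.eventually_const_lt
          (hne i hi.1 hi.2)).mono fun w hw _ _ => hw
      · exact Eventually.of_forall fun w h1 h2 => absurd ⟨h1, h2⟩ hi
    filter_upwards [φ.open_source.mem_nhds hy, h1] with w hw h2
    rw [hk w hw]
    refine ⟨fun h3 => h3 j hj, fun h3 i hi => ?_⟩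
    by_cases hij : i = j
    · rwa [hij]
    · exact (h2 i hi hij).le

theorem IsLocalChartAt.mem_interior (h : IsLocalChartAt φ x) {k : ℕ}
    (hk : ∀ y ∈ φ.source, (y ∈ Ω ↔ ∀ j : Fin (n + 1), j.1 < k → 0 ≤ φ y j)) (hy : y ∈ φ.source)
    (hpos : ∀ j : Fin (n + 1), j.1 < k → 0 < φ y j) : y ∈ interior Ω := by
  rw [mem_interior_iff_mem_nhds]
  have h1 : ∀ᶠ w in 𝓝 y, ∀ i : Fin (n + 1), i.1 < k → 0 < φ w i := by
    rw [eventually_all]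
    intro i
    by_cases hi : i.1 < k
    · exact ((h.smoothNear_coord hy i).continuousAt.eventually_const_lt (hpos i hi)).mono
        fun w hw _ => hw
    · exact Eventually.of_forall fun w h1 => absurd h1 hi
  filter_upwards [φ.open_source.mem_nhds hy, h1] with w hw h2
  exact (hk w hw).2 fun j hj => (h2 j hj).le

theorem hausdorffMeasure_two_coordinates {i j : Fin (n + 1)} (hij : i ≠ j) :
    μH[n] {z : Ambient n | z i = 0 ∧ z j = 0} = 0 := by
  refine measure_null_of_locally_null _ fun z hz => ?_
  let L : Ambient n →L[ℝ] ℝ × ℝ :=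
    (EuclideanSpace.proj (𝕜 := ℝ) i).prod (EuclideanSpace.proj (𝕜 := ℝ) j)
  have hL : Function.Surjective L := by
    rintro ⟨a, b⟩
    refine ⟨EuclideanSpace.single i a + EuclideanSpace.single j b, ?_⟩
    simp [L, hij, hij.symm]
  obtain ⟨N, hN, h⟩ := exists_nhds_hausdorffMeasure_level_null (d := n)
    (L.hasStrictFDerivAt (x := z)) hL (by simp; omega)
  refine ⟨_, inter_mem_nhdsWithin _ hN, h _ inter_subset_right fun w hw => ?_⟩
  simp [L, hz.1, hz.2, hw.1.1, hw.1.2]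

/-- Almost every boundary point is smooth: at the others two coordinates of a chart vanish. -/
theorem IsRegion.hausdorffMeasure_not_smooth (hΩ : IsRegion Ω) :
    μH[n] {y ∈ frontier Ω | ¬ IsSmoothBoundaryPoint Ω y} = 0 := by
  refine measure_null_of_locally_null _ fun x hx => ?_
  have hcl : frontier Ω ⊆ Ω := hΩ.isCompact.isClosed.frontier_subset
  obtain ⟨k, -, φ, hφ, hk⟩ := hΩ.corners x (hcl hx.1)
  have hnull : μH[n] (⋃ i : Fin (n + 1), ⋃ j : Fin (n + 1), ⋃ _ : i ≠ j,
      φ.symm '' (φ.target ∩ {z : Ambient n | z i = 0 ∧ z j = 0})) = 0 := by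
    simp only [measure_iUnion_null_iff]
    intro i j hij
    refine hausdorffMeasure_image_null (Nat.cast_nonneg n)
      (measure_mono_null inter_subset_right (hausdorffMeasure_two_coordinates hij)) fun z hz => ?_
    exact ((hφ.smooth_symm z hz.1).contDiffAt (φ.open_target.mem_nhds hz.1)).of_le (by simp)
  refine ⟨_, inter_mem_nhdsWithin _ (φ.open_source.mem_nhds hφ.mem_source),
    measure_mono_null ?_ hnull⟩
  rintro y ⟨⟨hy, hns⟩, hys⟩
  have h0 := (hk y hys).1 (hcl hy)
  obtain ⟨j, hj, hj0⟩ : ∃ j : Fin (n + 1), j.1 < k ∧ φ y j = 0 := by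
    by_contra! hcon
    exact hy.2 (hφ.mem_interior hk hys fun j hj => lt_of_le_of_ne (h0 j hj) (hcon j hj).symm)
  obtain ⟨i, hi, hij, hi0⟩ : ∃ i : Fin (n + 1), i.1 < k ∧ i ≠ j ∧ φ y i = 0 := by
    by_contra! hcon
    exact hns (hφ.isSmoothBoundaryPoint hk hys hj hj0 fun i hi hij =>
      lt_of_le_of_ne (h0 i hi) (hcon i hi hij).symm)
  simp only [mem_iUnion]
  exact ⟨i, j, hij, φ y, ⟨φ.map_source hys, hi0, hj0⟩, φ.left_inv hys⟩

theorem ball_subset_interior_of_closest (hu : u ∈ interior Ω)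
    (hy : ∀ b ∈ frontier Ω, dist u y ≤ dist u b) :
    Metric.ball u (dist u y) ⊆ interior Ω := by
  rcases eq_or_ne u y with rfl | hne
  · simp
  refine IsPreconnected.subset_left_of_subset_union isOpen_interior isClosed_closure.isOpen_compl
    (disjoint_compl_right_iff_subset.2 (interior_subset.trans subset_closure)) (fun w hw => ?_)
    ⟨u, Metric.mem_ball_self (dist_pos.2 hne), hu⟩ (convex_ball u (dist u y)).isPreconnected
  by_contra hcon
  simp only [mem_union, mem_compl_iff, not_or, not_not] at hcon
  have := hy w ⟨hcon.2, hcon.1⟩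
  rw [Metric.mem_ball, dist_comm] at hw
  linarith

/-- Directions at the closest point `y` which point into the ball about `u` lead into the
region. -/
theorem eventually_mem_interior_of_inner_pos (hu : u ∈ interior Ω)
    (hy : ∀ b ∈ frontier Ω, dist u y ≤ dist u b) {v : Ambient n} (hv : 0 < ⟪v, u - y⟫) :
    ∀ᶠ t : ℝ in 𝓝[>] 0, y + t • v ∈ interior Ω := by
  have hd : HasFDerivAt (fun w => dist u y ^ 2 - ‖w - u‖ ^ 2) _ y :=
    ((hasFDerivAt_id (𝕜 := ℝ) y).sub_const u).norm_sq.const_sub (dist u y ^ 2)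
  have h2 := eventually_pos_of_fderiv_pos (G := fun w => dist u y ^ 2 - ‖w - u‖ ^ 2) (y := y)
    (v := v) hd.differentiableAt (by simp [dist_eq_norm, norm_sub_rev]) (by
      rw [hd.fderiv]
      simp
      rw [← neg_sub, inner_neg_right] at hv
      rw [← inner_sub_left, real_inner_comm]
      linarith)
  filter_upwards [h2] with t ht
  refine ball_subset_interior_of_closest hu hy ?_
  rw [Metric.mem_ball, dist_eq_norm]
  exact lt_of_pow_lt_pow_left₀ 2 dist_nonneg (by linarith)

/-- A ball contained in the region does not touch a corner of it. -/
theorem IsRegion.isSmoothBoundaryPoint_of_closest (hΩ : IsRegion Ω) (hu : u ∈ interior Ω)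
    (hyB : y ∈ frontier Ω) (hy : ∀ b ∈ frontier Ω, dist u y ≤ dist u b) :
    IsSmoothBoundaryPoint Ω y := by
  have huy : u ≠ y := fun h => hyB.2 (h ▸ hu)
  obtain ⟨k, -, φ, hφ, hk⟩ := hΩ.corners y (hΩ.isCompact.isClosed.frontier_subset hyB)
  have hys := hφ.mem_source
  have h0 : ∀ j, φ y j = 0 := fun j => by rw [hφ.map_zero]; rfl
  obtain ⟨j, hj, -⟩ : ∃ j : Fin (n + 1), j.1 < k ∧ φ y j = 0 := by
    by_contra! hcon
    exact hyB.2 (hφ.mem_interior hk hys fun j hj => absurd (h0 j) (hcon j hj))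
  refine hφ.isSmoothBoundaryPoint hk hys hj (h0 j) fun i hi hij => False.elim ?_
  -- directions pointing into the ball do not decrease the active coordinates
  have hpos : ∀ i : Fin (n + 1), i.1 < k → ∀ v, 0 < ⟪v, u - y⟫ → 0 ≤ fderiv ℝ φ y v i := by
    intro i hi v hv
    by_contra! hneg
    have h1 := eventually_pos_of_fderiv_pos (G := fun w => - φ w i) (v := v)
      (hφ.smoothNear_coord hys i).differentiableAt.neg (by simp [h0 i]) (by
        rw [fderiv_fun_neg, neg_apply, hφ.fderiv_coord hys]
        linarith)
    have h2 := eventually_mem_interior_of_inner_pos hu hy hv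
    obtain ⟨t, ht1, ht2, ht3⟩ := (h1.and (h2.and ((tendsto_add_smul y v).eventually
      (φ.open_source.mem_nhds hys)))).exists
    have := (hk _ ht3).1 (interior_subset ht2) i hi
    linarith
  -- by continuity, the same holds for directions tangent to the ball
  have hpos' : ∀ i : Fin (n + 1), i.1 < k → ∀ v, 0 ≤ ⟪v, u - y⟫ → 0 ≤ fderiv ℝ φ y v i := by
    intro i hi v hv
    have h1 : Tendsto (fun t : ℝ => fderiv ℝ φ y (v + t • (u - y)) i) (𝓝[>] 0)
        (𝓝 (fderiv ℝ φ y v i)) := by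
      have : Continuous fun t : ℝ => fderiv ℝ φ y (v + t • (u - y)) i := by fun_prop
      simpa using (this.tendsto 0).mono_left nhdsWithin_le_nhds
    refine ge_of_tendsto h1 ?_
    filter_upwards [self_mem_nhdsWithin] with t ht
    refine hpos i hi _ ?_
    have h2 : 0 < ‖u - y‖ := norm_pos_iff.2 (sub_ne_zero.2 huy)
    have ht' : (0 : ℝ) < t := ht
    rw [inner_add_left, inner_smul_left, real_inner_self_eq_norm_sq]
    have : 0 < t * ‖u - y‖ ^ 2 := by positivity
    simpa using add_pos_of_nonneg_of_pos hv this
  -- of two active coordinates, one can be increased while the other is decreased; this direction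
  -- or its opposite points weakly into the ball
  obtain ⟨v, hv⟩ := hφ.fderiv_surjective hys (EuclideanSpace.single i 1 - EuclideanSpace.single j 1)
  rcases le_total 0 ⟪v, u - y⟫ with h1 | h1
  · have := hpos' j hj v h1
    rw [hv] at this
    simp [hij.symm] at this
    linarith
  · have := hpos' i hi (-v) (by rw [inner_neg_left]; linarith)
    rw [map_neg, hv] at this
    simp [hij] at this
    linarith

end Corners

/-! ### The boundary integral of a configuration -/

section BoundaryIntegral

variable {n m : ℕ} {Ω : Fin m → Set (Ambient n)} {g : Fin m → Ambient n → ℝ}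

/-- Almost no boundary point lies in three regions, so the parts of the boundary over which
`boundaryIntegral` sums fit together to the whole boundaries. -/
theorem IsMultiRegionConfiguration.boundaryIntegral_eq (hΩ : IsMultiRegionConfiguration Ω)
    (hg : ∀ i, IntegrableOn (g i) (frontier (Ω i)) (Measure.euclideanHausdorffMeasure n)) :
    boundaryIntegral Ω g =
      ∑ i, ∫ x in frontier (Ω i), g i x ∂(Measure.euclideanHausdorffMeasure n) := by
  have hfr : ∀ i, frontier (Ω i) ⊆ Ω i := fun i =>
    (hΩ.isRegion i).isCompact.isClosed.frontier_subset
  have hpair : ∀ i j, i ≠ j → Ω i ∩ Ω j ⊆ frontier (Ω i) := fun i j hij =>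
    (hΩ.boundary_intersection i j hij).trans inter_subset_left
  have htriple : ∀ i j l, i ≠ j → i ≠ l → j ≠ l → Measure.euclideanHausdorffMeasure n
      (frontier (Ω i) ∩ frontier (Ω j) ∩ frontier (Ω l)) = 0 := by
    intro i j l hij hil hjl
    rw [euclideanHausdorffMeasure_eq_zero_iff]
    refine measure_mono_null ?_ (measure_union_null (measure_union_null
      (hΩ.isRegion i).hausdorffMeasure_not_smooth (hΩ.isRegion j).hausdorffMeasure_not_smooth)
      (hΩ.isRegion l).hausdorffMeasure_not_smooth)
    rintro y ⟨⟨hi, hj⟩, hl⟩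
    by_contra hcon
    simp only [mem_union, mem_ofPred_eq, hi, hj, hl, true_and, not_or, not_not] at hcon
    exact not_three_smooth hcon.1.1 hcon.1.2 hcon.2 (hpair i j hij) (hpair i l hil) (hpair j l hjl)
  unfold boundaryIntegral
  refine Finset.sum_congr rfl fun i _ => ?_
  -- the unshared part takes the index `i` in the decomposition of the boundary of `Ω i`
  let s : Fin m → Set (Ambient n) := fun j => if j = i then
    frontier (Ω i) \ ⋃ j ∈ {j | j ≠ i}, frontier (Ω j) else frontier (Ω i) ∩ frontier (Ω j)
  have hsi : s i = frontier (Ω i) \ ⋃ j ∈ {j | j ≠ i}, frontier (Ω j) := if_pos rfl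
  have hsj : ∀ j, j ≠ i → s j = frontier (Ω i) ∩ frontier (Ω j) := fun j hj => if_neg hj
  have hU : ⋃ j, s j = frontier (Ω i) := by
    ext x
    simp only [mem_iUnion]
    constructor
    · rintro ⟨j, hj⟩
      by_cases hji : j = i
      · rw [hji, hsi] at hj; exact hj.1
      · rw [hsj j hji] at hj; exact hj.1
    · intro hx
      by_cases hex : ∃ j, j ≠ i ∧ x ∈ frontier (Ω j)
      · obtain ⟨j, hj, hxj⟩ := hex
        exact ⟨j, by rw [hsj j hj]; exact ⟨hx, hxj⟩⟩
      · push Not at hex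
        refine ⟨i, ?_⟩
        rw [hsi]
        exact ⟨hx, by simpa using hex⟩
  have hmeas : ∀ j, MeasurableSet (s j) := by
    intro j
    by_cases hji : j = i
    · rw [hji, hsi]
      exact isClosed_frontier.measurableSet.diff
        (MeasurableSet.biUnion (to_countable _) fun j _ => isClosed_frontier.measurableSet)
    · rw [hsj j hji]
      exact isClosed_frontier.measurableSet.inter isClosed_frontier.measurableSet
  have hdisj0 : ∀ j, j ≠ i → Disjoint (s i) (s j) := by
    intro j hj
    rw [hsi, hsj j hj, disjoint_left]
    rintro x ⟨-, hx⟩ ⟨-, hx'⟩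
    exact hx (mem_iUnion₂.2 ⟨j, hj, hx'⟩)
  have hdisj : Pairwise (Function.onFun (AEDisjoint (Measure.euclideanHausdorffMeasure n)) s) := by
    intro j l hjl
    by_cases hj : j = i
    · subst hj
      exact (hdisj0 l hjl.symm).aedisjoint
    by_cases hl : l = i
    · subst hl
      exact (hdisj0 j hjl).symm.aedisjoint
    change Measure.euclideanHausdorffMeasure n (s j ∩ s l) = 0
    rw [hsj j hj, hsj l hl]
    refine measure_mono_null ?_ (htriple i j l (Ne.symm hj) (Ne.symm hl) hjl)
    exact fun x hx => ⟨hx.1, hx.2.2⟩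
  have hint := integral_iUnion_ae (fun j => (hmeas j).nullMeasurableSet) hdisj
    (f := g i) (by rw [hU]; exact hg i)
  rw [hU, tsum_fintype, ← Finset.add_sum_erase _ _ (Finset.mem_univ i), hsi] at hint
  rw [hint]
  congr 1
  refine Finset.sum_congr rfl fun j hj => ?_
  rw [hsj j (Finset.ne_of_mem_erase hj)]

end BoundaryIntegral

/-! ### Closest boundary points and the medial axis -/

section ClosestPoints

variable {n : ℕ} {Ω : Set (Ambient n)} {y u w : Ambient n}

theorem IsRegion.isCompact_frontier (hΩ : IsRegion Ω) : IsCompact (frontier Ω) :=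
  hΩ.isCompact.of_isClosed_subset isClosed_frontier hΩ.isCompact.isClosed.frontier_subset

theorem IsRegion.frontier_nonempty (hΩ : IsRegion Ω) : (frontier Ω).Nonempty := by
  rw [nonempty_frontier_iff]
  exact ⟨hΩ.isConnected.nonempty, fun h => noncompact_univ (Ambient n) (h ▸ hΩ.isCompact)⟩

theorem IsRegion.closestPoints_nonempty (hΩ : IsRegion Ω) (u : Ambient n) :
    (closestPoints Ω u).Nonempty := by
  obtain ⟨y, hy, h⟩ := hΩ.isCompact_frontier.exists_infDist_eq_dist hΩ.frontier_nonempty u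
  exact ⟨y, hy, h.symm⟩

/-- The set of closest points depends upper semicontinuously on the point. -/
theorem IsRegion.eventually_closestPoints_subset (hΩ : IsRegion Ω) {V : Set (Ambient n)}
    (hV : IsOpen V) (h : closestPoints Ω u ⊆ V) : ∀ᶠ w in 𝓝 u, closestPoints Ω w ⊆ V := by
  rcases (frontier Ω \ V).eq_empty_or_nonempty with he | hne
  · exact Eventually.of_forall fun w b hb => sdiff_eq_empty.1 he hb.1
  have hc : IsCompact (frontier Ω \ V) := hΩ.isCompact_frontier.diff hV
  have h1 : Metric.infDist u (frontier Ω) < Metric.infDist u (frontier Ω \ V) := by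
    obtain ⟨b, hb, hbd⟩ := hc.exists_infDist_eq_dist hne u
    rw [hbd]
    refine lt_of_le_of_ne (Metric.infDist_le_dist_of_mem hb.1) fun heq => hb.2 (h ⟨hb.1, heq.symm⟩)
  have h2 : ∀ᶠ w in 𝓝 u, Metric.infDist w (frontier Ω) < Metric.infDist w (frontier Ω \ V) :=
    (Metric.continuous_infDist_pt _).continuousAt.eventually_lt
      (Metric.continuous_infDist_pt _).continuousAt h1
  filter_upwards [h2] with w hw b hb
  by_contra hbV
  have := Metric.infDist_le_dist_of_mem (x := w) (show b ∈ frontier Ω \ V from ⟨hb.1, hbV⟩)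
  rw [hb.2] at this
  linarith

theorem isClosed_setOf_mem_closestPoints {Y : Type*} [TopologicalSpace Y] {f g : Y → Ambient n}
    (hf : Continuous f) (hg : Continuous g) : IsClosed {t | g t ∈ closestPoints Ω (f t)} :=
  (isClosed_frontier.preimage hg).inter
    (isClosed_eq (hf.dist hg) ((Metric.continuous_infDist_pt _).comp hf))

/-- All closest points of nearby points lie on given sheets through the closest points. -/
theorem IsRegion.eventually_closestPoints_sheet (hΩ : IsRegion Ω) {ι : Type*} {y : ι → Ambient n}
    {q : ι → Ambient n → Ambient n} (hq : ∀ i, IsSheet (frontier Ω) (y i) u (q i))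
    [Finite ι] (h : closestPoints Ω u ⊆ range y) :
    ∀ᶠ w in 𝓝 u, ∀ b ∈ closestPoints Ω w, ∃ i, b = q i w := by
  have h1 : ∀ i, ∃ V : Set (Ambient n), IsOpen V ∧ y i ∈ V ∧ ∀ᶠ w in 𝓝 u, ∀ b ∈ V,
      b ∈ closestPoints Ω w → b = q i w := by
    intro i
    have h2 := (hq i).eq_of_closest
    rw [nhds_prod_eq, eventually_prod_iff] at h2
    obtain ⟨p₁, hp₁, p₂, hp₂, h3⟩ := h2
    obtain ⟨V, hV, hVo, hVy⟩ := mem_nhds_iff.1 hp₁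
    refine ⟨V, hVo, hVy, hp₂.mono fun w hw b hb hbw => ?_⟩
    rw [mem_closestPoints_iff] at hbw
    exact h3 (hV hb) hw hbw.1 hbw.2
  choose V hVo hVy hV using h1
  filter_upwards [hΩ.eventually_closestPoints_subset (isOpen_iUnion hVo) (u := u) (fun b hb => by
      obtain ⟨i, rfl⟩ := h hb
      exact mem_iUnion.2 ⟨i, hVy i⟩), eventually_all.2 hV] with w hw hw' b hb
  obtain ⟨i, hi⟩ := mem_iUnion.1 (hw hb)
  exact ⟨i, hw' i b hi hb⟩

/-- Near a point with a single sheet over it there is a single nondegenerate closest point. -/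
theorem IsRegion.eventually_closestPoints_eq_singleton (hΩ : IsRegion Ω)
    {q : Ambient n → Ambient n} (hq : IsSheet (frontier Ω) y u q) (h : closestPoints Ω u = {y}) :
    ∀ᶠ w in 𝓝 u, closestPoints Ω w = {q w} ∧ w ∉ interiorMedialAxis Ω := by
  filter_upwards [hΩ.eventually_closestPoints_sheet (ι := Unit) (y := fun _ => y) (fun _ => hq)
    (by rw [h]; simp), hq.not_isDegenerateAt] with w h1 h2
  have h3 : closestPoints Ω w = {q w} :=
    (hΩ.closestPoints_nonempty w).subset_singleton_iff.1 fun b hb => by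
      obtain ⟨-, hi⟩ := h1 b hb
      exact hi
  refine ⟨h3, fun h4 => ?_⟩
  rcases h4.2 with h5 | ⟨b, hb, hd⟩
  · rw [h3] at h5
    exact not_nontrivial_singleton h5
  · rw [h3, mem_singleton_iff] at hb
    exact h2 (hb ▸ hd)

theorem dist_pos_of_closest (hu : u ∈ interior Ω) (hy : y ∈ closestPoints Ω u) :
    0 < dist u y := dist_pos.2 fun h => hy.1.2 (h ▸ hu)

/-- At a smooth closest point of an interior point `u`, the segment to `u` points along the inward
unit normal. -/
theorem IsDefiningFunction.sub_eq_smul_normal {G : Ambient n → ℝ} (hG : IsDefiningFunction Ω y G)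
    {a : Ambient n} {c : ℝ} (ha : ‖a‖ = 1) (hc : 0 < c) (haG : ∀ v, fderiv ℝ G y v = c * ⟪a, v⟫)
    (hu : u ∈ interior Ω) (hy : y ∈ closestPoints Ω u) : u - y = dist u y • a := by
  have hd := dist_pos_of_closest hu hy
  have hne : u - y ≠ 0 := sub_ne_zero.2 (dist_pos.1 hd)
  have h1 : ‖(dist u y)⁻¹ • (u - y)‖ = 1 := by
    rw [norm_smul, norm_inv, Real.norm_of_nonneg hd.le, dist_eq_norm]
    exact inv_mul_cancel₀ (norm_ne_zero_iff.2 hne)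
  have h2 := eq_neg_of_not_both_pos (a := -a) (by rwa [norm_neg]) h1 fun v ⟨hv1, hv2⟩ => by
    have hv3 : 0 < ⟪v, u - y⟫ := by
      rw [inner_smul_left] at hv2
      rw [real_inner_comm]
      exact pos_of_mul_pos_right hv2 (by simp)
    have h4 := eventually_mem_interior_of_inner_pos hu (mem_closestPoints_iff.1 hy).2 hv3
    have h5 : fderiv ℝ (fun w => - G w) y v = - fderiv ℝ G y v := by
      rw [fderiv_fun_neg, neg_apply]
    have h6 := eventually_pos_of_fderiv_pos (G := fun w => - G w) (v := v)
      hG.smooth.differentiableAt.neg (by simp [hG.map_base]) (by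
        rw [h5, haG]
        rw [inner_neg_left] at hv1
        nlinarith)
    obtain ⟨t, ht1, ht2, ht3⟩ := (h4.and (h6.and
      ((tendsto_add_smul y v).eventually hG.eventually_mem_iff))).exists
    have := ht3.1 (interior_subset ht1)
    linarith
  rw [neg_neg] at h2
  rw [← h2, smul_smul, mul_inv_cancel₀ hd.ne', one_smul]

/-- Strictly between an interior point and one of its closest points there are no medial axis
points: the closest point is unique there, and the Hessian, affine along the segment, is positive
definite. -/
theorem IsRegion.add_smul_sub_notMem_interiorMedialAxis (hΩ : IsRegion Ω) (hu : u ∈ interior Ω)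
    (hy : y ∈ closestPoints Ω u) {s : ℝ} (hs0 : 0 < s) (hs1 : s < 1) :
    y + s • (u - y) ∉ interiorMedialAxis Ω := by
  set w := y + s • (u - y) with hw
  have hwy : w - y = s • (u - y) := by rw [hw]; abel
  have hwu : u - w = (1 - s) • (u - y) := by rw [hw, sub_smul, one_smul]; abel
  have hd1 : dist w y = s * dist u y := by
    rw [dist_eq_norm, hwy, norm_smul, Real.norm_of_nonneg hs0.le, dist_eq_norm]
  have hd2 : dist u w = (1 - s) * dist u y := by
    rw [dist_eq_norm, hwu, norm_smul, Real.norm_of_nonneg (by linarith), dist_eq_norm]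
  have hy' := mem_closestPoints_iff.1 hy
  have hle : ∀ b ∈ frontier Ω, dist w y ≤ dist w b := by
    intro b hb
    have h1 := hy'.2 b hb
    have h2 := dist_triangle u w b
    rw [hd2] at h2
    rw [hd1]
    linarith
  have hclosest : closestPoints Ω w = {y} := by
    refine Subset.antisymm (fun b hb => ?_) (singleton_subset_iff.2
      (mem_closestPoints_iff.2 ⟨hy'.1, hle⟩))
    have hb' := mem_closestPoints_iff.1 hb
    have h1 : dist w b = dist w y := le_antisymm (hb'.2 y hy'.1) (hle b hb'.1)
    have h2 : dist u b = dist u w + dist w b := by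
      refine le_antisymm (dist_triangle _ _ _) ?_
      rw [h1, hd1, hd2]
      have := hy'.2 b hb'.1
      linarith
    -- equality in the triangle inequality puts `b` on the ray from `u` through `w`
    have h3 : SameRay ℝ (u - w) (w - b) := by
      rw [sameRay_iff_norm_add, sub_add_sub_cancel]
      simpa [dist_eq_norm] using h2
    have hyu := dist_pos_of_closest hu hy
    rw [hwu] at h3
    have h4 : SameRay ℝ (u - y) (w - b) := by
      have := h3.pos_smul_left (inv_pos.2 (sub_pos.2 hs1))
      rwa [smul_smul, inv_mul_cancel₀ (sub_pos.2 hs1).ne', one_smul] at this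
    have h5 : SameRay ℝ (w - y) (w - b) := by
      rw [hwy]
      exact SameRay.pos_smul_left h4 hs0
    have h6 := (sameRay_iff_of_norm_eq (by
      simpa [dist_eq_norm] using h1.symm)).1 h5
    rw [mem_singleton_iff]
    exact (sub_right_injective h6).symm
  rintro ⟨-, h | ⟨b, hb, hdeg⟩⟩
  · rw [hclosest] at h
    exact not_nontrivial_singleton h
  · rw [hclosest, mem_singleton_iff] at hb
    subst hb
    obtain ⟨γ, hγ⟩ := (hΩ.isSmoothBoundaryPoint_of_closest hu hy'.1 hy'.2).exists_isLocalParam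
    -- in the direction of `v`, the Hessian at `w` is `2 (1 - s) ‖γ' v‖²` plus `s` times the
    -- positive semidefinite Hessian at `u`
    obtain ⟨v, hv, hker⟩ := (hγ.isDegenerateAt_iff
      (hγ.fderiv_distSq_eq_zero (hγ.inner_eq_zero_of_closest hle))).1 hdeg
    have h1 := congrArg (fun L => L v) hker
    simp only [hessian_distSq_apply hγ.smooth, hγ.map_zero, zero_apply] at h1
    have h2 := (smoothNear_distSq hγ.smooth u).hessian_nonneg (hγ.isLocalMin_distSq hy'.2) v
    rw [hessian_distSq_apply hγ.smooth, hγ.map_zero] at h2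
    have h3 : b - w = s • (b - u) := by
      rw [← neg_sub, hwy, ← smul_neg, neg_sub]
    rw [h3, inner_smul_left] at h1
    have h4 : 0 < ⟪fderiv ℝ γ 0 v, fderiv ℝ γ 0 v⟫ := by
      rw [real_inner_self_eq_norm_sq]
      have : fderiv ℝ γ 0 v ≠ 0 := fun h => hv (hγ.immersion (by rw [h, _root_.map_zero]))
      positivity
    simp only [conj_trivial] at h1
    nlinarith

/-- A boundary point is a closest point of at most one medial axis point. -/
theorem IsRegion.unique_of_mem_closestPoints (hΩ : IsRegion Ω) (hu : u ∈ interiorMedialAxis Ω)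
    (hw : w ∈ interiorMedialAxis Ω) (hyu : y ∈ closestPoints Ω u) (hyw : y ∈ closestPoints Ω w) :
    u = w := by
  have hyu' := mem_closestPoints_iff.1 hyu
  obtain ⟨G, hG⟩ := hΩ.isSmoothBoundaryPoint_of_closest hu.1 hyu'.1 hyu'.2
  obtain ⟨a, c, ha, hc, haG⟩ := exists_unit_gradient hG.fderiv_ne_zero
  have h1 := hG.sub_eq_smul_normal ha hc haG hu.1 hyu
  have h2 := hG.sub_eq_smul_normal ha hc haG hw.1 hyw
  have key : ∀ {u w : Ambient n}, u ∈ interiorMedialAxis Ω → w ∈ interiorMedialAxis Ω →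
      y ∈ closestPoints Ω u → y ∈ closestPoints Ω w → u - y = dist u y • a →
      w - y = dist w y • a → ¬ dist u y < dist w y := by
    intro u w hu hw hyu hyw h1 h2 hlt
    have hpu := dist_pos_of_closest hu.1 hyu
    have hpw := dist_pos_of_closest hw.1 hyw
    refine hΩ.add_smul_sub_notMem_interiorMedialAxis hw.1 hyw (s := dist u y / dist w y)
      (by positivity) ((div_lt_one hpw).2 hlt) ?_
    rw [h2, smul_smul, div_mul_cancel₀ _ hpw.ne', ← h1, add_sub_cancel]
    exact hu
  have h3 : dist u y = dist w y := le_antisymm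
    (not_lt.1 (key hw hu hyw hyu h2 h1)) (not_lt.1 (key hu hw hyu hyw h1 h2))
  have h4 : u - y = w - y := by rw [h1, h2, h3]
  exact sub_left_injective h4

/-- At a nondegenerate closest point there is a sheet, constant along the normal line, whose
derivative is positive definite across that line. -/
theorem IsRegion.exists_isSheet (hΩ : IsRegion Ω) (hu : u ∈ interior Ω)
    (hy : y ∈ closestPoints Ω u) (hnd : ¬ IsDegenerateAt (frontier Ω) u y) :
    ∃ q, IsSheet (frontier Ω) y u q ∧ (∀ᶠ t : ℝ in 𝓝 1, q (y + t • (u - y)) = y) ∧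
      ∀ v, 0 ≤ ⟪fderiv ℝ q u v, v⟫ ∧
        (⟪fderiv ℝ q u v, v⟫ = 0 → ∃ c : ℝ, v = c • (y - u)) := by
  have hy' := mem_closestPoints_iff.1 hy
  obtain ⟨γ, hγ⟩ := (hΩ.isSmoothBoundaryPoint_of_closest hu hy'.1 hy'.2).exists_isLocalParam
  have horth := hγ.inner_eq_zero_of_closest hy'.2
  obtain ⟨q, hq, hline, hpos⟩ := hγ.exists_isSheet horth
    (fun v hv => hγ.hessian_pos_of_closest hy'.2 hnd hv)
  refine ⟨q, hq, ?_, fun v => ⟨(hpos v).1, fun h0 => ?_⟩⟩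
  · have ht : Tendsto (fun t : ℝ => y + t • (u - y)) (𝓝 1) (𝓝 u) := by
      have : Continuous fun t : ℝ => y + t • (u - y) := by fun_prop
      simpa using this.tendsto 1
    filter_upwards [ht.eventually hline] with t h
    refine h fun v => ?_
    have : y - (y + t • (u - y)) = t • (y - u) := by
      rw [← neg_sub u y, smul_neg]; abel
    rw [this, inner_smul_left, horth, mul_zero]
  · -- the orthogonal complement of the tangent space is the normal line
    set R := LinearMap.range (fderiv ℝ γ 0 : EuclideanSpace ℝ (Fin n) →ₗ[ℝ] Ambient n) with hR
    have hRdim : Module.finrank ℝ R = n := by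
      rw [hR, LinearMap.finrank_range_of_inj hγ.immersion, finrank_euclideanSpace_fin]
    have hRo : Module.finrank ℝ Rᗮ = 1 := by
      have := R.finrank_add_finrank_orthogonal
      rw [hRdim, finrank_euclideanSpace_fin] at this
      omega
    have hmem : ∀ x : Ambient n, (∀ z, ⟪x, fderiv ℝ γ 0 z⟫ = 0) → x ∈ Rᗮ := by
      intro x hx
      rw [Submodule.mem_orthogonal]
      rintro _ ⟨z, rfl⟩
      rw [real_inner_comm]
      exact hx z
    have hne : (⟨y - u, hmem _ horth⟩ : Rᗮ) ≠ 0 := by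
      intro h
      have : y - u = 0 := congrArg Subtype.val h
      exact hy'.1.2 (sub_eq_zero.1 this ▸ hu)
    obtain ⟨c, hc⟩ := (finrank_eq_one_iff_of_nonzero' _ hne).1 hRo ⟨v, hmem v ((hpos v).2 h0)⟩
    exact ⟨c, (congrArg Subtype.val hc).symm⟩

/-- Every smooth boundary point is a closest point of a medial axis point: the farthest point on
its inward normal of which it is a closest point. -/
theorem IsRegion.exists_mem_interiorMedialAxis (hΩ : IsRegion Ω) (hyB : y ∈ frontier Ω)
    (hy : IsSmoothBoundaryPoint Ω y) :
    ∃ u ∈ interiorMedialAxis Ω, y ∈ closestPoints Ω u := by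
  obtain ⟨γ, hγ⟩ := hy.exists_isLocalParam
  obtain ⟨G, hG⟩ := hy
  obtain ⟨a, c, ha, hc, haG⟩ := exists_unit_gradient hG.fderiv_ne_zero
  have hclosed : IsClosed Ω := hΩ.isCompact.isClosed
  have hcont : Continuous fun t : ℝ => y + t • a := by fun_prop
  -- the normal is orthogonal to the tangent space
  have horth : ∀ v, ⟪a, fderiv ℝ γ 0 v⟫ = 0 := by
    intro v
    have h1 : (fun z => G (γ z)) =ᶠ[𝓝 0] fun _ => (0 : ℝ) := by
      filter_upwards [hγ.tendsto.eventually hG.mem_frontier_iff, hγ.eventually_mem] with z h1 h2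
      exact h1.1 h2
    have h2 : HasFDerivAt (fun z => G (γ z)) ((fderiv ℝ G y).comp (fderiv ℝ γ 0)) 0 :=
      HasFDerivAt.comp (g := G) 0 (by rw [hγ.map_zero]; exact hG.smooth.hasFDerivAt)
        hγ.smooth.hasFDerivAt
    have h3 := congrArg (fun L => L v)
      (h2.unique ((hasFDerivAt_const (0 : ℝ) (0 : EuclideanSpace ℝ (Fin n))).congr_of_eventuallyEq
        h1))
    simp only [ContinuousLinearMap.comp_apply, haG, zero_apply] at h3
    exact (mul_eq_zero.1 h3).resolve_left hc.ne'
  -- the distances along the normal up to which `y` is a closest point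
  set S : Set ℝ := {t | 0 ≤ t ∧ y + t • a ∈ Ω ∧ y ∈ closestPoints Ω (y + t • a)} with hS
  have hScl : IsClosed S := isClosed_Ici.inter ((hclosed.preimage hcont).inter
    (isClosed_setOf_mem_closestPoints hcont continuous_const))
  have hyΩ : y ∈ Ω := hclosed.frontier_subset hyB
  have hSb : BddAbove S := by
    obtain ⟨R, hR⟩ := hΩ.isCompact.isBounded.exists_norm_le
    refine ⟨R + ‖y‖, fun t ht => ?_⟩
    have h1 := hR _ ht.2.1
    have h2 := norm_sub_le (y + t • a) y
    rw [add_sub_cancel_left, norm_smul, ha, mul_one, Real.norm_of_nonneg ht.1] at h2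
    linarith
  -- small steps along the normal keep `y` as the closest point
  obtain ⟨t₀, ht₀, ht₀S⟩ : ∃ t₀ > 0, t₀ ∈ S := by
    have hcy : closestPoints Ω y = {y} := by
      ext b
      rw [mem_closestPoints_iff, mem_singleton_iff]
      constructor
      · rintro ⟨-, hb⟩
        have := hb y hyB
        rw [dist_self] at this
        exact (dist_le_zero.1 this).symm
      · rintro rfl
        exact ⟨hyB, fun b _ => by rw [dist_self]; exact dist_nonneg⟩
    obtain ⟨q, hq, hline, -⟩ := hγ.exists_isSheet (u := y) (by simp) (fun v hv => by
      rw [hessian_distSq_apply hγ.smooth, hγ.map_zero, sub_self, inner_zero_left, add_zero,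
        real_inner_self_eq_norm_sq]
      have : fderiv ℝ γ 0 v ≠ 0 := fun h => hv (hγ.immersion (by rw [h, _root_.map_zero]))
      positivity)
    have h1 := (tendsto_add_smul y a).eventually
      ((hΩ.eventually_closestPoints_eq_singleton hq hcy).and
        (hline.and hG.mem_interior_of_pos))
    have h2 := eventually_pos_of_fderiv_pos (v := a) hG.smooth.differentiableAt hG.map_base (by
      rw [haG, real_inner_self_eq_norm_sq, ha]; simpa using hc)
    obtain ⟨t, ⟨⟨h3, -⟩, h4, h5⟩, h6, h7⟩ := (h1.and (h2.and self_mem_nhdsWithin)).exists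
    refine ⟨t, h7, (show (0 : ℝ) < t from h7).le, interior_subset (h5 h6), ?_⟩
    rw [h3, mem_singleton_iff, h4]
    intro v
    rw [show y - (y + t • a) = -(t • a) by abel, inner_neg_left, inner_smul_left, horth]
    simp
  set T := sSup S with hT
  have hTS : T ∈ S := hScl.csSup_mem ⟨t₀, ht₀S⟩ hSb
  have hTpos : 0 < T := ht₀.trans_le (le_csSup hSb ht₀S)
  set u := y + T • a with hu
  -- a boundary point `u ≠ y` would be closer to itself than `y` is
  have huint : u ∈ interior Ω := by
    by_contra hni
    have huB : u ∈ frontier Ω := ⟨subset_closure hTS.2.1, hni⟩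
    have h1 := (mem_closestPoints_iff.1 hTS.2.2).2 u huB
    rw [dist_self, dist_eq_norm, add_sub_cancel_left, norm_smul, ha, mul_one,
      Real.norm_of_nonneg hTpos.le] at h1
    linarith
  refine ⟨u, ?_, hTS.2.2⟩
  by_contra hnot
  have hnot' : ¬ ((closestPoints Ω u).Nontrivial ∨
    ∃ y ∈ closestPoints Ω u, IsDegenerateAt (frontier Ω) u y) := fun h => hnot ⟨huint, h⟩
  rw [not_or, not_nontrivial_iff] at hnot'
  have hcu : closestPoints Ω u = {y} := hnot'.1.eq_singleton_of_mem hTS.2.2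
  -- off the medial axis the sheet through `y` could be followed beyond `T`
  obtain ⟨q, hq, hline, -⟩ := hΩ.exists_isSheet huint hTS.2.2 fun hd => hnot'.2 ⟨y, hTS.2.2, hd⟩
  have huy : u - y = T • a := by rw [hu, add_sub_cancel_left]
  have ht : Tendsto (fun t : ℝ => y + t • (u - y)) (𝓝 1) (𝓝 u) := by
    have : Continuous fun t : ℝ => y + t • (u - y) := by fun_prop
    simpa using this.tendsto 1
  have h1 := hline.and (ht.eventually ((hΩ.eventually_closestPoints_eq_singleton hq hcu).and
    (isOpen_interior.mem_nhds huint)))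
  obtain ⟨s, ⟨h2, ⟨h3, -⟩, h4⟩, h5⟩ :=
    ((h1.filter_mono nhdsWithin_le_nhds).and (self_mem_nhdsWithin (s := Ioi (1 : ℝ)))).exists
  rw [huy, smul_smul] at h2 h3 h4
  have h6 : s * T ∈ S := ⟨by have : (1 : ℝ) < s := h5; positivity, interior_subset h4, by
    rw [h3, h2]; rfl⟩
  have h7 := le_csSup hSb h6
  have : (1 : ℝ) < s := h5
  nlinarith

end ClosestPoints

/-! ### Determinants and volume distortion of linear maps -/

section RadialJacobianAlgebra

variable {E : Type*} [NormedAddCommGroup E] [InnerProductSpace ℝ E] [FiniteDimensional ℝ E]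

/-- A linear map which is positive definite, but not necessarily symmetric, has positive
determinant. -/
theorem det_pos_of_inner_pos {A : E →ₗ[ℝ] E} (h : ∀ v ≠ 0, 0 < ⟪A v, v⟫) :
    0 < LinearMap.det A := by
  -- the segment from the identity to `A` consists of positive definite, hence invertible, maps
  let K : ℝ → E →ₗ[ℝ] E := fun t => (1 - t) • LinearMap.id + t • A
  have hK : Continuous fun t => LinearMap.det (K t) := by
    have h1 : Continuous fun t : ℝ => (1 - t) • ContinuousLinearMap.id ℝ E +
        t • A.toContinuousLinearMap := by fun_prop
    have h2 := (ContinuousLinearMap.continuous_det (E := E) (𝕜 := ℝ)).comp h1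
    exact h2
  have hne : ∀ t ∈ Icc (0 : ℝ) 1, LinearMap.det (K t) ≠ 0 := by
    intro t ht h0
    obtain ⟨v, hv, hv0⟩ : ∃ v, v ≠ 0 ∧ K t v = 0 := by
      have := LinearMap.bot_lt_ker_of_det_eq_zero h0
      obtain ⟨v, hv, hv0⟩ := (Submodule.ne_bot_iff _).1 this.ne'
      exact ⟨v, hv0, hv⟩
    have h1 : ⟪K t v, v⟫ = (1 - t) * ‖v‖ ^ 2 + t * ⟪A v, v⟫ := by
      simp [K, inner_add_left, inner_smul_left]
    rw [hv0, inner_zero_left] at h1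
    have h2 := h v hv
    have h3 : 0 < ‖v‖ ^ 2 := by positivity
    rcases ht.1.eq_or_lt with rfl | ht0
    · linarith
    · nlinarith [ht.2, mul_pos ht0 h2]
  by_contra hneg
  have h0 : LinearMap.det (K 0) = 1 := by simp [K]
  have h1 : K 1 = A := by simp [K]
  have hz : (0 : ℝ) ∈ Icc (LinearMap.det (K 1)) (LinearMap.det (K 0)) := by
    rw [h0, h1]; exact ⟨not_lt.1 hneg, zero_le_one⟩
  obtain ⟨t, ht, ht0⟩ := intermediate_value_Icc' zero_le_one hK.continuousOn hz
  exact hne t ht ht0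

/-- The map `Q + u uᵀ`, where `u` is the unit vector in the direction of `U`. -/
noncomputable def normalExtension (Q : E →L[ℝ] E) (U : E) : E →L[ℝ] E :=
  Q + (innerSL ℝ (‖U‖⁻¹ • U)).smulRight (‖U‖⁻¹ • U)

variable {Q : E →L[ℝ] E} {U : E} {T : Submodule ℝ E}

theorem normalExtension_apply (v : E) :
    normalExtension Q U v = Q v + (‖U‖⁻¹ * (‖U‖⁻¹ * ⟪U, v⟫)) • U := by
  simp [normalExtension, inner_smul_left, smul_smul]
  congr 1
  ring

theorem normalExtension_self (hU : U ≠ 0) (hker : Q U = 0) : normalExtension Q U U = U := by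
  rw [normalExtension_apply, hker, real_inner_self_eq_norm_sq, zero_add]
  have := norm_ne_zero_iff.2 hU
  rw [show ‖U‖⁻¹ * (‖U‖⁻¹ * ‖U‖ ^ 2) = 1 by field_simp, one_smul]

theorem det_normalExtension_pos (hU : U ≠ 0)
    (hpos : ∀ v, 0 ≤ ⟪Q v, v⟫ ∧ (⟪Q v, v⟫ = 0 → ∃ c : ℝ, v = c • U)) :
    0 < LinearMap.det (normalExtension Q U : E →ₗ[ℝ] E) := by
  refine det_pos_of_inner_pos fun v hv => ?_
  have hU' := norm_pos_iff.2 hU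
  have h1 : ⟪(normalExtension Q U : E →ₗ[ℝ] E) v, v⟫ = ⟪Q v, v⟫ + (‖U‖⁻¹ * ⟪U, v⟫) ^ 2 := by
    change ⟪normalExtension Q U v, v⟫ = _
    rw [normalExtension_apply, inner_add_left, inner_smul_left]
    simp
    ring
  rw [h1]
  refine lt_of_le_of_ne (add_nonneg (hpos v).1 (sq_nonneg _)) fun h0 => ?_
  obtain ⟨h2, h3⟩ := (add_eq_zero_iff_of_nonneg (hpos v).1 (sq_nonneg _)).1 h0.symm
  obtain ⟨c, rfl⟩ := (hpos v).2 h2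
  rw [inner_smul_right, real_inner_self_eq_norm_sq] at h3
  have h4 : c ≠ 0 := fun h => hv (by rw [h, zero_smul])
  have h5 : ‖U‖⁻¹ * (c * ‖U‖ ^ 2) ≠ 0 := by positivity
  exact h5 (pow_eq_zero_iff (two_ne_zero)|>.1 h3)

/-- Projecting along `U`, the map `Q` induces on a complement `T` of the line of `U` an
endomorphism conjugate to the one induced by `Q + u uᵀ` on the quotient by that line. -/
theorem det_projectionOnto_comp (hU : U ≠ 0) (hker : Q U = 0)
    (hT : IsCompl T (Submodule.span ℝ {U})) :
    LinearMap.det (T.projectionOnto (Submodule.span ℝ {U}) hT ∘ₗ (Q : E →ₗ[ℝ] E) ∘ₗ T.subtype) =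
      LinearMap.det (normalExtension Q U : E →ₗ[ℝ] E) := by
  set W := Submodule.span ℝ {U} with hW
  have hWA : ∀ w ∈ W, normalExtension Q U w = w := by
    intro w hw
    obtain ⟨c, rfl⟩ := Submodule.mem_span_singleton.1 hw
    rw [map_smul, normalExtension_self hU hker]
  have hle : W ≤ W.comap (normalExtension Q U : E →ₗ[ℝ] E) := fun w hw => by
    change normalExtension Q U w ∈ W
    rwa [hWA w hw]
  rw [LinearMap.det_eq_det_mul_det W _ hle]
  have h1 : (normalExtension Q U : E →ₗ[ℝ] E).restrict hle = LinearMap.id := by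
    ext w
    exact hWA w w.2
  rw [h1, LinearMap.det_id, one_mul]
  let e := Submodule.quotientEquivOfIsCompl W T hT.symm
  rw [← LinearMap.det_conj (W.mapQ W (normalExtension Q U : E →ₗ[ℝ] E) hle) e]
  congr 1
  ext t
  have h2 : e.symm t = Submodule.Quotient.mk (t : E) := by
    rw [LinearEquiv.symm_apply_eq]
    exact (Submodule.quotientEquivOfIsCompl_apply_mk_right hT.symm t).symm
  simp only [LinearMap.comp_apply, LinearEquiv.coe_coe, h2, Submodule.mapQ_apply]
  change _ = ((e (Submodule.Quotient.mk (normalExtension Q U (t : E))) : T) : E)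
  rw [Submodule.quotientEquivOfIsCompl_apply_mk, normalExtension_apply, map_add,
    Submodule.projectionOnto_apply_of_mem_right hT (Submodule.smul_mem _ _
      (Submodule.mem_span_singleton_self U)), add_zero]
  rfl

/-- The volume distortion of the orthogonal projection of `T` to the orthogonal complement of a
unit vector `u` is the length of the component of `u` normal to `T`. -/
theorem normDet_sub_inner {u : E} (hu : ‖u‖ = 1) :
    ((LinearMap.id - ((innerSL ℝ u).smulRight u : E →L[ℝ] E).toLinearMap) ∘ₗ T.subtype).normDet =
      ‖Tᗮ.starProjection u‖ := by
  set f := (LinearMap.id - ((innerSL ℝ u).smulRight u : E →L[ℝ] E).toLinearMap) ∘ₗ T.subtype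
  have hf : ∀ t : T, f t = (t : E) - ⟪u, (t : E)⟫ • u := fun t => rfl
  rw [← sq_eq_sq₀ (LinearMap.normDet_nonneg _) (norm_nonneg _)]
  let b := stdOrthonormalBasis ℝ T
  have h1 := LinearMap.normDet_sq_eq_det_gram f b
  -- the Gram matrix is a rank-one perturbation of the identity
  have h2 : Matrix.gram ℝ (fun i => f (b i)) = 1 +
      Matrix.replicateCol Unit (fun i => -⟪u, (b i : E)⟫) *
        Matrix.replicateRow Unit (fun i => ⟪u, (b i : E)⟫) := by
    ext i j
    have h3 : ⟪(b i : E), (b j : E)⟫ = (1 : Matrix _ _ ℝ) i j := by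
      rw [Matrix.one_apply, ← orthonormal_iff_ite.1 b.orthonormal i j]
      rfl
    simp only [Matrix.gram_apply, hf, inner_sub_left, inner_sub_right, inner_smul_left,
      inner_smul_right, real_inner_self_eq_norm_sq, hu, h3, Matrix.add_apply, Matrix.mul_apply,
      Matrix.replicateCol_apply, Matrix.replicateRow_apply]
    simp [real_inner_comm]
    ring
  rw [h2, Matrix.det_one_add_replicateCol_mul_replicateRow] at h1
  have h4 : ‖T.starProjection u‖ ^ 2 = ∑ i, ⟪u, (b i : E)⟫ ^ 2 := by
    have h5 := b.sum_sq_norm_inner_right (T.orthogonalProjectionOnto u)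
    have h6 : ‖T.starProjection u‖ = ‖T.orthogonalProjectionOnto u‖ := rfl
    rw [h6, ← h5]
    refine Finset.sum_congr rfl fun i _ => ?_
    rw [Submodule.inner_orthogonalProjectionOnto_eq_of_mem_left, Real.norm_eq_abs, sq_abs,
      real_inner_comm]
  have h7 := T.norm_sq_eq_add_norm_sq_starProjection u
  rw [hu] at h7
  have h8 : f.normDet ^ 2 = 1 - ∑ i, ⟪u, (b i : E)⟫ ^ 2 := by
    have h9 : ((f.normDet ^ 2 : ℝ) : ℝ) = _ := h1
    rw [h9]
    simp [dotProduct]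
    rw [sub_eq_add_neg]
    congr 2
    refine Finset.sum_congr rfl fun i _ => ?_
    ring
  rw [h8, ← h4]
  linarith

/-- The volume distortion of `Q` on `T` is the product of the determinant of the endomorphism of
`T` induced by projecting along `U`, and of the normal component of `u`. -/
theorem normDet_comp_subtype (hU : U ≠ 0) (horth : ∀ v, ⟪U, Q v⟫ = 0)
    (hT : IsCompl T (Submodule.span ℝ {U})) :
    ((Q : E →ₗ[ℝ] E) ∘ₗ T.subtype).normDet =
      |LinearMap.det (T.projectionOnto (Submodule.span ℝ {U}) hT ∘ₗ
        (Q : E →ₗ[ℝ] E) ∘ₗ T.subtype)| * ‖Tᗮ.starProjection (‖U‖⁻¹ • U)‖ := by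
  set P := T.projectionOnto (Submodule.span ℝ {U}) hT ∘ₗ (Q : E →ₗ[ℝ] E) ∘ₗ T.subtype with hP
  have hu : ‖‖U‖⁻¹ • U‖ = 1 := norm_smul_inv_norm (𝕜 := ℝ) hU
  have h1 : (Q : E →ₗ[ℝ] E) ∘ₗ T.subtype = ((LinearMap.id -
      ((innerSL ℝ (‖U‖⁻¹ • U)).smulRight (‖U‖⁻¹ • U) : E →L[ℝ] E).toLinearMap) ∘ₗ
      T.subtype) ∘ₗ P := by
    ext t
    have h2 : (Q (t : E)) - (P t : E) ∈ Submodule.span ℝ {U} := by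
      rw [← Submodule.projectionOnto_apply_eq_zero_iff hT, map_sub,
        Submodule.projectionOnto_apply_left hT (P t)]
      exact sub_self _
    obtain ⟨c, hc⟩ := Submodule.mem_span_singleton.1 h2
    have h3 : (P t : E) = Q (t : E) - c • U := by rw [hc]; abel
    change Q (t : E) = (P t : E) - ⟪‖U‖⁻¹ • U, (P t : E)⟫ • ‖U‖⁻¹ • U
    rw [h3, inner_sub_right, inner_smul_left, inner_smul_left, inner_smul_right, horth,
      real_inner_self_eq_norm_sq, smul_smul]
    have := norm_ne_zero_iff.2 hU
    rw [show ((starRingEnd ℝ) ‖U‖⁻¹ * 0 - (starRingEnd ℝ) ‖U‖⁻¹ * (c * ‖U‖ ^ 2)) * ‖U‖⁻¹ = -c by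
      simp; field_simp]
    simp
  rw [h1, LinearMap.normDet_comp_of_finrank_eq _ _ rfl, normDet_sub_inner hu,
    LinearMap.normDet_eq_abs_det, mul_comm]

end RadialJacobianAlgebra

/-! ### Points of the medial axis with two sheets -/

section GenericPoints

variable {n : ℕ} {Ω : Set (Ambient n)} {x y u : Ambient n} {q q₁ q₂ : Ambient n → Ambient n}

/-- The interior points with exactly two closest boundary points, both nondegenerate. -/
def genericPoints (Ω : Set (Ambient n)) : Set (Ambient n) :=
  {x ∈ interior Ω | ∃ y₁ y₂, y₁ ≠ y₂ ∧ closestPoints Ω x = {y₁, y₂} ∧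
    ¬ IsDegenerateAt (frontier Ω) x y₁ ∧ ¬ IsDegenerateAt (frontier Ω) x y₂}

theorem IsSheet.eventually {B : Set (Ambient n)} (h : IsSheet B y u q) :
    ∀ᶠ w in 𝓝 u, IsSheet B (q w) w q := by
  have ht : Tendsto (fun w => (q w, w)) (𝓝 u) (𝓝 (y, u)) := by
    have : ContinuousAt (fun w => (q w, w)) u := h.smooth.continuousAt.prodMk continuousAt_id
    rwa [ContinuousAt, h.map_base] at this
  filter_upwards [h.smooth.eventually, h.mem.eventually_nhds, h.orth.eventually_nhds,
    h.ker.eventually_nhds, ht.eventually h.eq_of_closest.eventually_nhds,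
    h.not_isDegenerateAt.eventually_nhds] with w h1 h2 h3 h4 h5 h6
  exact ⟨h1, rfl, h2, h3, h4, h5, h6⟩

/-- The determinant of the derivative of a sheet, extended by the identity in the direction of the
radial vector. -/
noncomputable def sheetJacobian (q : Ambient n → Ambient n) (w : Ambient n) : ℝ :=
  LinearMap.det (normalExtension (fderiv ℝ q w) (q w - w) : Ambient n →ₗ[ℝ] Ambient n)

theorem continuousAt_sheetJacobian (hq : SmoothNear q x) (hne : q x - x ≠ 0) :
    ContinuousAt (sheetJacobian q) x := by
  have h1 : ContinuousAt (fun w => normalExtension (fderiv ℝ q w) (q w - w)) x := by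
    have hd : ContinuousAt (fun w => q w - w) x := hq.continuousAt.sub continuousAt_id
    have hu : ContinuousAt (fun w => ‖q w - w‖⁻¹ • (q w - w)) x :=
      (hd.norm.inv₀ (norm_ne_zero_iff.2 hne)).smul hd
    unfold normalExtension
    refine hq.fderiv.continuousAt.add ?_
    have h2 : ContinuousAt (fun w => innerSL ℝ (‖q w - w‖⁻¹ • (q w - w))) x :=
      (innerSL ℝ).continuous.continuousAt.comp hu
    have h3 := (ContinuousLinearMap.smulRightL ℝ (Ambient n) (Ambient n)).continuous.continuousAt.comp
      h2 |>.clm_apply hu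
    exact h3
  exact (ContinuousLinearMap.continuous_det (E := Ambient n) (𝕜 := ℝ)).continuousAt.comp h1

/-- Over the interior point `x` the boundary has exactly the two closest points `q₁ x` and `q₂ x`,
which are nondegenerate and lie on the sheets `q₁` and `q₂`. -/
structure IsTwoSheeted (Ω : Set (Ambient n)) (x : Ambient n) (q₁ q₂ : Ambient n → Ambient n) :
    Prop where
  mem_interior : x ∈ interior Ω
  ne : q₁ x ≠ q₂ x
  closest : closestPoints Ω x = {q₁ x, q₂ x}
  sheet₁ : IsSheet (frontier Ω) (q₁ x) x q₁
  sheet₂ : IsSheet (frontier Ω) (q₂ x) x q₂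
  jacobian_pos₁ : 0 < sheetJacobian q₁ x
  jacobian_pos₂ : 0 < sheetJacobian q₂ x

theorem IsTwoSheeted.symm (h : IsTwoSheeted Ω x q₁ q₂) : IsTwoSheeted Ω x q₂ q₁ :=
  ⟨h.mem_interior, h.ne.symm, by rw [h.closest, pair_comm], h.sheet₂, h.sheet₁, h.jacobian_pos₂,
    h.jacobian_pos₁⟩

theorem IsTwoSheeted.mem_genericPoints (h : IsTwoSheeted Ω x q₁ q₂) : x ∈ genericPoints Ω :=
  ⟨h.mem_interior, _, _, h.ne, h.closest, h.sheet₁.not_isDegenerateAt.self_of_nhds,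
    h.sheet₂.not_isDegenerateAt.self_of_nhds⟩

theorem IsRegion.exists_isTwoSheeted (hΩ : IsRegion Ω) (hx : x ∈ interior Ω) {y₁ y₂ : Ambient n}
    (hne : y₁ ≠ y₂) (hcl : closestPoints Ω x = {y₁, y₂})
    (h₁ : ¬ IsDegenerateAt (frontier Ω) x y₁) (h₂ : ¬ IsDegenerateAt (frontier Ω) x y₂) :
    ∃ q₁ q₂, IsTwoSheeted Ω x q₁ q₂ ∧ q₁ x = y₁ ∧ q₂ x = y₂ := by
  have hy₁ : y₁ ∈ closestPoints Ω x := by rw [hcl]; exact mem_insert _ _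
  have hy₂ : y₂ ∈ closestPoints Ω x := by rw [hcl]; exact mem_insert_of_mem _ rfl
  obtain ⟨q₁, hq₁, -, hp₁⟩ := hΩ.exists_isSheet hx hy₁ h₁
  obtain ⟨q₂, hq₂, -, hp₂⟩ := hΩ.exists_isSheet hx hy₂ h₂
  have e₁ := hq₁.map_base
  have e₂ := hq₂.map_base
  subst e₁ e₂
  have hd : ∀ y ∈ closestPoints Ω x, y - x ≠ 0 := fun y hy h =>
    (dist_pos_of_closest hx hy).ne' (by rw [dist_comm, dist_eq_norm, h, norm_zero])
  exact ⟨q₁, q₂, ⟨hx, hne, hcl, hq₁, hq₂, det_normalExtension_pos (hd _ hy₁) hp₁,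
    det_normalExtension_pos (hd _ hy₂) hp₂⟩, rfl, rfl⟩

theorem IsTwoSheeted.mem_closest₁ (h : IsTwoSheeted Ω x q₁ q₂) : q₁ x ∈ closestPoints Ω x := by
  rw [h.closest]; exact mem_insert _ _

theorem IsTwoSheeted.mem_closest₂ (h : IsTwoSheeted Ω x q₁ q₂) : q₂ x ∈ closestPoints Ω x :=
  h.symm.mem_closest₁

theorem IsTwoSheeted.radial_ne_zero (h : IsTwoSheeted Ω x q₁ q₂) : q₁ x - x ≠ 0 := fun h0 =>
  (dist_pos_of_closest h.mem_interior h.mem_closest₁).ne' (by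
    rw [dist_comm, dist_eq_norm, h0, norm_zero])

theorem IsTwoSheeted.norm_sub_eq (h : IsTwoSheeted Ω x q₁ q₂) : ‖q₁ x - x‖ = ‖q₂ x - x‖ := by
  rw [← dist_eq_norm, ← dist_eq_norm, dist_comm, h.mem_closest₁.2, dist_comm, h.mem_closest₂.2]

theorem IsTwoSheeted.inner_sub_eq (h : IsTwoSheeted Ω x q₁ q₂) :
    ⟪q₁ x - q₂ x, q₁ x - x⟫ = ‖q₁ x - q₂ x‖ ^ 2 / 2 := by
  have h1 := norm_sub_sq_real (q₁ x - x) (q₂ x - x)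
  rw [sub_sub_sub_cancel_right, ← h.norm_sub_eq] at h1
  have h2 : q₁ x - q₂ x = (q₁ x - x) - (q₂ x - x) := by abel
  rw [h1]
  nth_rewrite 1 [h2]
  rw [inner_sub_left, real_inner_self_eq_norm_sq, real_inner_comm]
  ring

theorem IsTwoSheeted.inner_sub_pos (h : IsTwoSheeted Ω x q₁ q₂) :
    0 < ⟪q₁ x - q₂ x, q₁ x - x⟫ := by
  rw [h.inner_sub_eq]
  have := norm_pos_iff.2 (sub_ne_zero.2 h.ne)
  positivity

/-- The function whose zero set is the medial axis near a point with two sheets. -/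
noncomputable def sheetGap (q₁ q₂ : Ambient n → Ambient n) (w : Ambient n) : ℝ :=
  ‖q₁ w - w‖ ^ 2 - ‖q₂ w - w‖ ^ 2

theorem smoothNear_sheetGap (h₁ : SmoothNear q₁ x) (h₂ : SmoothNear q₂ x) :
    SmoothNear (sheetGap q₁ q₂) x := by
  filter_upwards [h₁, h₂] with w h1 h2
  exact ((h1.sub contDiffAt_id).norm_sq ℝ).sub ((h2.sub contDiffAt_id).norm_sq ℝ)

theorem IsSheet.hasFDerivAt_norm_sq {B : Set (Ambient n)} (h : IsSheet B y u q) :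
    HasFDerivAt (fun w => ‖q w - w‖ ^ 2) ((-2 : ℝ) • innerSL ℝ (q u - u)) u := by
  refine (h.smooth.hasFDerivAt.sub (hasFDerivAt_id u)).norm_sq.congr_fderiv ?_
  ext v
  have := h.orth.self_of_nhds v
  rw [inner_sub_left] at this
  simp
  linarith

theorem IsTwoSheeted.hasFDerivAt_sheetGap (h : IsTwoSheeted Ω x q₁ q₂) :
    HasFDerivAt (sheetGap q₁ q₂) ((-2 : ℝ) • innerSL ℝ (q₁ x - q₂ x)) x := by
  refine (h.sheet₁.hasFDerivAt_norm_sq.sub h.sheet₂.hasFDerivAt_norm_sq).congr_fderiv ?_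
  rw [← smul_sub, ← map_sub, sub_sub_sub_cancel_right]

theorem IsEdgeCornerPoint.not_mem_interior {k : ℕ} (hk : 1 ≤ k) (h : IsEdgeCornerPoint Ω k x) :
    x ∉ interior Ω := by
  obtain ⟨-, φ, hφ, hΩ⟩ := h
  intro hx
  have h0 : ∀ᶠ w in 𝓝 x, 0 ≤ φ w 0 := by
    filter_upwards [mem_interior_iff_mem_nhds.1 hx, φ.open_source.mem_nhds hφ.mem_source]
      with w h1 h2
    exact (hΩ w h2).1 h1 0 hk
  have h1 : IsLocalMin (fun w => φ w 0) x := by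
    filter_upwards [h0] with w hw
    rw [hφ.map_zero]
    exact hw
  obtain ⟨v, hv⟩ := hφ.fderiv_surjective hφ.mem_source (EuclideanSpace.single 0 1)
  have h2 := hφ.fderiv_coord hφ.mem_source 0 v
  rw [h1.fderiv_eq_zero, hv] at h2
  simp at h2

theorem mem_medialAxis_iff_of_mem_interior (hx : x ∈ interior Ω) :
    x ∈ medialAxis Ω ↔ x ∈ interiorMedialAxis Ω :=
  ⟨fun h => h.resolve_right fun ⟨_, hk, h⟩ => h.not_mem_interior (by omega) hx, Or.inl⟩

theorem genericPoints_subset : genericPoints Ω ⊆ interiorMedialAxis Ω := by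
  rintro x ⟨hx, y₁, y₂, hne, hcl, -⟩
  exact ⟨hx, Or.inl (by rw [hcl]; exact nontrivial_pair hne)⟩

/-- Near a point with two sheets the medial axis is the set where the sheets are equally far, and
the two sheets persist along it. -/
theorem IsTwoSheeted.eventually_medialAxis (hΩ : IsRegion Ω) (h : IsTwoSheeted Ω x q₁ q₂) :
    ∀ᶠ w in 𝓝 x, (w ∈ medialAxis Ω ↔ sheetGap q₁ q₂ w = 0) ∧
      (w ∈ medialAxis Ω → IsTwoSheeted Ω w q₁ q₂) := by
  have hcl := hΩ.eventually_closestPoints_sheet (u := x) (ι := Bool)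
    (y := fun b => cond b (q₁ x) (q₂ x)) (q := fun b => cond b q₁ q₂)
    (fun b => by cases b; exacts [h.sheet₂, h.sheet₁]) (by
      rw [h.closest]
      rintro b (rfl | rfl)
      exacts [⟨true, rfl⟩, ⟨false, rfl⟩])
  have hne : ∀ᶠ w in 𝓝 x, q₁ w ≠ q₂ w := by
    have : ContinuousAt (fun w => (q₁ w, q₂ w)) x :=
      h.sheet₁.smooth.continuousAt.prodMk h.sheet₂.smooth.continuousAt
    exact this.eventually ((isOpen_ne_fun continuous_fst continuous_snd).mem_nhds h.ne)
  filter_upwards [hcl, hne, isOpen_interior.mem_nhds h.mem_interior, h.sheet₁.eventually,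
    h.sheet₂.eventually,
    (continuousAt_sheetJacobian h.sheet₁.smooth h.radial_ne_zero).eventually_const_lt h.jacobian_pos₁,
    (continuousAt_sheetJacobian h.sheet₂.smooth h.symm.radial_ne_zero).eventually_const_lt
      h.jacobian_pos₂] with w hcl hne hint hs₁ hs₂ hj₁ hj₂
  have hsub : closestPoints Ω w ⊆ {q₁ w, q₂ w} := by
    intro b hb
    obtain ⟨i, hi⟩ := hcl b hb
    cases i
    exacts [Or.inr hi, Or.inl hi]
  have hd : ∀ y : Ambient n, ‖y - w‖ = dist w y := fun y => by rw [dist_comm, dist_eq_norm]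
  have hgap : sheetGap q₁ q₂ w = 0 ↔ dist w (q₁ w) = dist w (q₂ w) := by
    rw [sheetGap, hd, hd, sub_eq_zero, sq_eq_sq₀ dist_nonneg dist_nonneg]
  -- no other points can be closest, so equally far sheets are both closest
  have hpair : sheetGap q₁ q₂ w = 0 → closestPoints Ω w = {q₁ w, q₂ w} := by
    intro h0
    rw [hgap] at h0
    refine Subset.antisymm hsub ?_
    obtain ⟨b, hb⟩ := hΩ.closestPoints_nonempty w
    have h1 : q₁ w ∈ closestPoints Ω w ∧ q₂ w ∈ closestPoints Ω w := by
      rcases hsub hb with rfl | hb'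
      · exact ⟨hb, hs₂.mem.self_of_nhds, h0 ▸ hb.2⟩
      · rw [mem_singleton_iff] at hb'
        subst hb'
        exact ⟨⟨hs₁.mem.self_of_nhds, h0 ▸ hb.2⟩, hb⟩
    rintro b (rfl | rfl)
    exacts [h1.1, h1.2]
  have hiff : w ∈ medialAxis Ω ↔ sheetGap q₁ q₂ w = 0 := by
    rw [mem_medialAxis_iff_of_mem_interior hint]
    refine ⟨fun hw => ?_, fun h0 => ⟨hint, Or.inl ?_⟩⟩
    · rw [hgap]
      rcases hw.2 with hnt | ⟨b, hb, hdeg⟩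
      · obtain ⟨a, ha, b, hb, hab⟩ := hnt
        rcases hsub ha with rfl | ha' <;> rcases hsub hb with rfl | hb'
        · exact absurd rfl hab
        · rw [mem_singleton_iff] at hb'
          subst hb'
          rw [ha.2, hb.2]
        · rw [mem_singleton_iff] at ha'
          subst ha'
          rw [ha.2, hb.2]
        · exact absurd (ha'.trans hb'.symm) hab
      · rcases hsub hb with rfl | hb'
        · exact absurd hdeg hs₁.not_isDegenerateAt.self_of_nhds
        · rw [mem_singleton_iff] at hb'
          subst hb'
          exact absurd hdeg hs₂.not_isDegenerateAt.self_of_nhds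
    · rw [hpair h0]
      exact nontrivial_pair hne
  exact ⟨hiff, fun hw => ⟨hint, hne, hpair (hiff.1 hw), hs₁, hs₂, hj₁, hj₂⟩⟩

theorem IsTwoSheeted.mem_medialAxis (h : IsTwoSheeted Ω x q₁ q₂) : x ∈ medialAxis Ω :=
  Or.inl (genericPoints_subset h.mem_genericPoints)

theorem IsTwoSheeted.mem_regularPart (hΩ : IsRegion Ω) (h : IsTwoSheeted Ω x q₁ q₂) :
    x ∈ regularPart Ω := by
  refine ⟨h.mem_medialAxis, sheetGap q₁ q₂, smoothNear_sheetGap h.sheet₁.smooth h.sheet₂.smooth,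
    ?_, (h.eventually_medialAxis hΩ).mono fun w hw => hw.1⟩
  rw [h.hasFDerivAt_sheetGap.fderiv]
  intro h0
  have h1 := congrArg (fun L => L (q₁ x - x)) h0
  have h2 := h.inner_sub_pos
  simp at h1
  rw [inner_sub_left, h1] at h2
  simp at h2

/-- The tangent space of the medial axis at a point with two sheets is the orthogonal complement
of the difference of the two radial vectors. -/
theorem IsTwoSheeted.medialTangentSpace_eq (hΩ : IsRegion Ω) (h : IsTwoSheeted Ω x q₁ q₂) :
    medialTangentSpace Ω x = (Submodule.span ℝ {q₁ x - q₂ x})ᗮ := by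
  have hM := h.eventually_medialAxis hΩ
  have hF := h.hasFDerivAt_sheetGap
  have hFs := smoothNear_sheetGap h.sheet₁.smooth h.sheet₂.smooth
  obtain ⟨F', hF', hFd⟩ : ∃ F', F' = (-2 : ℝ) • innerSL ℝ (q₁ x - q₂ x) ∧
      HasFDerivAt (sheetGap q₁ q₂) F' x := ⟨_, rfl, hF⟩
  have hmem : ∀ v, v ∈ (Submodule.span ℝ {q₁ x - q₂ x})ᗮ ↔ F' v = 0 := by
    intro v
    rw [Submodule.mem_orthogonal_singleton_iff_inner_right, hF']
    simp [inner_sub_left]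
  have hx0 : sheetGap q₁ q₂ x = 0 := hM.self_of_nhds.1.1 h.mem_medialAxis
  refine le_antisymm (Submodule.span_le.2 fun v hv => ?_) ?_
  · rw [SetLike.mem_coe, hmem]
    have h1 : HasFDerivWithinAt (sheetGap q₁ q₂) (0 : Ambient n →L[ℝ] ℝ) (medialAxis Ω) x := by
      refine (hasFDerivWithinAt_const (0 : ℝ) x _).congr_of_eventuallyEq ?_ hx0
      filter_upwards [mem_nhdsWithin_of_mem_nhds hM, self_mem_nhdsWithin] with w hw hwM
      exact hw.1.1 hwM
    exact hFd.hasFDerivWithinAt.unique_on h1 hv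
  · obtain ⟨-, F, hFsm, hF0, hFM⟩ := h.mem_regularPart hΩ
    have hFx : F x = 0 := hFM.self_of_nhds.1 h.mem_medialAxis
    obtain ⟨γ, hγ⟩ := exists_isLocalParam_of_level hFsm hFx hF0 hFM
    -- a parametrization gives as many tangent directions as the dimension allows
    set R := LinearMap.range (fderiv ℝ γ 0 : EuclideanSpace ℝ (Fin n) →ₗ[ℝ] Ambient n) with hR
    have hRdim : Module.finrank ℝ R = n := by
      rw [hR, LinearMap.finrank_range_of_inj hγ.immersion, finrank_euclideanSpace_fin]
    have hRcone : (R : Set (Ambient n)) ⊆ tangentConeAt ℝ (medialAxis Ω) x := by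
      rintro _ ⟨z, rfl⟩
      have h0 : z ∈ tangentConeAt ℝ {z | γ z ∈ medialAxis Ω} 0 := by
        have : {z | γ z ∈ medialAxis Ω} ∈ 𝓝 (0 : EuclideanSpace ℝ (Fin n)) := hγ.eventually_mem
        rw [tangentConeAt_of_mem_nhds this]
        trivial
      have h1 := (hγ.smooth.hasFDerivAt.hasFDerivWithinAt
        (s := {z | γ z ∈ medialAxis Ω})).mapsTo_tangent_cone h0
      rw [hγ.map_zero] at h1
      exact tangentConeAt_mono (image_subset_iff.2 fun z hz => hz) h1
    have hRle : R ≤ (Submodule.span ℝ {q₁ x - q₂ x})ᗮ := by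
      intro v hv
      rw [hmem]
      have h1 : HasFDerivWithinAt (sheetGap q₁ q₂) (0 : Ambient n →L[ℝ] ℝ) (medialAxis Ω) x := by
        refine (hasFDerivWithinAt_const (0 : ℝ) x _).congr_of_eventuallyEq ?_ hx0
        filter_upwards [mem_nhdsWithin_of_mem_nhds hM, self_mem_nhdsWithin] with w hw hwM
        exact hw.1.1 hwM
      exact hFd.hasFDerivWithinAt.unique_on h1 (hRcone hv)
    have hdim : Module.finrank ℝ (Submodule.span ℝ {q₁ x - q₂ x})ᗮ = n := by
      have : Fact (Module.finrank ℝ (Ambient n) = n + 1) := ⟨finrank_euclideanSpace_fin⟩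
      exact Submodule.finrank_orthogonal_span_singleton (sub_ne_zero.2 h.ne)
    rw [← Submodule.eq_of_le_of_finrank_eq hRle (hRdim.trans hdim.symm)]
    exact fun v hv => Submodule.subset_span (hRcone hv)

theorem isCompl_orthogonal_span_singleton_of_inner_ne_zero {m U : Ambient n} (h : ⟪m, U⟫ ≠ 0) :
    IsCompl (Submodule.span ℝ {m})ᗮ (Submodule.span ℝ {U}) := by
  refine ⟨?_, ?_⟩
  · rw [Submodule.disjoint_def]
    intro v hv hvU
    obtain ⟨c, rfl⟩ := Submodule.mem_span_singleton.1 hvU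
    rw [Submodule.mem_orthogonal_singleton_iff_inner_right, inner_smul_right] at hv
    rw [(mul_eq_zero.1 hv).resolve_right h, zero_smul]
  · rw [codisjoint_iff, Submodule.eq_top_iff']
    intro v
    refine Submodule.mem_sup.2 ⟨v - (⟪m, v⟫ / ⟪m, U⟫) • U, ?_, (⟪m, v⟫ / ⟪m, U⟫) • U,
      Submodule.smul_mem _ _ (Submodule.mem_span_singleton_self U), sub_add_cancel _ _⟩
    rw [Submodule.mem_orthogonal_singleton_iff_inner_right, inner_sub_right, inner_smul_right]
    field_simp
    ring

theorem IsTwoSheeted.isCompl (hΩ : IsRegion Ω) (h : IsTwoSheeted Ω x q₁ q₂) :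
    IsCompl (medialTangentSpace Ω x) (Submodule.span ℝ {q₁ x - x}) := by
  rw [h.medialTangentSpace_eq hΩ]
  exact isCompl_orthogonal_span_singleton_of_inner_ne_zero h.inner_sub_pos.ne'

theorem IsTwoSheeted.mem_radialVectors_iff (h : IsTwoSheeted Ω x q₁ q₂) {U : Ambient n} :
    U ∈ radialVectors Ω x ↔ U = q₁ x - x ∨ U = q₂ x - x := by
  simp only [radialVectors, mem_ofPred_eq, h.closest, mem_insert_iff, mem_singleton_iff]
  rw [eq_sub_iff_add_eq', eq_sub_iff_add_eq']

/-- A smooth value of the radial vector field agrees along the medial axis with a sheet. -/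
theorem IsTwoSheeted.eventually_eq_of_isSmoothValue (hΩ : IsRegion Ω) (h : IsTwoSheeted Ω x q₁ q₂)
    {V : Ambient n → Ambient n} (hV : IsSmoothValue Ω (x, q₁ x - x) V) :
    V =ᶠ[𝓝[medialAxis Ω] x] fun w => q₁ w - w := by
  obtain ⟨hVs, hVx, hVr⟩ := hV
  have hne : ∀ᶠ w in 𝓝 x, V w ≠ q₂ w - w := by
    have h1 : ContinuousAt (fun w => (V w, q₂ w - w)) x :=
      hVs.continuousAt.prodMk (h.sheet₂.smooth.continuousAt.sub continuousAt_id)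
    refine h1.eventually ((isOpen_ne_fun continuous_fst continuous_snd).mem_nhds ?_)
    simp only [mem_ofPred_eq, hVx]
    exact fun h0 => h.ne (sub_left_injective h0)
  filter_upwards [hVr, mem_nhdsWithin_of_mem_nhds hne,
    mem_nhdsWithin_of_mem_nhds (h.eventually_medialAxis hΩ), self_mem_nhdsWithin] with w h1 h2 h3 h4
  exact ((h3.2 h4).mem_radialVectors_iff.1 h1).resolve_right h2

/-- Up to the projection along `U`, the operator `I - r S_rad` is the derivative of the sheet, so
that its determinant is the determinant of the derivative of the sheet extended by the identity on
the line of `U`. -/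
theorem IsTwoSheeted.radialJacobian_eq (hΩ : IsRegion Ω) (h : IsTwoSheeted Ω x q₁ q₂) :
    radialJacobian Ω (x, q₁ x - x) = sheetJacobian q₁ x := by
  have hcompl := h.isCompl hΩ
  have hex : ∃ V, IsSmoothValue Ω (x, q₁ x - x) V := by
    refine ⟨fun w => q₁ w - w, h.sheet₁.smooth.sub (smoothNear_of_contDiff contDiff_id _), rfl, ?_⟩
    filter_upwards [mem_nhdsWithin_of_mem_nhds (h.eventually_medialAxis hΩ), self_mem_nhdsWithin]
      with w h1 h2
    exact (h1.2 h2).mem_radialVectors_iff.2 (Or.inl rfl)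
  have hfield : unitRadialField Ω (x, q₁ x - x) =
      fun w => ‖hex.choose w‖⁻¹ • hex.choose w := dif_pos hex
  have hV := hex.choose_spec
  set V := hex.choose
  have hVx : V x = q₁ x - x := hV.2.1
  have hVd : HasFDerivAt V (fderiv ℝ V x) x := SmoothNear.hasFDerivAt hV.1
  -- `V` and `q₁ - id` agree along the medial axis only, so their derivatives agree on its tangent
  -- space
  have hVq : ∀ t ∈ medialTangentSpace Ω x, fderiv ℝ V x t = fderiv ℝ q₁ x t - t := by
    have h1 : HasFDerivWithinAt V (fderiv ℝ q₁ x - ContinuousLinearMap.id ℝ (Ambient n))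
        (medialAxis Ω) x :=
      (h.sheet₁.smooth.hasFDerivAt.sub (hasFDerivAt_id x)).hasFDerivWithinAt.congr_of_eventuallyEq
        (h.eventually_eq_of_isSmoothValue hΩ hV) hVx
    have h2 : EqOn (fderiv ℝ V x : Ambient n →ₗ[ℝ] Ambient n)
        ((fderiv ℝ q₁ x - ContinuousLinearMap.id ℝ (Ambient n) : Ambient n →L[ℝ] Ambient n) :
          Ambient n →ₗ[ℝ] Ambient n) (tangentConeAt ℝ (medialAxis Ω) x) :=
      hVd.hasFDerivWithinAt.unique_on h1
    exact fun t ht => LinearMap.eqOn_span h2 ht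
  have hnorm : ∃ d : Ambient n →L[ℝ] ℝ, HasFDerivAt (fun w => ‖V w‖⁻¹) d x := by
    have h1 : DifferentiableAt ℝ (fun w => ‖V w‖⁻¹) x :=
      (hVd.differentiableAt.norm ℝ (by rw [hVx]; exact h.radial_ne_zero)).inv (by
        rw [hVx]; exact norm_ne_zero_iff.2 h.radial_ne_zero)
    exact ⟨_, h1.hasFDerivAt⟩
  obtain ⟨d, hd⟩ := hnorm
  -- normalizing `V` adds to its derivative a multiple of `U`, which the projection kills
  have hu : ∀ t, fderiv ℝ (unitRadialField Ω (x, q₁ x - x)) x t =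
      ‖q₁ x - x‖⁻¹ • fderiv ℝ V x t + d t • (q₁ x - x) := by
    intro t
    have h1 : HasFDerivAt (fun w => ‖V w‖⁻¹ • V w) _ x := hd.smul hVd
    rw [hfield, h1.fderiv, hVx]
    rfl
  have hS : LinearMap.id - ‖q₁ x - x‖ • radialShapeOperator Ω (x, q₁ x - x) =
      (medialTangentSpace Ω x).projectionOnto (Submodule.span ℝ {q₁ x - x}) hcompl ∘ₗ
        (fderiv ℝ q₁ x : Ambient n →ₗ[ℝ] Ambient n) ∘ₗ (medialTangentSpace Ω x).subtype := by
    ext1 t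
    have h1 : radialShapeOperator Ω (x, q₁ x - x) t =
        -(medialTangentSpace Ω x).projectionOnto (Submodule.span ℝ {q₁ x - x}) hcompl
          (fderiv ℝ (unitRadialField Ω (x, q₁ x - x)) x (t : Ambient n)) := by
      have : projAlong (medialTangentSpace Ω x) (q₁ x - x) =
        (medialTangentSpace Ω x).projectionOnto (Submodule.span ℝ {q₁ x - x}) hcompl :=
          dif_pos hcompl
      rw [← this]
      rfl
    have h2 : (medialTangentSpace Ω x).projectionOnto (Submodule.span ℝ {q₁ x - x}) hcompl
        (t : Ambient n) = t := Submodule.projectionOnto_apply_left hcompl t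
    have h3 : (medialTangentSpace Ω x).projectionOnto (Submodule.span ℝ {q₁ x - x}) hcompl
        (q₁ x - x) = 0 := Submodule.projectionOnto_apply_of_mem_right hcompl
          (Submodule.mem_span_singleton_self _)
    have h4 : ‖q₁ x - x‖ ≠ 0 := norm_ne_zero_iff.2 h.radial_ne_zero
    change t - ‖q₁ x - x‖ • radialShapeOperator Ω (x, q₁ x - x) t =
      (medialTangentSpace Ω x).projectionOnto (Submodule.span ℝ {q₁ x - x}) hcompl
        (fderiv ℝ q₁ x (t : Ambient n))
    rw [h1, hu, hVq t t.2, map_add, map_smul, map_smul, h3, smul_zero, add_zero, smul_neg,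
      smul_smul, mul_inv_cancel₀ h4, one_smul, map_sub, h2]
    abel
  unfold radialJacobian
  simp only [hS]
  exact det_projectionOnto_comp h.radial_ne_zero h.sheet₁.ker.self_of_nhds hcompl

theorem IsTwoSheeted.normalDensity_eq (hΩ : IsRegion Ω) (h : IsTwoSheeted Ω x q₁ q₂) :
    normalDensity Ω (x, q₁ x - x) = ‖q₁ x - q₂ x‖ / (2 * ‖q₁ x - x‖) := by
  have h1 : q₁ x - q₂ x ≠ 0 := sub_ne_zero.2 h.ne
  unfold normalDensity
  simp only [h.medialTangentSpace_eq hΩ, Submodule.orthogonal_orthogonal]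
  rw [Submodule.starProjection_singleton, inner_smul_right, h.inner_sub_eq, norm_smul]
  have h2 := norm_ne_zero_iff.2 h1
  have h3 := norm_ne_zero_iff.2 h.radial_ne_zero
  simp
  field_simp

/-- The volume distortion of a sheet along the medial axis. -/
theorem IsTwoSheeted.normDet_eq (hΩ : IsRegion Ω) (h : IsTwoSheeted Ω x q₁ q₂) :
    ((fderiv ℝ q₁ x : Ambient n →ₗ[ℝ] Ambient n) ∘ₗ (medialTangentSpace Ω x).subtype).normDet =
      sheetJacobian q₁ x * normalDensity Ω (x, q₁ x - x) := by
  rw [normDet_comp_subtype h.radial_ne_zero h.sheet₁.orth.self_of_nhds (h.isCompl hΩ),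
    det_projectionOnto_comp h.radial_ne_zero h.sheet₁.ker.self_of_nhds]
  change |sheetJacobian q₁ x| * normalDensity Ω (x, q₁ x - x) = _
  rw [abs_of_pos h.jacobian_pos₁]

end GenericPoints

/-! ### The set of non-generic points -/

section NonGenericPairs

variable {n : ℕ} {Ω : Set (Ambient n)} {x u : Ambient n}

theorem surjective_prod_inner {a b : Ambient n} (h : LinearIndependent ℝ ![a, b]) :
    Function.Surjective ((innerSL ℝ a).prod (innerSL ℝ b)) := by
  have hab : ∀ s t : ℝ, s • a + t • b = 0 → s = 0 ∧ t = 0 := LinearIndependent.pair_iff.1 h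
  have hdet : ⟪a, a⟫ * ⟪b, b⟫ - ⟪a, b⟫ * ⟪a, b⟫ ≠ 0 := by
    intro h0
    have h1 : ‖⟪a, b⟫ • a - ⟪a, a⟫ • b‖ ^ 2 = 0 := by
      rw [← real_inner_self_eq_norm_sq, inner_sub_left, inner_sub_right, inner_sub_right]
      simp only [inner_smul_left, inner_smul_right, conj_trivial, real_inner_comm a b]
      linear_combination ⟪a, a⟫ * h0
    rw [sq_eq_zero_iff, norm_eq_zero] at h1
    have h2 := hab ⟪a, b⟫ (-⟪a, a⟫) (by rw [neg_smul, ← sub_eq_add_neg]; exact h1)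
    have h3 : a = 0 := by simpa using h2.2
    have := hab 1 0 (by simp [h3])
    simp at this
  rintro ⟨s, t⟩
  -- Cramer's rule for the Gram matrix
  refine ⟨((s * ⟪b, b⟫ - t * ⟪a, b⟫) / (⟪a, a⟫ * ⟪b, b⟫ - ⟪a, b⟫ * ⟪a, b⟫)) • a +
    ((t * ⟪a, a⟫ - s * ⟪a, b⟫) / (⟪a, a⟫ * ⟪b, b⟫ - ⟪a, b⟫ * ⟪a, b⟫)) • b, ?_⟩
  refine Prod.ext ?_ ?_
  · change ⟪a, _⟫ = s
    rw [inner_add_right, inner_smul_right, inner_smul_right, div_mul_eq_mul_div,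
      div_mul_eq_mul_div, ← add_div, div_eq_iff hdet]
    ring
  · change ⟪b, _⟫ = t
    rw [inner_add_right, inner_smul_right, inner_smul_right, real_inner_comm a b,
      div_mul_eq_mul_div, div_mul_eq_mul_div, ← add_div, div_eq_iff hdet]
    ring

/-- Differences of three distinct vectors of the same length are independent. -/
theorem linearIndependent_sub_of_norm_eq {a b c : Ambient n} (hab : a ≠ b) (hac : a ≠ c)
    (hbc : b ≠ c) (h1 : ‖a‖ = ‖b‖) (h2 : ‖a‖ = ‖c‖) : LinearIndependent ℝ ![a - b, a - c] := by
  rw [LinearIndependent.pair_iff' (sub_ne_zero.2 hab)]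
  intro t ht
  have hc : c = a - t • (a - b) := by rw [ht]; abel
  have h3 : ‖c‖ ^ 2 = ‖a‖ ^ 2 - 2 * t * ⟪a, a - b⟫ + t ^ 2 * ‖a - b‖ ^ 2 := by
    rw [hc, norm_sub_sq_real, inner_smul_right, norm_smul, mul_pow, Real.norm_eq_abs, sq_abs]
    ring
  have h4 : ‖a - b‖ ^ 2 = 2 * ⟪a, a - b⟫ := by
    rw [norm_sub_sq_real, inner_sub_right, real_inner_self_eq_norm_sq, ← h1]
    ring
  rw [← h2] at h3
  have h5 : ‖a - b‖ ^ 2 ≠ 0 := pow_ne_zero _ (norm_ne_zero_iff.2 (sub_ne_zero.2 hab))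
  have h6 : t * (t - 1) = 0 := by
    have : (t * (t - 1)) * ‖a - b‖ ^ 2 = 0 := by linear_combination -h3 - t * h4
    exact (mul_eq_zero.1 this).resolve_right h5
  rcases mul_eq_zero.1 h6 with h7 | h7
  · rw [h7, zero_smul, sub_zero] at hc
    exact hac hc.symm
  · rw [sub_eq_zero.1 h7, one_smul, sub_sub_cancel] at hc
    exact hbc hc.symm

/-- Points with three distinct nondegenerate closest points, together with these. -/
def nondegenerateTriples (Ω : Set (Ambient n)) :
    Set (Ambient n × Ambient n × Ambient n × Ambient n) :=
  {p | p.1 ∈ interior Ω ∧ (p.2.1 ≠ p.2.2.1 ∧ p.2.1 ≠ p.2.2.2 ∧ p.2.2.1 ≠ p.2.2.2) ∧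
    (p.2.1 ∈ closestPoints Ω p.1 ∧ p.2.2.1 ∈ closestPoints Ω p.1 ∧
      p.2.2.2 ∈ closestPoints Ω p.1) ∧
    ¬ IsDegenerateAt (frontier Ω) p.1 p.2.1 ∧ ¬ IsDegenerateAt (frontier Ω) p.1 p.2.2.1 ∧
    ¬ IsDegenerateAt (frontier Ω) p.1 p.2.2.2}

/-- Three sheets are equally far on a set of codimension two. -/
theorem IsRegion.hausdorffMeasure_nondegenerateTriples (hΩ : IsRegion Ω) :
    μH[n] (nondegenerateTriples Ω) = 0 := by
  refine measure_null_of_locally_null _ ?_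
  rintro ⟨x, y₁, y₂, y₃⟩ ⟨hx, ⟨h12, h13, h23⟩, ⟨hy₁, hy₂, hy₃⟩, hd₁, hd₂, hd₃⟩
  simp only at hx h12 h13 h23 hy₁ hy₂ hy₃ hd₁ hd₂ hd₃
  obtain ⟨q₁, hq₁, -⟩ := hΩ.exists_isSheet hx hy₁ hd₁
  obtain ⟨q₂, hq₂, -⟩ := hΩ.exists_isSheet hx hy₂ hd₂
  obtain ⟨q₃, hq₃, -⟩ := hΩ.exists_isSheet hx hy₃ hd₃
  have hgap : ∀ {y y' u : Ambient n}, y ∈ closestPoints Ω u → y' ∈ closestPoints Ω u →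
      ‖y - u‖ = ‖y' - u‖ := by
    intro y y' u hy hy'
    rw [← dist_eq_norm, ← dist_eq_norm, dist_comm, hy.2, dist_comm, hy'.2]
  have hsg : ∀ {q q' : Ambient n → Ambient n} {u : Ambient n}, q u ∈ closestPoints Ω u →
      q' u ∈ closestPoints Ω u → sheetGap q q' u = 0 := by
    intro q q' u hy hy'
    rw [sheetGap, hgap hy hy', sub_self]
  have hd12 : HasFDerivAt (sheetGap q₁ q₂) ((-2 : ℝ) • innerSL ℝ (y₁ - y₂)) x := by
    refine (hq₁.hasFDerivAt_norm_sq.sub hq₂.hasFDerivAt_norm_sq).congr_fderiv ?_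
    rw [← smul_sub, ← map_sub, sub_sub_sub_cancel_right, hq₁.map_base, hq₂.map_base]
  have hd13 : HasFDerivAt (sheetGap q₁ q₃) ((-2 : ℝ) • innerSL ℝ (y₁ - y₃)) x := by
    refine (hq₁.hasFDerivAt_norm_sq.sub hq₃.hasFDerivAt_norm_sq).congr_fderiv ?_
    rw [← smul_sub, ← map_sub, sub_sub_sub_cancel_right, hq₁.map_base, hq₃.map_base]
  have hs12 := smoothNear_sheetGap hq₁.smooth hq₂.smooth
  have hs13 := smoothNear_sheetGap hq₁.smooth hq₃.smooth
  have hstrict := hs12.hasStrictFDerivAt.prodMk hs13.hasStrictFDerivAt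
  rw [hd12.fderiv, hd13.fderiv] at hstrict
  -- three distinct points of a sphere are not collinear, so the two gaps are independent
  have hsurj : Function.Surjective (((-2 : ℝ) • innerSL ℝ (y₁ - y₂)).prod
      ((-2 : ℝ) • innerSL ℝ (y₁ - y₃))) := by
    have hli := linearIndependent_sub_of_norm_eq (a := y₁ - x) (b := y₂ - x) (c := y₃ - x)
      (fun h => h12 (sub_left_injective h)) (fun h => h13 (sub_left_injective h))
      (fun h => h23 (sub_left_injective h)) (hgap hy₁ hy₂) (hgap hy₁ hy₃)
    rw [sub_sub_sub_cancel_right, sub_sub_sub_cancel_right] at hli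
    intro p
    obtain ⟨v, hv⟩ := surjective_prod_inner hli p
    refine ⟨(-2 : ℝ)⁻¹ • v, ?_⟩
    rw [← hv]
    refine Prod.ext ?_ ?_ <;> simp [inner_smul_right] <;> ring
  obtain ⟨N, hN, hnull⟩ := exists_nhds_hausdorffMeasure_level_null (d := n) hstrict hsurj
    (by simp; omega)
  have h0 : sheetGap q₁ q₂ x = 0 ∧ sheetGap q₁ q₃ x = 0 :=
    ⟨hsg (by rwa [hq₁.map_base]) (by rwa [hq₂.map_base]),
      hsg (by rwa [hq₁.map_base]) (by rwa [hq₃.map_base])⟩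
  have hsm : {w | SmoothNear q₁ w ∧ SmoothNear q₂ w ∧ SmoothNear q₃ w} ∈ 𝓝 x :=
    hq₁.smooth.eventually.and (hq₂.smooth.eventually.and hq₃.smooth.eventually)
  have himg := hausdorffMeasure_image_null (f := fun w => (w, q₁ w, q₂ w, q₃ w))
    (Nat.cast_nonneg n) (hnull (N ∩ ({w | SmoothNear q₁ w ∧ SmoothNear q₂ w ∧ SmoothNear q₃ w} ∩
      {w | sheetGap q₁ q₂ w = 0 ∧ sheetGap q₁ q₃ w = 0})) inter_subset_left
      (fun w hw => by simp only [hw.2.2.1, hw.2.2.2, h0.1, h0.2])) (fun w hw => by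
      have h1 : ContDiffAt ℝ 1 q₁ w := hw.2.1.1.contDiffAt.of_le (by simp)
      have h2 : ContDiffAt ℝ 1 q₂ w := hw.2.1.2.1.contDiffAt.of_le (by simp)
      have h3 : ContDiffAt ℝ 1 q₃ w := hw.2.1.2.2.contDiffAt.of_le (by simp)
      exact contDiffAt_id.prodMk (h1.prodMk (h2.prodMk h3)))
  have ht1 : Tendsto (fun p : Ambient n × Ambient n × Ambient n × Ambient n => (p.2.1, p.1))
      (𝓝 (x, y₁, y₂, y₃)) (𝓝 (y₁, x)) :=
    (by fun_prop : Continuous fun p : Ambient n × Ambient n × Ambient n × Ambient n =>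
      (p.2.1, p.1)).tendsto _
  have ht2 : Tendsto (fun p : Ambient n × Ambient n × Ambient n × Ambient n => (p.2.2.1, p.1))
      (𝓝 (x, y₁, y₂, y₃)) (𝓝 (y₂, x)) :=
    (by fun_prop : Continuous fun p : Ambient n × Ambient n × Ambient n × Ambient n =>
      (p.2.2.1, p.1)).tendsto _
  have ht3 : Tendsto (fun p : Ambient n × Ambient n × Ambient n × Ambient n => (p.2.2.2, p.1))
      (𝓝 (x, y₁, y₂, y₃)) (𝓝 (y₃, x)) :=
    (by fun_prop : Continuous fun p : Ambient n × Ambient n × Ambient n × Ambient n =>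
      (p.2.2.2, p.1)).tendsto _
  have hev := (ht1.eventually hq₁.eq_of_closest).and ((ht2.eventually hq₂.eq_of_closest).and
    ((ht3.eventually hq₃.eq_of_closest).and (continuousAt_fst.eventually (inter_mem hN hsm))))
  refine ⟨_, inter_mem_nhdsWithin _ hev, measure_mono_null ?_ himg⟩
  rintro ⟨w, b₁, b₂, b₃⟩ ⟨⟨-, -, ⟨hb₁, hb₂, hb₃⟩, -⟩, he₁, he₂, he₃, hw⟩
  simp only at hb₁ hb₂ hb₃ he₁ he₂ he₃
  have e₁ := he₁ hb₁.1 (mem_closestPoints_iff.1 hb₁).2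
  have e₂ := he₂ hb₂.1 (mem_closestPoints_iff.1 hb₂).2
  have e₃ := he₃ hb₃.1 (mem_closestPoints_iff.1 hb₃).2
  subst e₁ e₂ e₃
  exact ⟨w, ⟨hw.1, hw.2, hsg hb₁ hb₂, hsg hb₁ hb₃⟩, rfl⟩

/-- Along a sheet, the pairs over points with a degenerate closest point are an image of these
degenerate pairs. -/
theorem IsRegion.hausdorffMeasure_sheet_over_degenerate (hΩ : IsRegion Ω) :
    μH[n] {p : Ambient n × Ambient n × Ambient n | p.2 ∈ versalDegeneratePairs (frontier Ω) ∧
      p.2.2 ∈ interior Ω ∧ p.1 ∈ closestPoints Ω p.2.2 ∧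
      ¬ IsDegenerateAt (frontier Ω) p.2.2 p.1} = 0 := by
  refine measure_null_of_locally_null _ ?_
  rintro ⟨y, b, u⟩ ⟨-, hu, hy, hnd⟩
  simp only at hu hy hnd
  obtain ⟨q, hq, -⟩ := hΩ.exists_isSheet hu hy hnd
  have himg := hausdorffMeasure_image_null (f := fun p : Ambient n × Ambient n => (q p.2, p))
    (Nat.cast_nonneg n) (measure_mono_null (inter_subset_left (t := {p | SmoothNear q p.2}))
      (hausdorffMeasure_versalDegeneratePairs (frontier Ω))) (fun p hp => by
      have h1 : ContDiffAt ℝ 1 q p.2 := hp.2.contDiffAt.of_le (by simp)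
      exact (ContDiffAt.comp (g := q) p h1 contDiffAt_snd).prodMk contDiffAt_id)
  have ht : Tendsto (fun p : Ambient n × Ambient n × Ambient n => (p.1, p.2.2))
      (𝓝 (y, b, u)) (𝓝 (y, u)) :=
    (by fun_prop : Continuous fun p : Ambient n × Ambient n × Ambient n =>
      (p.1, p.2.2)).tendsto _
  have hev := (ht.eventually hq.eq_of_closest).and
    ((continuousAt_snd.comp continuousAt_snd).eventually hq.smooth.eventually :
      ∀ᶠ p : Ambient n × Ambient n × Ambient n in 𝓝 (y, b, u), SmoothNear q p.2.2)
  refine ⟨_, inter_mem_nhdsWithin _ hev, measure_mono_null ?_ himg⟩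
  rintro ⟨y', p⟩ ⟨⟨hp, -, hy', -⟩, he, hs⟩
  simp only at hp hy' he hs
  have e := he hy'.1 (mem_closestPoints_iff.1 hy').2
  subst e
  exact ⟨p, ⟨hp, hs⟩, rfl⟩

/-- Up to a null set of pairs, the medial axis points and their closest points are generic. -/
theorem IsRegion.hausdorffMeasure_nongeneric_pairs (hΩ : IsRegion Ω) (hn : 0 < n)
    (hB : HasGenericBlumMedialAxis Ω) :
    μH[n] {p : Ambient n × Ambient n | p.2 ∈ interiorMedialAxis Ω ∧ p.1 ∈ closestPoints Ω p.2 ∧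
      p.2 ∉ genericPoints Ω} = 0 := by
  obtain ⟨E, hE, hE1, hV⟩ := hB
  have hn' : (0 : ℝ) < n := by exact_mod_cast hn
  have := Measure.nullSingletonClass_hausdorff (Ambient n × Ambient n) hn'
  have h1 : μH[n] {p : Ambient n × Ambient n | p.2 ∈ E ∧ p.1 ∈ closestPoints Ω p.2} = 0 := by
    refine Set.Finite.measure_zero ?_ _
    choose! y hy using hE1
    refine (hE.image fun u => (y u, u)).subset ?_
    rintro ⟨b, u⟩ ⟨hu, hb⟩
    rw [hy u hu] at hb
    exact ⟨u, hu, Prod.ext (mem_singleton_iff.1 hb).symm rfl⟩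
  have h2 := hausdorffMeasure_versalDegeneratePairs (frontier Ω)
  have h3 := hausdorffMeasure_image_null
    (f := fun p : Ambient n × Ambient n × Ambient n => (p.1, p.2.2)) (Nat.cast_nonneg n)
    hΩ.hausdorffMeasure_sheet_over_degenerate (fun p _ => by fun_prop)
  have h4 := hausdorffMeasure_image_null
    (f := fun p : Ambient n × Ambient n × Ambient n × Ambient n => (p.2.1, p.1))
    (Nat.cast_nonneg n) hΩ.hausdorffMeasure_nondegenerateTriples (fun p _ => by fun_prop)
  refine measure_mono_null ?_ (measure_union_null (measure_union_null h1 h2)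
    (measure_union_null h3 h4))
  -- either `u` is exceptional, or `y` is degenerate, or another closest point is, or there are
  -- three nondegenerate ones
  rintro ⟨y, u⟩ ⟨hu, hy, hng⟩
  simp only at hu hy hng
  by_cases huE : u ∈ E
  · exact Or.inl (Or.inl ⟨huE, hy⟩)
  have hvd : ∀ b ∈ closestPoints Ω u, IsDegenerateAt (frontier Ω) u b →
      (b, u) ∈ versalDegeneratePairs (frontier Ω) := fun b hb hd =>
    ⟨(mem_closestPoints_iff.1 hb).2, hd, hV u ⟨hu, huE⟩ {b} (Finset.singleton_nonempty b)
      (by simpa using hb)⟩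
  by_cases hd : IsDegenerateAt (frontier Ω) u y
  · exact Or.inl (Or.inr (hvd y hy hd))
  by_cases hall : ∃ b ∈ closestPoints Ω u, IsDegenerateAt (frontier Ω) u b
  · obtain ⟨b, hb, hbd⟩ := hall
    exact Or.inr (Or.inl ⟨(y, b, u), ⟨hvd b hb hbd, hu.1, hy, hd⟩, rfl⟩)
  have hnt : (closestPoints Ω u).Nontrivial := hu.2.resolve_right hall
  push Not at hall
  obtain ⟨b, hb, hby⟩ := hnt.exists_ne y
  have hne : ¬ closestPoints Ω u ⊆ {y, b} := fun hsub => hng ⟨hu.1, y, b, hby.symm,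
    Subset.antisymm hsub (by rintro c (rfl | rfl); exacts [hy, hb]), hd, hall b hb⟩
  obtain ⟨c, hc, hc'⟩ := not_subset.1 hne
  simp only [mem_insert_iff, mem_singleton_iff, not_or] at hc'
  exact Or.inr (Or.inr ⟨(u, y, b, c), ⟨hu.1, ⟨hby.symm, Ne.symm hc'.1, Ne.symm hc'.2⟩,
    ⟨hy, hb, hc⟩, hd, hall b hb, hall c hc⟩, rfl⟩)

theorem IsRegion.hausdorffMeasure_nongeneric_points (hΩ : IsRegion Ω) (hn : 0 < n)
    (hB : HasGenericBlumMedialAxis Ω) :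
    μH[n] (interiorMedialAxis Ω \ genericPoints Ω) = 0 := by
  refine measure_mono_null ?_ (hausdorffMeasure_image_null (f := Prod.snd) (Nat.cast_nonneg n)
    (hΩ.hausdorffMeasure_nongeneric_pairs hn hB) (fun p _ => by fun_prop))
  rintro u ⟨hu, hng⟩
  obtain ⟨y, hy⟩ := hΩ.closestPoints_nonempty u
  exact ⟨(y, u), ⟨hu, hy, hng⟩, rfl⟩

/-- Almost every boundary point is a closest point of a generic medial axis point. -/
theorem IsRegion.hausdorffMeasure_not_closest_to_generic (hΩ : IsRegion Ω) (hn : 0 < n)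
    (hB : HasGenericBlumMedialAxis Ω) :
    μH[n] (frontier Ω \ {y | ∃ u ∈ genericPoints Ω, y ∈ closestPoints Ω u}) = 0 := by
  refine measure_mono_null ?_ (measure_union_null hΩ.hausdorffMeasure_not_smooth
    (hausdorffMeasure_image_null (f := Prod.fst) (Nat.cast_nonneg n)
      (hΩ.hausdorffMeasure_nongeneric_pairs hn hB) (fun p _ => by fun_prop)))
  rintro y ⟨hy, hng⟩
  by_cases hs : IsSmoothBoundaryPoint Ω y
  · obtain ⟨u, hu, hyu⟩ := hΩ.exists_mem_interiorMedialAxis hy hs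
    exact Or.inr ⟨(y, u), ⟨hu, hyu, fun h => hng ⟨u, h, hyu⟩⟩, rfl⟩
  · exact Or.inl ⟨hy, hs⟩

end NonGenericPairs

/-! ### The medial measure -/

section MedialMeasure

variable {n : ℕ} {Ω : Set (Ambient n)} {x u : Ambient n} {q₁ q₂ : Ambient n → Ambient n}

/-- The part of the double of the medial axis over the generic points. -/
def genericDouble (Ω : Set (Ambient n)) : Set (Ambient n × Ambient n) :=
  {p | p.1 ∈ genericPoints Ω ∧ p.2 ∈ radialVectors Ω p.1}

/-- A set which is locally the zero set of a continuous function is locally closed. -/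
theorem measurableSet_of_eventually_iff {X : Type*} [TopologicalSpace X] [MeasurableSpace X]
    [BorelSpace X] {s : Set X}
    (h : ∀ x ∈ s, ∃ F : X → ℝ, ∀ᶠ w in 𝓝 x, ContinuousAt F w ∧ (w ∈ s ↔ F w = 0)) :
    MeasurableSet s := by
  suffices hs : IsLocallyClosed s by
    obtain ⟨U, Z, hU, hZ, rfl⟩ := hs
    exact hU.measurableSet.inter hZ.measurableSet
  refine (isLocallyClosed_tfae s).out 0 3 |>.2 fun x hx => ?_
  obtain ⟨F, hF⟩ := h x hx
  obtain ⟨V, hV, hVo, hxV⟩ := eventually_nhds_iff.1 hF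
  refine ⟨V, hxV, hVo, ?_⟩
  rintro w ⟨hw, hws⟩
  rw [(hV w hw).2]
  by_contra hne
  have h1 : ∀ᶠ z in 𝓝 w, z ∉ s := by
    filter_upwards [(hV w hw).1.eventually_ne hne, hVo.mem_nhds hw] with z hz hzV hzs
    exact hz ((hV z hzV).2.1 hzs)
  exact (mem_closure_iff_frequently.1 hws) h1

theorem IsRegion.exists_isTwoSheeted_of_mem (hΩ : IsRegion Ω) (hx : x ∈ genericPoints Ω) :
    ∃ q₁ q₂, IsTwoSheeted Ω x q₁ q₂ := by
  obtain ⟨hi, y₁, y₂, hne, hcl, h₁, h₂⟩ := hx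
  obtain ⟨q₁, q₂, h, -⟩ := hΩ.exists_isTwoSheeted hi hne hcl h₁ h₂
  exact ⟨q₁, q₂, h⟩

theorem IsRegion.measurableSet_genericPoints (hΩ : IsRegion Ω) :
    MeasurableSet (genericPoints Ω) := by
  refine measurableSet_of_eventually_iff fun x hx => ?_
  obtain ⟨q₁, q₂, h⟩ := hΩ.exists_isTwoSheeted_of_mem hx
  refine ⟨sheetGap q₁ q₂, ?_⟩
  filter_upwards [(smoothNear_sheetGap h.sheet₁.smooth h.sheet₂.smooth).eventually,
    h.eventually_medialAxis hΩ] with w h1 h2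
  exact ⟨h1.continuousAt, fun hw => h2.1.1 (Or.inl (genericPoints_subset hw)),
    fun hw => (h2.2 (h2.1.2 hw)).mem_genericPoints⟩

theorem measurableSet_regularPart : MeasurableSet (regularPart Ω) := by
  refine measurableSet_of_eventually_iff fun x hx => ?_
  obtain ⟨-, F, hF, hF', hM⟩ := hx
  refine ⟨F, ?_⟩
  filter_upwards [hF.eventually, hF.fderiv.continuousAt.eventually_ne hF', hM.eventually_nhds]
    with w h1 h2 h3
  exact ⟨h1.continuousAt, fun hw => h3.self_of_nhds.1 hw.1,
    fun hw => ⟨h3.self_of_nhds.2 hw, F, h1, h2, h3⟩⟩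

theorem IsRegion.measurableSet_genericDouble (hΩ : IsRegion Ω) :
    MeasurableSet (genericDouble Ω) :=
  (measurable_fst hΩ.measurableSet_genericPoints).inter
    (isClosed_setOf_mem_closestPoints (f := fun p : Ambient n × Ambient n => p.1)
      (g := fun p => p.1 + p.2) continuous_fst (by fun_prop)).measurableSet

theorem IsRegion.injOn_radialMap (hΩ : IsRegion Ω) : InjOn radialMap (genericDouble Ω) := by
  rintro ⟨u, U⟩ ⟨hu, hU⟩ ⟨w, W⟩ ⟨hw, hW⟩ h
  have h' : u + U = w + W := h
  have hU' : u + U ∈ closestPoints Ω u := hU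
  have hW' : w + W ∈ closestPoints Ω w := hW
  have e : u = w := hΩ.unique_of_mem_closestPoints (genericPoints_subset hu)
    (genericPoints_subset hw) hU' (h' ▸ hW')
  subst e
  rw [add_left_cancel h']

theorem IsRegion.exists_isTwoSheeted_of_mem_genericDouble (hΩ : IsRegion Ω)
    {p : Ambient n × Ambient n} (hp : p ∈ genericDouble Ω) :
    ∃ q₁ q₂, IsTwoSheeted Ω p.1 q₁ q₂ ∧ p.2 = q₁ p.1 - p.1 := by
  obtain ⟨q₁, q₂, h⟩ := hΩ.exists_isTwoSheeted_of_mem hp.1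
  rcases h.mem_radialVectors_iff.1 hp.2 with h1 | h1
  exacts [⟨q₁, q₂, h, h1⟩, ⟨q₂, q₁, h.symm, h1⟩]

/-- Near a point of the generic double, the double is the graph of a sheet. -/
theorem IsTwoSheeted.eventually_genericDouble (hΩ : IsRegion Ω) (h : IsTwoSheeted Ω x q₁ q₂) :
    ∀ᶠ p in 𝓝 (x, q₁ x - x), p ∈ genericDouble Ω →
      IsTwoSheeted Ω p.1 q₁ q₂ ∧ p.2 = q₁ p.1 - p.1 := by
  have hne : ∀ᶠ p : Ambient n × Ambient n in 𝓝 (x, q₁ x - x), p.2 ≠ q₂ p.1 - p.1 := by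
    have h1 : ContinuousAt (fun p : Ambient n × Ambient n => (p.2, q₂ p.1 - p.1))
        (x, q₁ x - x) :=
      continuousAt_snd.prodMk ((ContinuousAt.comp (g := q₂) h.sheet₂.smooth.continuousAt
        continuousAt_fst).sub continuousAt_fst)
    refine h1.eventually ((isOpen_ne_fun continuous_fst continuous_snd).mem_nhds ?_)
    exact fun h0 => h.ne (sub_left_injective h0)
  filter_upwards [hne, continuousAt_fst.eventually (h.eventually_medialAxis hΩ)] with p h1 h2 hp
  have h3 := h2.2 (Or.inl (genericPoints_subset hp.1))
  exact ⟨h3, (h3.mem_radialVectors_iff.1 hp.2).resolve_right h1⟩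

/-- The sum of the point masses at the pairs `(x, U)`, for the values `U` of the radial vector
field at `x`, with weights `u · n`.  The medial measure is the integral of these measures over the
regular part of the medial axis. -/
noncomputable def medialKernel (Ω : Set (Ambient n)) (x : Ambient n) :
    Measure (Ambient n × Ambient n) :=
  Measure.sum fun U : radialVectors Ω x =>
    ENNReal.ofReal (normalDensity Ω (x, (U : Ambient n))) • Measure.dirac (x, (U : Ambient n))

theorem medialKernel_apply (A : Set (Ambient n × Ambient n)) (hA : MeasurableSet A) :
    medialKernel Ω x A = ∑' U : radialVectors Ω x,
      ENNReal.ofReal (normalDensity Ω (x, (U : Ambient n))) * A.indicator 1 (x, (U : Ambient n)) := by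
  rw [medialKernel, Measure.sum_apply _ hA]
  refine tsum_congr fun U => ?_
  rw [Measure.smul_apply, Measure.dirac_apply' _ hA, smul_eq_mul]

theorem medialKernel_apply_eq_zero {A : Set (Ambient n × Ambient n)} (hA : MeasurableSet A)
    (h : ∀ U ∈ radialVectors Ω x, (x, U) ∉ A) : medialKernel Ω x A = 0 := by
  rw [medialKernel_apply A hA, ENNReal.tsum_eq_zero]
  intro U
  rw [indicator_of_notMem (h U U.2), mul_zero]

theorem IsTwoSheeted.medialKernel_apply (h : IsTwoSheeted Ω x q₁ q₂)
    {A : Set (Ambient n × Ambient n)} (hA : MeasurableSet A) :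
    medialKernel Ω x A =
      ENNReal.ofReal (normalDensity Ω (x, q₁ x - x)) * A.indicator 1 (x, q₁ x - x) +
      ENNReal.ofReal (normalDensity Ω (x, q₂ x - x)) * A.indicator 1 (x, q₂ x - x) := by
  classical
  have hset : radialVectors Ω x = (({q₁ x - x, q₂ x - x} : Finset (Ambient n)) :
      Set (Ambient n)) := by
    ext U
    simp [h.mem_radialVectors_iff]
  rw [BlumLinking.medialKernel_apply A hA, tsum_congr_set_coe (fun U =>
    ENNReal.ofReal (normalDensity Ω (x, U)) * A.indicator 1 (x, U)) hset]
  refine (Finset.tsum_subtype' ({q₁ x - x, q₂ x - x} : Finset (Ambient n)) fun U =>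
    ENNReal.ofReal (normalDensity Ω (x, U)) * A.indicator 1 (x, U)).trans ?_
  rw [Finset.sum_pair fun h0 => h.ne (sub_left_injective h0)]

theorem medialKernel_eq_zero {k : ℕ} (hk : 2 ≤ k)
    (hx : IsEdgeCornerPoint Ω k x) : medialKernel Ω x = 0 := by
  have hxΩ : x ∈ Ω := by
    obtain ⟨-, φ, hφ, h⟩ := hx
    refine (h x hφ.mem_source).2 fun j _ => ?_
    rw [hφ.map_zero]
    exact le_rfl
  have hxB : x ∈ frontier Ω := ⟨subset_closure hxΩ, hx.not_mem_interior (by omega)⟩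
  -- the only closest point of a boundary point is the point itself, and the density vanishes there
  refine Measure.measure_univ_eq_zero.1 ?_
  rw [medialKernel_apply _ MeasurableSet.univ, ENNReal.tsum_eq_zero]
  rintro ⟨U, hU⟩
  have h1 := (mem_closestPoints_iff.1 hU).2 x hxB
  rw [dist_self, dist_eq_norm, sub_add_cancel_left, norm_neg] at h1
  have h2 : U = 0 := norm_le_zero_iff.1 h1
  subst h2
  simp [normalDensity]

theorem IsRegion.ae_mem_genericPoints (hΩ : IsRegion Ω) (hn : 0 < n)
    (hB : HasGenericBlumMedialAxis Ω) :
    ∀ᵐ x ∂((Measure.euclideanHausdorffMeasure n).restrict (regularPart Ω)),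
      x ∈ genericPoints Ω ∨ medialKernel Ω x = 0 := by
  rw [ae_restrict_iff' measurableSet_regularPart]
  have h0 := euclideanHausdorffMeasure_eq_zero_iff.2 (hΩ.hausdorffMeasure_nongeneric_points hn hB)
  rw [measure_eq_zero_iff_ae_notMem] at h0
  filter_upwards [h0] with x hx hreg
  rcases hreg.1 with h1 | ⟨k, hk, h1⟩
  · by_contra hcon
    rw [not_or] at hcon
    exact hx ⟨h1, hcon.1⟩
  · exact Or.inr (medialKernel_eq_zero hk h1)

theorem measurable_smul_dirac_add :
    Measurable fun p : (ℝ≥0∞ × (Ambient n × Ambient n)) × (ℝ≥0∞ × (Ambient n × Ambient n)) =>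
      p.1.1 • Measure.dirac p.1.2 + p.2.1 • Measure.dirac p.2.2 := by
  refine Measure.measurable_of_measurable_coe _ fun s hs => ?_
  simp only [Measure.add_apply, Measure.smul_apply, Measure.dirac_apply' _ hs, smul_eq_mul]
  have h1 : Measurable (s.indicator (1 : Ambient n × Ambient n → ℝ≥0∞)) :=
    measurable_one.indicator hs
  fun_prop

theorem IsRegion.aemeasurable_medialKernel (hΩ : IsRegion Ω) (hn : 0 < n)
    (hB : HasGenericBlumMedialAxis Ω) :
    AEMeasurable (medialKernel Ω)
      ((Measure.euclideanHausdorffMeasure n).restrict (regularPart Ω)) := by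
  have hloc : ∀ x ∈ genericPoints Ω, ∃ N ∈ 𝓝[genericPoints Ω] x, MeasurableSet N ∧
      N ⊆ genericPoints Ω ∧
      AEMeasurable (medialKernel Ω) ((Measure.euclideanHausdorffMeasure n).restrict N) := by
    intro x hx
    obtain ⟨q₁, q₂, h⟩ := hΩ.exists_isTwoSheeted_of_mem hx
    have hev := (h.eventually_medialAxis hΩ).and
      (h.sheet₁.smooth.eventually.and h.sheet₂.smooth.eventually)
    obtain ⟨V, hV, hVo, hxV⟩ := eventually_nhds_iff.1 hev
    have hts : ∀ w ∈ V ∩ genericPoints Ω, IsTwoSheeted Ω w q₁ q₂ := fun w hw =>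
      (hV w hw.1).1.2 (Or.inl (genericPoints_subset hw.2))
    have hmeas : MeasurableSet (V ∩ genericPoints Ω) :=
      hVo.measurableSet.inter hΩ.measurableSet_genericPoints
    refine ⟨V ∩ genericPoints Ω, inter_mem (mem_nhdsWithin_of_mem_nhds (hVo.mem_nhds hxV))
      self_mem_nhdsWithin, hmeas, inter_subset_right, ?_⟩
    have hc₁ : ContinuousOn q₁ (V ∩ genericPoints Ω) := fun w hw =>
      (hV w hw.1).2.1.continuousAt.continuousWithinAt
    have hc₂ : ContinuousOn q₂ (V ∩ genericPoints Ω) := fun w hw =>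
      (hV w hw.1).2.2.continuousAt.continuousWithinAt
    have hd : ∀ {q q' : Ambient n → Ambient n}, ContinuousOn q (V ∩ genericPoints Ω) →
        ContinuousOn q' (V ∩ genericPoints Ω) →
        (∀ w ∈ V ∩ genericPoints Ω, IsTwoSheeted Ω w q q') →
        ContinuousOn (fun w => (ENNReal.ofReal (normalDensity Ω (w, q w - w)), (w, q w - w)))
          (V ∩ genericPoints Ω) := by
      intro q q' hq hq' hqq
      have h1 : ContinuousOn (fun w => ‖q w - q' w‖ / (2 * ‖q w - w‖)) (V ∩ genericPoints Ω) :=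
        (hq.sub hq').norm.div (continuousOn_const.mul (hq.sub continuousOn_id).norm)
          fun w hw => mul_ne_zero two_ne_zero (norm_ne_zero_iff.2 (hqq w hw).radial_ne_zero)
      refine (ENNReal.continuous_ofReal.comp_continuousOn ?_).prodMk
        (continuousOn_id.prodMk (hq.sub continuousOn_id))
      exact h1.congr fun w hw => (hqq w hw).normalDensity_eq hΩ
    -- near `x` the kernel is a sum of two point masses which depend continuously on the point
    have h1 := measurable_smul_dirac_add.comp_aemeasurable
      (((hd hc₁ hc₂ hts).prodMk (hd hc₂ hc₁ fun w hw => (hts w hw).symm)).aemeasurable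
        (μ := Measure.euclideanHausdorffMeasure n) hmeas)
    refine h1.congr ((ae_restrict_iff' hmeas).2 (Eventually.of_forall fun w hw => ?_))
    ext A hA
    rw [(hts w hw).medialKernel_apply hA]
    simp [Measure.dirac_apply' _ hA]
  choose! N hN hNm hNs hNa using hloc
  obtain ⟨t, ht, htc, hcov⟩ := TopologicalSpace.countable_cover_nhdsWithin hN
  have hU : ⋃ x ∈ t, N x = genericPoints Ω :=
    Subset.antisymm (iUnion₂_subset fun x hx => hNs x (ht hx)) hcov
  have h1 : AEMeasurable (medialKernel Ω)
      ((Measure.euclideanHausdorffMeasure n).restrict (genericPoints Ω)) := by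
    rw [← hU, biUnion_eq_iUnion]
    have := htc.to_subtype
    exact aemeasurable_iUnion_iff.2 fun x => hNa x (ht x.2)
  have h2 := (aemeasurable_indicator_iff (μ := Measure.euclideanHausdorffMeasure n)
    hΩ.measurableSet_genericPoints).2 h1
  refine (h2.mono_measure Measure.restrict_le_self).congr ?_
  filter_upwards [hΩ.ae_mem_genericPoints hn hB] with x hx
  by_cases hxg : x ∈ genericPoints Ω
  · rw [indicator_of_mem hxg]
  · rw [indicator_of_notMem hxg, hx.resolve_left hxg]

theorem IsRegion.medialMeasure_apply (hΩ : IsRegion Ω) (hn : 0 < n)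
    (hB : HasGenericBlumMedialAxis Ω) {A : Set (Ambient n × Ambient n)} (hA : MeasurableSet A) :
    medialMeasure Ω A =
      ∫⁻ x in regularPart Ω, medialKernel Ω x A ∂(Measure.euclideanHausdorffMeasure n) :=
  Measure.bind_apply hA (hΩ.aemeasurable_medialKernel hn hB)

theorem IsRegion.ae_mem_genericDouble (hΩ : IsRegion Ω) (hn : 0 < n)
    (hB : HasGenericBlumMedialAxis Ω) : ∀ᵐ p ∂(medialMeasure Ω), p ∈ genericDouble Ω := by
  change medialMeasure Ω (genericDouble Ω)ᶜ = 0
  have hm := hΩ.measurableSet_genericDouble.compl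
  rw [hΩ.medialMeasure_apply hn hB hm]
  refine lintegral_eq_zero_of_ae_eq_zero ?_
  filter_upwards [hΩ.ae_mem_genericPoints hn hB] with x hx
  rcases hx with hx | hx
  · exact medialKernel_apply_eq_zero hm fun U hU => not_not.2 ⟨hx, hU⟩
  · rw [hx]; rfl

end MedialMeasure

/-! ### Change of variables by the radial map -/

section ChangeOfVariables

variable {n : ℕ} {Ω : Set (Ambient n)} {x u : Ambient n} {q₁ q₂ : Ambient n → Ambient n}

theorem eventually_le_mul_of_continuousAt {X : Type*} [TopologicalSpace X] {f : X → ℝ} {a : X}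
    (hf : ContinuousAt f a) (ha : 0 < f a) {c : ℝ} (hc : 1 < c) :
    ∀ᶠ w in 𝓝 a, f w ≤ c * f a ∧ f a ≤ c * f w := by
  have h1 : f a < c * f a := lt_mul_of_one_lt_left ha hc
  have h2 : ContinuousAt (fun w => c * f w) a := continuousAt_const.mul hf
  filter_upwards [hf.eventually (gt_mem_nhds h1), h2.eventually (lt_mem_nhds h1)] with w h3 h4
  exact ⟨h3.le, h4.le⟩

theorem IsTwoSheeted.normalDensity_pos (hΩ : IsRegion Ω) (h : IsTwoSheeted Ω x q₁ q₂) :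
    0 < normalDensity Ω (x, q₁ x - x) := by
  rw [h.normalDensity_eq hΩ]
  have h1 := norm_pos_iff.2 h.radial_ne_zero
  have h2 := norm_pos_iff.2 (sub_ne_zero.2 h.ne)
  positivity

/-- Near a point of the generic double, the medial measure is the volume of the medial axis, up to
the nearly constant factor `u · n`. -/
theorem IsTwoSheeted.exists_nhds_medialMeasure_le (hΩ : IsRegion Ω) (hn : 0 < n)
    (hB : HasGenericBlumMedialAxis Ω) (h : IsTwoSheeted Ω x q₁ q₂) {c : ℝ} (hc : 1 < c) :
    ∃ N ∈ 𝓝 (x, q₁ x - x), ∀ A ⊆ genericDouble Ω ∩ N, MeasurableSet A →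
      medialMeasure Ω A ≤ ENNReal.ofReal c * (ENNReal.ofReal (normalDensity Ω (x, q₁ x - x)) *
        (Measure.euclideanHausdorffMeasure n) (Prod.fst '' A)) ∧
      ENNReal.ofReal (normalDensity Ω (x, q₁ x - x)) *
        (Measure.euclideanHausdorffMeasure n) (Prod.fst '' A) ≤
          ENNReal.ofReal c * medialMeasure Ω A := by
  have hc0 : 0 ≤ c := by linarith
  have hcont : ContinuousAt (fun w => ‖q₁ w - q₂ w‖ / (2 * ‖q₁ w - w‖)) x :=
    (h.sheet₁.smooth.continuousAt.sub h.sheet₂.smooth.continuousAt).norm.div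
      (continuousAt_const.mul (h.sheet₁.smooth.continuousAt.sub continuousAt_id).norm)
      (mul_ne_zero two_ne_zero (norm_ne_zero_iff.2 h.radial_ne_zero))
  have hpos := h.normalDensity_pos hΩ
  rw [h.normalDensity_eq hΩ] at hpos
  have hratio := (continuousAt_fst (p := (x, q₁ x - x))).eventually
    (eventually_le_mul_of_continuousAt hcont hpos hc)
  rw [← h.normalDensity_eq hΩ] at hratio
  refine ⟨_, (h.eventually_genericDouble hΩ).and hratio, fun A hA hAm => ?_⟩
  have hgraph : ∀ p ∈ A, IsTwoSheeted Ω p.1 q₁ q₂ ∧ p.2 = q₁ p.1 - p.1 := fun p hp =>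
    (hA hp).2.1 (hA hp).1
  have hinj : InjOn Prod.fst A := fun p hp p' hp' e =>
    Prod.ext e (by rw [(hgraph p hp).2, (hgraph p' hp').2, e])
  have hD : MeasurableSet (Prod.fst '' A) :=
    hAm.image_of_continuousOn_injOn continuous_fst.continuousOn hinj
  have hDreg : Prod.fst '' A ⊆ regularPart Ω := by
    rintro _ ⟨p, hp, rfl⟩
    exact (hgraph p hp).1.mem_regularPart hΩ
  -- only one of the two point masses of the kernel can lie in `A`
  have hker : ∀ w, medialKernel Ω w A = (Prod.fst '' A).indicator
      (fun w => ENNReal.ofReal (normalDensity Ω (w, q₁ w - w))) w := by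
    intro w
    by_cases hw : w ∈ Prod.fst '' A
    · rw [indicator_of_mem hw]
      obtain ⟨⟨w, U⟩, hp, rfl⟩ := hw
      obtain ⟨ht, hU⟩ := hgraph _ hp
      simp only at hU ht ⊢
      subst hU
      have h2 : (w, q₂ w - w) ∉ A := fun h2 =>
        ht.ne (sub_left_injective (hgraph _ h2).2).symm
      rw [ht.medialKernel_apply hAm, indicator_of_mem hp, indicator_of_notMem h2]
      simp
    · rw [indicator_of_notMem hw]
      exact medialKernel_apply_eq_zero hAm fun U _ hU => hw ⟨_, hU, rfl⟩
  have hform : medialMeasure Ω A = ∫⁻ w in Prod.fst '' A,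
      ENNReal.ofReal (normalDensity Ω (w, q₁ w - w)) ∂(Measure.euclideanHausdorffMeasure n) := by
    rw [hΩ.medialMeasure_apply hn hB hAm]
    simp_rw [hker]
    rw [lintegral_indicator hD, Measure.restrict_restrict hD, inter_eq_left.2 hDreg]
  have hnd : ∀ w ∈ Prod.fst '' A, normalDensity Ω (w, q₁ w - w) ≤
      c * normalDensity Ω (x, q₁ x - x) ∧ normalDensity Ω (x, q₁ x - x) ≤
      c * normalDensity Ω (w, q₁ w - w) := by
    rintro _ ⟨p, hp, rfl⟩
    have h1 := (hA hp).2.2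
    rwa [← (hgraph p hp).1.normalDensity_eq hΩ] at h1
  rw [hform]
  constructor
  · refine (setLIntegral_mono' hD fun w hw => ENNReal.ofReal_le_ofReal (hnd w hw).1).trans_eq ?_
    rw [setLIntegral_const, ENNReal.ofReal_mul hc0, mul_assoc]
  · rw [← setLIntegral_const, ← lintegral_const_mul' _ _ ENNReal.ofReal_ne_top]
    refine setLIntegral_mono' hD fun w hw => ?_
    rw [← ENNReal.ofReal_mul hc0]
    exact ENNReal.ofReal_le_ofReal (hnd w hw).2

theorem norm_sub_starProjection_orthogonal_singleton {V : Type*} [NormedAddCommGroup V]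
    [InnerProductSpace ℝ V] (m d : V) :
    ‖d - (Submodule.span ℝ {m})ᗮ.starProjection d‖ * ‖m‖ = |⟪m, d⟫| := by
  by_cases hm : m = 0
  · simp [hm]
  have hm' : ‖m‖ ≠ 0 := norm_ne_zero_iff.2 hm
  have h1 : d - (Submodule.span ℝ {m})ᗮ.starProjection d =
      (Submodule.span ℝ {m}).starProjection d := by
    rw [Submodule.starProjection_orthogonal_val, sub_sub_cancel]
  rw [h1, Submodule.starProjection_singleton, norm_smul, norm_div]
  simp
  field_simp

/-- Secants of the medial axis near a generic point are nearly tangent. -/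
theorem IsTwoSheeted.exists_nhds_secant (hΩ : IsRegion Ω) (h : IsTwoSheeted Ω x q₁ q₂)
    {ε : ℝ} (hε : 0 < ε) :
    ∃ N ∈ 𝓝 x, ∀ w ∈ medialAxis Ω ∩ N, ∀ w' ∈ medialAxis Ω ∩ N,
      ‖(w - w') - (medialTangentSpace Ω x).starProjection (w - w')‖ ≤ ε * ‖w - w'‖ := by
  have hne := norm_pos_iff.2 (sub_ne_zero.2 h.ne)
  have hs : HasStrictFDerivAt (sheetGap q₁ q₂) ((-2 : ℝ) • innerSL ℝ (q₁ x - q₂ x)) x := by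
    rw [← h.hasFDerivAt_sheetGap.fderiv]
    exact (smoothNear_sheetGap h.sheet₁.smooth h.sheet₂.smooth).self_of_nhds.hasStrictFDerivAt
      (by simp)
  obtain ⟨N, hN, hN'⟩ := exists_nhds_norm_sub_sub_le hs
    (show 0 < 2 * (ε * ‖q₁ x - q₂ x‖) by positivity)
  refine ⟨_, inter_mem hN (h.eventually_medialAxis hΩ), fun w hw w' hw' => ?_⟩
  have h1 := hN' w hw.2.1 w' hw'.2.1
  rw [hw.2.2.1.1 hw.1, hw'.2.2.1.1 hw'.1, sub_zero, zero_sub, norm_neg] at h1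
  have h2 : |⟪q₁ x - q₂ x, w - w'⟫| ≤ ε * ‖w - w'‖ * ‖q₁ x - q₂ x‖ := by
    rw [smul_apply, norm_smul, innerSL_apply_apply, Real.norm_eq_abs] at h1
    norm_num at h1
    linarith
  have h3 := h.medialTangentSpace_eq hΩ
  simp only [h3]
  rw [← norm_sub_starProjection_orthogonal_singleton] at h2
  exact le_of_mul_le_mul_right h2 hne

theorem IsTwoSheeted.exists_nhds_image_sheet (hΩ : IsRegion Ω) (h : IsTwoSheeted Ω x q₁ q₂)
    {c : ℝ} (hc : 1 < c) :
    ∃ N ∈ 𝓝 x, ∀ A ⊆ medialAxis Ω ∩ N,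
      (Measure.euclideanHausdorffMeasure n) (q₁ '' A) ≤
        ENNReal.ofReal (c * (sheetJacobian q₁ x * normalDensity Ω (x, q₁ x - x))) *
          (Measure.euclideanHausdorffMeasure n) A ∧
      ENNReal.ofReal (sheetJacobian q₁ x * normalDensity Ω (x, q₁ x - x)) *
          (Measure.euclideanHausdorffMeasure n) A ≤
        ENNReal.ofReal c * (Measure.euclideanHausdorffMeasure n) (q₁ '' A) := by
  have hpos : 0 < sheetJacobian q₁ x * normalDensity Ω (x, q₁ x - x) :=
    mul_pos h.jacobian_pos₁ (h.normalDensity_pos hΩ)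
  have hnd := h.normDet_eq hΩ
  have hrank : Module.finrank ℝ (medialTangentSpace Ω x) = n := by
    have : Fact (Module.finrank ℝ (Ambient n) = n + 1) := ⟨by simp⟩
    rw [h.medialTangentSpace_eq hΩ]
    exact Submodule.finrank_orthogonal_span_singleton (sub_ne_zero.2 h.ne)
  have hinj := ((LinearMap.normDet_ne_zero_tfae ((fderiv ℝ q₁ x : Ambient n →ₗ[ℝ] Ambient n) ∘ₗ
    (medialTangentSpace Ω x).subtype)).out 0 4).1 (hnd ▸ hpos.ne')
  rw [← hnd]
  refine euclideanHausdorffMeasure_image_near hrank (fun ε hε => h.exists_nhds_secant hΩ hε)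
    (h.sheet₁.smooth.self_of_nhds.hasStrictFDerivAt (by simp)) (fun v hv h0 => ?_) hc
  have := @hinj ⟨v, hv⟩ 0 (by simpa using h0)
  simpa using this

theorem genericDouble_subset_double :
    genericDouble Ω ⊆ double Ω := fun _ hp => ⟨Or.inl (genericPoints_subset hp.1), hp.2⟩

theorem continuous_radialMap : Continuous (radialMap (n := n)) := by
  unfold radialMap
  fun_prop

theorem IsRegion.continuousOn_radialJacobian (hΩ : IsRegion Ω) :
    ContinuousOn (radialJacobian Ω) (genericDouble Ω) := by
  rintro ⟨x, U⟩ hp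
  obtain ⟨q₁, q₂, h, hU⟩ := hΩ.exists_isTwoSheeted_of_mem_genericDouble hp
  simp only at h hU
  subst hU
  have h1 : ContinuousAt (fun p : Ambient n × Ambient n => sheetJacobian q₁ p.1) (x, q₁ x - x) :=
    ContinuousAt.comp (g := sheetJacobian q₁)
      (continuousAt_sheetJacobian h.sheet₁.smooth h.radial_ne_zero) continuousAt_fst
  refine h1.continuousWithinAt.congr_of_eventuallyEq ?_ (h.radialJacobian_eq hΩ)
  filter_upwards [mem_nhdsWithin_of_mem_nhds (h.eventually_genericDouble hΩ),
    self_mem_nhdsWithin] with p h2 h3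
  obtain ⟨h4, h5⟩ := h2 h3
  rw [← h4.radialJacobian_eq hΩ, ← h5]

theorem IsRegion.radialJacobian_pos (hΩ : IsRegion Ω) {p : Ambient n × Ambient n}
    (hp : p ∈ genericDouble Ω) : 0 < radialJacobian Ω p := by
  obtain ⟨q₁, q₂, h, hU⟩ := hΩ.exists_isTwoSheeted_of_mem_genericDouble hp
  obtain ⟨x, U⟩ := p
  simp only at h hU
  subst hU
  rw [h.radialJacobian_eq hΩ]
  exact h.jacobian_pos₁

/-- The change of variables formula for the radial map on the generic double. -/
theorem IsRegion.euclideanHausdorffMeasure_radialMap_image (hΩ : IsRegion Ω) (hn : 0 < n)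
    (hB : HasGenericBlumMedialAxis Ω) {A : Set (Ambient n × Ambient n)}
    (hA : A ⊆ genericDouble Ω) (hAm : MeasurableSet A) :
    (Measure.euclideanHausdorffMeasure n) (radialMap '' A) =
      ∫⁻ p in A, ENNReal.ofReal (radialJacobian Ω p) ∂(medialMeasure Ω) := by
  refine measure_image_eq_setLIntegral_of_local hΩ.injOn_radialMap
    (fun A hA hAm => hAm.image_of_continuousOn_injOn continuous_radialMap.continuousOn
      (hΩ.injOn_radialMap.mono hA)) (fun p hp c hc => ?_) hA hAm
  have hc0 : 0 ≤ c := by linarith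
  have hJ : ∃ N ∈ 𝓝 p, ∀ p' ∈ genericDouble Ω ∩ N, radialJacobian Ω p' ≤ c * radialJacobian Ω p ∧
      radialJacobian Ω p ≤ c * radialJacobian Ω p' := by
    have h1 : ContinuousAt ((genericDouble Ω).domRestrict (radialJacobian Ω)) ⟨p, hp⟩ :=
      (continuousOn_iff_continuous_domRestrict.1 hΩ.continuousOn_radialJacobian).continuousAt
    have h2 := eventually_le_mul_of_continuousAt h1 (hΩ.radialJacobian_pos hp) hc
    rw [nhds_subtype_eq_comap, eventually_comap] at h2
    exact ⟨_, h2, fun p' hp' => hp'.2 ⟨p', hp'.1⟩ rfl⟩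
  obtain ⟨N₀, hN₀, hJ⟩ := hJ
  obtain ⟨q₁, q₂, h, hU⟩ := hΩ.exists_isTwoSheeted_of_mem_genericDouble hp
  obtain ⟨x, U⟩ := p
  simp only at h hU
  subst hU
  -- the two distortion estimates are combined, each with the constant `√c`
  have hb : 1 < √c := Real.lt_sqrt_of_sq_lt (by simpa using hc)
  have hb0 : 0 ≤ √c := Real.sqrt_nonneg c
  have hbb : ENNReal.ofReal c = ENNReal.ofReal √c * ENNReal.ofReal √c := by
    rw [← ENNReal.ofReal_mul hb0, Real.mul_self_sqrt hc0]
  obtain ⟨N₁, hN₁, h₁⟩ := h.exists_nhds_medialMeasure_le hΩ hn hB hb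
  obtain ⟨N₂, hN₂, h₂⟩ := h.exists_nhds_image_sheet hΩ hb
  have hN₂' : Prod.fst ⁻¹' N₂ ∈ 𝓝 (x, q₁ x - x) := continuousAt_fst.preimage_mem_nhds hN₂
  refine ⟨N₀ ∩ (N₁ ∩ (Prod.fst ⁻¹' N₂ ∩ _)), inter_mem hN₀ (inter_mem hN₁ (inter_mem hN₂'
    (h.eventually_genericDouble hΩ))), fun p hp => ?_, fun A hA hAm => ?_⟩
  · rw [← ENNReal.ofReal_mul hc0, ← ENNReal.ofReal_mul hc0]
    have h3 := hJ p ⟨hp.1, hp.2.1⟩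
    exact ⟨ENNReal.ofReal_le_ofReal h3.1, ENNReal.ofReal_le_ofReal h3.2⟩
  have hgraph : ∀ p ∈ A, IsTwoSheeted Ω p.1 q₁ q₂ ∧ p.2 = q₁ p.1 - p.1 := fun p hp =>
    (hA hp).2.2.2.2 (hA hp).1
  have himage : radialMap '' A = q₁ '' (Prod.fst '' A) := by
    rw [image_image]
    refine image_congr fun p hp => ?_
    rw [radialMap, (hgraph p hp).2, add_sub_cancel]
  obtain ⟨h3, h4⟩ := h₁ A (fun p hp => ⟨(hA hp).1, (hA hp).2.2.1⟩) hAm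
  obtain ⟨h5, h6⟩ := h₂ (Prod.fst '' A) (by
    rintro _ ⟨p, hp, rfl⟩
    exact ⟨Or.inl (genericPoints_subset (hA hp).1.1), (hA hp).2.2.2.1⟩)
  rw [himage, h.radialJacobian_eq hΩ, hbb]
  rw [ENNReal.ofReal_mul hb0, ENNReal.ofReal_mul h.jacobian_pos₁.le] at h5
  rw [ENNReal.ofReal_mul h.jacobian_pos₁.le] at h6
  constructor
  · calc _ ≤ _ := h5
      _ = ENNReal.ofReal √c * (ENNReal.ofReal (sheetJacobian q₁ x) * (ENNReal.ofReal
          (normalDensity Ω (x, q₁ x - x)) *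
            (Measure.euclideanHausdorffMeasure n) (Prod.fst '' A))) := by ring
      _ ≤ ENNReal.ofReal √c * (ENNReal.ofReal (sheetJacobian q₁ x) *
          (ENNReal.ofReal √c * medialMeasure Ω A)) := by gcongr
      _ = _ := by ring
  · calc _ ≤ ENNReal.ofReal (sheetJacobian q₁ x) * (ENNReal.ofReal √c * (ENNReal.ofReal
          (normalDensity Ω (x, q₁ x - x)) *
            (Measure.euclideanHausdorffMeasure n) (Prod.fst '' A))) := by gcongr
      _ = ENNReal.ofReal √c * (ENNReal.ofReal (sheetJacobian q₁ x) * ENNReal.ofReal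
          (normalDensity Ω (x, q₁ x - x)) *
            (Measure.euclideanHausdorffMeasure n) (Prod.fst '' A)) := by ring
      _ ≤ ENNReal.ofReal √c * (ENNReal.ofReal √c *
          (Measure.euclideanHausdorffMeasure n) (q₁ '' (Prod.fst '' A))) := by gcongr
      _ = _ := by ring

theorem IsRegion.aemeasurable_radialJacobian (hΩ : IsRegion Ω) (hn : 0 < n)
    (hB : HasGenericBlumMedialAxis Ω) : AEMeasurable (radialJacobian Ω) (medialMeasure Ω) := by
  rw [← Measure.restrict_eq_self_of_ae_mem (hΩ.ae_mem_genericDouble hn hB)]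
  exact hΩ.continuousOn_radialJacobian.aemeasurable hΩ.measurableSet_genericDouble

/-- The radial map pushes the measure `det (I - r S_rad) dM` forward to the volume of the
boundary. -/
theorem IsRegion.map_radialMap_withDensity (hΩ : IsRegion Ω) (hn : 0 < n)
    (hB : HasGenericBlumMedialAxis Ω) :
    ((medialMeasure Ω).withDensity fun p => ENNReal.ofReal (radialJacobian Ω p)).map radialMap =
      (Measure.euclideanHausdorffMeasure n).restrict (frontier Ω) := by
  ext B hBm
  have hpre : MeasurableSet (radialMap ⁻¹' B) := continuous_radialMap.measurable hBm
  have hS := hΩ.measurableSet_genericDouble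
  have himg : radialMap '' genericDouble Ω =
      {y | ∃ u ∈ genericPoints Ω, y ∈ closestPoints Ω u} := by
    ext y
    constructor
    · rintro ⟨p, hp, rfl⟩
      exact ⟨p.1, hp.1, hp.2⟩
    · rintro ⟨u, hu, hy⟩
      refine ⟨(u, y - u), ⟨hu, ?_⟩, add_sub_cancel _ _⟩
      change u + (y - u) ∈ closestPoints Ω u
      rwa [add_sub_cancel]
  have himg' : radialMap '' genericDouble Ω ⊆ frontier Ω := by
    rintro _ ⟨p, hp, rfl⟩
    exact (mem_closestPoints_iff.1 hp.2).1
  have hnull := euclideanHausdorffMeasure_eq_zero_iff.2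
    (hΩ.hausdorffMeasure_not_closest_to_generic hn hB)
  rw [← himg] at hnull
  rw [Measure.map_apply continuous_radialMap.measurable hBm, withDensity_apply _ hpre,
    Measure.restrict_apply hBm]
  have h1 : (medialMeasure Ω).restrict (radialMap ⁻¹' B) =
      (medialMeasure Ω).restrict (genericDouble Ω ∩ radialMap ⁻¹' B) := by
    refine Measure.restrict_congr_set ?_
    filter_upwards [hΩ.ae_mem_genericDouble hn hB] with p hp
    exact propext ⟨fun h => ⟨hp, h⟩, fun h => h.2⟩
  rw [h1, ← hΩ.euclideanHausdorffMeasure_radialMap_image hn hB inter_subset_left (hS.inter hpre),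
    image_inter_preimage]
  refine le_antisymm (measure_mono fun y hy => ⟨hy.2, himg' hy.1⟩) ?_
  refine (measure_mono (t := (radialMap '' genericDouble Ω ∩ B) ∪
    (frontier Ω \ radialMap '' genericDouble Ω)) fun y hy => ?_).trans
      ((measure_union_le _ _).trans (by rw [hnull, add_zero]))
  by_cases hyS : y ∈ radialMap '' genericDouble Ω
  · exact Or.inl ⟨hyS, hy.1⟩
  · exact Or.inr ⟨hy.2, hyS⟩

theorem IsRegion.medialMeasure_restrict_double (hΩ : IsRegion Ω) (hn : 0 < n)
    (hB : HasGenericBlumMedialAxis Ω) :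
    (medialMeasure Ω).restrict (double Ω) = medialMeasure Ω :=
  Measure.restrict_eq_self_of_ae_mem ((hΩ.ae_mem_genericDouble hn hB).mono fun _ hp =>
    genericDouble_subset_double hp)

/-- The boundary integral of one region as a medial integral. -/
theorem IsRegion.integrableOn_and_setIntegral_frontier_eq (hΩ : IsRegion Ω) (hn : 0 < n)
    (hB : HasGenericBlumMedialAxis Ω) {g : Ambient n → ℝ}
    (hg : IntegrableOn g (frontier Ω) (Measure.euclideanHausdorffMeasure n)) :
    IntegrableOn (fun p => g (radialMap p) * radialJacobian Ω p) (double Ω) (medialMeasure Ω) ∧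
      ∫ y in frontier Ω, g y ∂(Measure.euclideanHausdorffMeasure n) =
        ∫ p in double Ω, g (radialMap p) * radialJacobian Ω p ∂(medialMeasure Ω) := by
  have hmap := hΩ.map_radialMap_withDensity hn hB
  have hJm := (hΩ.aemeasurable_radialJacobian hn hB).ennreal_ofReal
  have hlt : ∀ᵐ p ∂(medialMeasure Ω), ENNReal.ofReal (radialJacobian Ω p) < ⊤ :=
    Eventually.of_forall fun p => ENNReal.ofReal_lt_top
  have hcongr : (fun p => (ENNReal.ofReal (radialJacobian Ω p)).toReal • g (radialMap p))
      =ᵐ[medialMeasure Ω] fun p => g (radialMap p) * radialJacobian Ω p := by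
    filter_upwards [hΩ.ae_mem_genericDouble hn hB] with p hp
    rw [ENNReal.toReal_ofReal (hΩ.radialJacobian_pos hp).le, smul_eq_mul, mul_comm]
  rw [IntegrableOn, ← hmap] at hg
  rw [IntegrableOn, hΩ.medialMeasure_restrict_double hn hB, ← hmap,
    integral_map continuous_radialMap.aemeasurable hg.aestronglyMeasurable,
    integral_withDensity_eq_integral_toReal_smul₀ hJm hlt, integral_congr_ae hcongr]
  refine ⟨?_, rfl⟩
  rw [integrable_map_measure hg.aestronglyMeasurable continuous_radialMap.aemeasurable,
    integrable_withDensity_iff_integrable_smul₀' hJm hlt] at hg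
  exact hg.congr hcongr

end ChangeOfVariables

end BlumLinking

theorem mainTheorem10 {n m : ℕ} (hn : 1 ≤ n)
    (Ω : Fin m → Set (BlumLinking.Ambient n))
    (hΩ : BlumLinking.IsMultiRegionConfiguration Ω)
    (hBlum : ∀ i, BlumLinking.HasGenericBlumMedialAxis (Ω i))
    (g : Fin m → BlumLinking.Ambient n → ℝ)
    (hg_meas : ∀ i, Measurable ((frontier (Ω i)).domRestrict (g i)))
    (hg_int : ∀ i, IntegrableOn (g i) (frontier (Ω i)) (Measure.euclideanHausdorffMeasure n)) :
    (∀ i, IntegrableOn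
      (fun p => g i (BlumLinking.radialMap p) * BlumLinking.radialJacobian (Ω i) p)
      (BlumLinking.double (Ω i)) (BlumLinking.medialMeasure (Ω i))) ∧
    BlumLinking.boundaryIntegral Ω g =
      ∑ i, ∫ p in BlumLinking.double (Ω i),
        g i (BlumLinking.radialMap p) * BlumLinking.radialJacobian (Ω i) p
        ∂(BlumLinking.medialMeasure (Ω i)) := by
  have h := fun i => (hΩ.isRegion i).integrableOn_and_setIntegral_frontier_eq hn (hBlum i)
    (hg_int i)
  refine ⟨fun i => (h i).1, ?_⟩
  rw [hΩ.boundaryIntegral_eq hg_int]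
  exact Finset.sum_congr rfl fun i _ => (h i).2
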